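/- **Setting.** Let $\lambda_{\rm m},\lambda_{\rm s},\lambda_{\rm u},\mu>0$. Tiers are $i\in\{{\rm m},{\rm s}\}$ (macro and small-cell base stations, MBSs and SBSs). All powers $P_i$, biases $T_i$, reference losses $\beta_{{\rm a}_i},\beta_{{\rm b}_{\rm m}}$, main-lobe gains $G_i,G_{\rm u}$, the bandwidth $W$ and the noise density ${\tt N}_0$ are positive, side-lobe gains $g_{\rm s},g_{\rm u}\ge 0$, beamwidths $\theta_{\rm s},\theta_{\rm u}\in[0,2\pi]$. Link types are $k\in\{{\rm a}_{\rm m},{\rm a}_{\rm s},{\rm b}_{\rm m}\}$ (access link from an MBS or SBS, backhaul link from an MBS), with pathloss exponents $\alpha_{k,\ell},\alpha_{k,{\rm n}}>0$ and $\alpha_{{\rm a}_{\rm s},{\rm n}}>2$. *Network.* The points $\Phi_{\rm m},\Phi_{\rm s}$ are independent homogeneous Poisson processes in $\mathbb R^2$ of densities $\lambda_{\rm m},\lambda_{\rm s}$. A link of type $k$ and length $r$ is line-of-sight with probability $e^{-r/\mu}$, independently of all others, and its pathloss is $L_k=r^{\alpha_{k,\ell}}$ if so and $L_k=r^{\alpha_{k,{\rm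 n}}}$ otherwise. All links have i.i.d. $\exp(1)$ fading $h$. The typical UE at the origin is served by the base station ${\bf x}^*$ that maximizes $P_iT_i\beta_{{\rm a}_i}G_iG_{\rm u}L_{{\rm a}_i}({\bf x})^{-1}$ over ${\bf x}\in\Phi_i$, $i\in\{{\rm m},{\rm s}\}$; put ${\cal A}_i=\mathbb P({\bf x}^*\in\Phi_i)$. On $\{{\bf x}^*\in\Phi_i\}$, $${\tt SINR}_{\rm a}=\frac{P_iG_iG_{\rm u}\beta_{{\rm a}_i}h_{{\bf x}^*}L_{{\rm a}_i}({\bf x}^*)^{-1}}{\sum_{{\bf x}\in\Phi_{\rm s}\setminus\{{\bf x}^*\}}P_{\rm s}h_{\bf x}\beta_{{\rm a}_{\rm s}}\psi_{\bf x}L_{{\rm a}_{\rm s}}({\bf x})^{-1}+{\tt N}_0W}$$ (interference from MBSs is neglected), with i.i.d. gains $\psi_{\bf x}$ taking the values $G_{\rm s}G_{\rm u},\ g_{\rm s}G_{\rm u},\ G_{\rm s}g_{\rm u},\ g_{\rm s}g_{\rm u}$ with probabilities $p_{\cal G}$ equal to $\frac{\theta_{\rm s}\theta_{\rm u}}{4\pi^2},\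 \frac{(2\pi-\theta_{\rm s})\theta_{\rm u}}{4\pi^2},\ \frac{\theta_{\rm s}(2\pi-\theta_{\rm u})}{4\pi^2},\ \frac{(2\pi-\theta_{\rm s})(2\pi-\theta_{\rm u})}{4\pi^2}$. The backhaul is noise-limited and independent of the access side: ${\tt SNR}_{\rm b}=P_{\rm m}G_{\rm m}G_{\rm s}\beta_{{\rm b}_{\rm m}}\,h\,\tilde L^{-1}/({\tt N}_0W)$, where $\tilde L$ is the least pathloss from an independent copy of $\Phi_{\rm m}$ to a typical SBS at the origin and $h\sim\exp(1)$ is independent. *Loads.* Put, for $n\ge1$ and $n\ge 0$ respectively, $${\tt K}_t(n;\lambda,\lambda')=\tfrac{3.5^{3.5}}{(n-1)!}\tfrac{\Gamma(n+3.5)}{\Gamma(3.5)}\big(\tfrac{\lambda'}{\lambda}\big)^{n-1}\big(3.5+\tfrac{\lambda'}{\lambda}\big)^{-n-3.5},\qquad {\tt K}(n;\lambda,\lambda')=\tfrac{3.5^{3.5}}{n!}\tfrac{\Gamma(n+3.5)}{\Gamma(3.5)}\big(\tfrac{\lambda'}{\lambda}\big)^{n}\big(3.5+\tfrac{\lambda'}{\lambda}\big)^{-n-3.5}.$$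 Given ${\bf x}^*\in\Phi_i$, the load $N$ of the tagged base station has PMF ${\tt K}_t(\cdot;\lambda_i/{\cal A}_i,\lambda_{\rm u})$ and is independent of the links. All other loads are replaced by their means: $M$, the mean of ${\tt K}(\cdot;\lambda_{\rm m}/{\cal A}_{\rm m},\lambda_{\rm u})$, for the UEs directly served by the anchor MBS; and $S$, the mean of ${\tt K}(\cdot;\lambda_{\rm s}/{\cal A}_{\rm s},\lambda_{\rm u})$ times the mean of ${\tt K}(\cdot;\lambda_{\rm m},\lambda_{\rm s})$, for the UEs of all (respectively, of the other) SBSs in a backhaul cell. *Rates.* With $\omega=N/(M+N+S)$ and $\eta_{\rm a}\in(0,1)$, $${\tt Rate}_{\rm IRA}=\begin{cases}\frac{W}{N+S}\log_2(1+{\tt SINR}_{\rm a}),&{\bf x}^*\in\Phi_{\rm m},\\ \frac WN\min\big(\omega\log_2(1+{\tt SNR}_{\rm b}),(1-\omega)\log_2(1+{\tt SINR}_{\rm a})\big),&{\bf x}^*\in\Phi_{\rm s},\end{cases}$$ $${\tt Rate}_{\rm ORA}=\begin{cases}\frac{\eta_{\rm a}W}{N}\log_2(1+{\tt SINR}_{\rm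 a}),&{\bf x}^*\in\Phi_{\rm m},\\ \min\big(\frac{\eta_{\rm a}W}{N}\log_2(1+{\tt SINR}_{\rm a}),\frac{(1-\eta_{\rm a})W}{N+S}\log_2(1+{\tt SNR}_{\rm b})\big),&{\bf x}^*\in\Phi_{\rm s}.\end{cases}$$ *Notation for the formulas.* $\Omega_{j,i}=\frac{P_jT_j\beta_{{\rm a}_j}G_j}{P_iT_i\beta_{{\rm a}_i}G_i}$. For a link type $k$ with transmitter tier of density $\lambda_i$, $$\Lambda_k(l)=2\pi\lambda_i\Big[\mu\big(\mu-e^{-l^{1/\alpha_{k,\ell}}/\mu}(l^{1/\alpha_{k,\ell}}+\mu)\big)+\tfrac12l^{2/\alpha_{k,{\rm n}}}-\mu\big(\mu-e^{-l^{1/\alpha_{k,{\rm n}}}/\mu}(l^{1/\alpha_{k,{\rm n}}}+\mu)\big)\Big],$$ $$\lambda_k(l)=\Lambda_k'(l)=2\pi\lambda_i\Big[\tfrac1{\alpha_{k,\ell}}l^{\frac2{\alpha_{k,\ell}}-1}e^{-l^{1/\alpha_{k,\ell}}/\mu}+\tfrac1{\alpha_{k,{\rm n}}}l^{\frac2{\alpha_{k,{\rm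 n}}}-1}\big(1-e^{-l^{1/\alpha_{k,{\rm n}}}/\mu}\big)\Big].$$ **Theorem.** The following hold. (1) For $i\in\{{\rm m},{\rm s}\}$, ${\cal A}_i=\int_0^\infty e^{-\sum_j\Lambda_{{\rm a}_j}(\Omega_{j,i}l)}\lambda_{{\rm a}_i}(l)\,{\rm d}l>0$. (2) For $\tau\ge0$ and $i\in\{{\rm m},{\rm s}\}$, $\mathbb P({\tt SINR}_{\rm a}>\tau\mid{\bf x}^*\in\Phi_i)=C_i(\tau)$, where $$C_i(\tau)=\frac1{{\cal A}_i}\int_0^\infty\exp\Big(-\sum_{\cal G}\int_{\Omega_{{\rm s},i}l}^\infty\Big(1-\frac1{1+\frac{\tau P_{\rm s}\beta_{{\rm a}_{\rm s}}{\cal G}l}{P_i\beta_{{\rm a}_i}G_iG_{\rm u}z}}\Big)p_{\cal G}\lambda_{{\rm a}_{\rm s}}(z)\,{\rm d}z-\frac{\tau{\tt N}_0Wl}{P_i\beta_{{\rm a}_i}G_iG_{\rm u}}-\sum_j\Lambda_{{\rm a}_j}(\Omega_{j,i}l)\Big)\lambda_{{\rm a}_i}(l)\,{\rm d}l,$$ the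 sum being over the four gain values ${\cal G}$. Moreover $\mathbb P({\tt SNR}_{\rm b}>\tau)=B(\tau)$ with $$B(\tau)=\int_0^\infty\exp\Big(-\frac{\tau{\tt N}_0Wl}{P_{\rm m}\beta_{{\rm b}_{\rm m}}G_{\rm m}G_{\rm s}}-\Lambda_{{\rm b}_{\rm m}}(l)\Big)\lambda_{{\rm b}_{\rm m}}(l)\,{\rm d}l,$$ and for $\tau_1,\tau_2\ge0$ the joint SBS and backhaul coverage is $\mathbb P({\tt SINR}_{\rm a}>\tau_1,{\tt SNR}_{\rm b}>\tau_2\mid{\bf x}^*\in\Phi_{\rm s})=C_{\rm s}(\tau_1)B(\tau_2)$. (3) For every $\rho\ge0$, with convergent series, $$\mathbb P({\tt Rate}_{\rm IRA}>\rho)={\cal A}_{\rm m}\sum_{n\ge1}C_{\rm m}\Big(2^{\frac\rho W(n+\frac{{\cal A}_{\rm s}\lambda_{\rm u}}{\lambda_{\rm m}})}-1\Big){\tt K}_t\Big(n;\frac{\lambda_{\rm m}}{{\cal A}_{\rm m}},\lambda_{\rm u}\Big)+{\cal A}_{\rm s}\sum_{n\ge1}C_{\rm s}\Big(2^{\frac{\rho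 n}W(1+\frac{\lambda_{\rm m}n}{\lambda_{\rm u}})}-1\Big)B\Big(2^{\frac{\rho}{W}(n+\frac{\lambda_{\rm u}}{\lambda_{\rm m}})}-1\Big){\tt K}_t\Big(n;\frac{\lambda_{\rm s}}{{\cal A}_{\rm s}},\lambda_{\rm u}\Big),$$ $$\mathbb P({\tt Rate}_{\rm ORA}>\rho)={\cal A}_{\rm m}\sum_{n\ge1}C_{\rm m}\Big(2^{\frac{\rho n}{\eta_{\rm a}W}}-1\Big){\tt K}_t\Big(n;\frac{\lambda_{\rm m}}{{\cal A}_{\rm m}},\lambda_{\rm u}\Big)+{\cal A}_{\rm s}\sum_{n\ge1}C_{\rm s}\Big(2^{\frac{\rho n}{\eta_{\rm a}W}}-1\Big)B\Big(2^{\frac{\rho}{W(1-\eta_{\rm a})}(n+\frac{{\cal A}_{\rm s}\lambda_{\rm u}}{\lambda_{\rm m}})}-1\Big){\tt K}_t\Big(n;\frac{\lambda_{\rm s}}{{\cal A}_{\rm s}},\lambda_{\rm u}\Big).$$ -/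

import Mathlib

open MeasureTheory ProbabilityTheory
open scoped ENNReal

noncomputable section

namespace IAB

/-! ## Parameters of the network -/

/-- The two tiers of base stations: macro (MBS) and small cell (SBS). -/
inductive Tier
  | mbs
  | sbs

instance : Nonempty Tier := ⟨.mbs⟩

/-- The types of links: access links (typical UE to a BS of the given tier) and backhaul links
(typical SBS to an MBS). -/
inductive Link
  | access (i : Tier)
  | backhaul

/-- The tier to which the transmitter of a link belongs. -/
def Link.tier : Link → Tier
  | .access i => i
  | .backhaul => .mbs

/-- Line-of-sight and non-line-of-sight states of a link. -/
inductive LinkState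
  | los
  | nlos

/-- System parameters (linear units). -/
structure Params where
  /-- densities of the MBS and SBS point processes -/
  density : Tier → ℝ
  /-- density of the UE point process -/
  userDensity : ℝ
  /-- LOS range constant of the blocking model -/
  losRange : ℝ
  /-- pathloss exponents -/
  exponent : Link → LinkState → ℝ
  /-- transmit powers over the whole bandwidth -/
  power : Tier → ℝ
  /-- association bias factors -/
  bias : Tier → ℝ
  /-- propagation losses at the reference distance -/
  refLoss : Link → ℝ
  /-- main lobe gains of the BSs -/
  gain : Tier → ℝ
  /-- main lobe gain of the UEs -/
  userGain : ℝ
  /-- side lobe gain of the SBSs -/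
  sbsSideGain : ℝ
  /-- side lobe gain of the UEs -/
  userSideGain : ℝ
  /-- beamwidth of the SBSs -/
  sbsBeamwidth : ℝ
  /-- beamwidth of the UEs -/
  userBeamwidth : ℝ
  /-- system bandwidth -/
  bandwidth : ℝ
  /-- noise power spectral density -/
  noisePSD : ℝ
  density_pos : ∀ i, 0 < density i
  userDensity_pos : 0 < userDensity
  losRange_pos : 0 < losRange
  exponent_pos : ∀ k s, 0 < exponent k s
  /-- the aggregate interference of the (mostly NLOS) far SBSs is finite -/
  two_lt_exponent : 2 < exponent (.access .sbs) .nlos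
  power_pos : ∀ i, 0 < power i
  bias_pos : ∀ i, 0 < bias i
  refLoss_pos : ∀ k, 0 < refLoss k
  gain_pos : ∀ i, 0 < gain i
  userGain_pos : 0 < userGain
  sbsSideGain_nonneg : 0 ≤ sbsSideGain
  userSideGain_nonneg : 0 ≤ userSideGain
  sbsBeamwidth_mem : sbsBeamwidth ∈ Set.Icc 0 (2 * Real.pi)
  userBeamwidth_mem : userBeamwidth ∈ Set.Icc 0 (2 * Real.pi)
  bandwidth_pos : 0 < bandwidth
  noisePSD_pos : 0 < noisePSD

/-- The noise power `N₀ W`. -/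
def Params.noise (p : Params) : ℝ := p.noisePSD * p.bandwidth

/-- Effective antenna gain of an interfering access link from an SBS; the first flag says whether
the UE lies in the main lobe of the SBS, the second one whether the SBS lies in the main lobe of
the UE. -/
def Params.interfGain (p : Params) (b : Bool × Bool) : ℝ :=
  (if b.1 then p.gain .sbs else p.sbsSideGain) * (if b.2 then p.userGain else p.userSideGain)

/-- Probability of the gain `interfGain b`. -/
def Params.interfGainProb (p : Params) (b : Bool × Bool) : ℝ :=
  (if b.1 then p.sbsBeamwidth else 2 * Real.pi - p.sbsBeamwidth) *
    (if b.2 then p.userBeamwidth else 2 * Real.pi - p.userBeamwidth) / (4 * Real.pi ^ 2)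

/-- `Ω_{j,i}`, the ratio of the biased powers of tiers `j` and `i`. -/
def Params.biasRatio (p : Params) (j i : Tier) : ℝ :=
  (p.power j * p.bias j * p.refLoss (.access j) * p.gain j) /
    (p.power i * p.bias i * p.refLoss (.access i) * p.gain i)

/-! ## Load kernels -/

/-- The load kernel `K(n; lam, lamU)`, `n ≥ 0` (load of a typical cell of a tessellation with
mean cell area `1 / lam`). -/
def loadK (n : ℕ) (lam lamU : ℝ) : ℝ :=
  (3.5 : ℝ) ^ (3.5 : ℝ) / (n.factorial : ℝ) * (Real.Gamma (n + 3.5) / Real.Gamma 3.5) *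
    (lamU / lam) ^ n * (3.5 + lamU / lam) ^ (-(n : ℝ) - 3.5)

/-- The load kernel `K_t(n; lam, lamU)`, supported on `n ≥ 1` (load of the tagged cell). -/
def loadKt (n : ℕ) (lam lamU : ℝ) : ℝ :=
  if n = 0 then 0 else
    (3.5 : ℝ) ^ (3.5 : ℝ) / ((n - 1).factorial : ℝ) * (Real.Gamma (n + 3.5) / Real.Gamma 3.5) *
      (lamU / lam) ^ (n - 1) * (3.5 + lamU / lam) ^ (-(n : ℝ) - 3.5)

/-- Mean of the load distribution `K(·; lam, lamU)`. -/
def meanLoad (lam lamU : ℝ) : ℝ := ∑' n : ℕ, (n : ℝ) * loadK n lam lamU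

/-! ## The random network -/

/-- The plane in which the network lives, with its Euclidean norm. -/
abbrev Plane := EuclideanSpace ℝ (Fin 2)

/-- The counting measure of a point process given by an enumeration of its points. -/
def countingMeasure (pts : ℕ → Plane) : Measure Plane :=
  Measure.sum fun n => Measure.dirac (pts n)

/-- The random points `Φ` form a homogeneous Poisson point process of density `lam`: the number of
points in a measurable set of finite area is Poisson distributed with mean `lam` times the area,
and the numbers of points in disjoint measurable sets are independent. -/
structure IsPoissonProcess {Ω : Type*} [MeasurableSpace Ω] (P : Measure Ω)
    (Φ : Ω → ℕ → Plane) (lam : ℝ) : Prop where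
  measurable : Measurable Φ
  count_law : ∀ A : Set Plane, MeasurableSet A → volume A ≠ ∞ → ∀ k : ℕ,
    P {ω | countingMeasure (Φ ω) A = k} =
      ENNReal.ofReal (Real.exp (-(lam * (volume A).toReal)) *
        (lam * (volume A).toReal) ^ k / (k.factorial : ℝ))
  count_indep : ∀ (m : ℕ) (A : Fin m → Set Plane), (∀ i, MeasurableSet (A i)) →
    Pairwise (fun i j => Disjoint (A i) (A j)) →
    iIndepFun (fun i ω => countingMeasure (Φ ω) (A i)) P

/-- The sources of randomness. `points (access i)` are the BSs of tier `i` as seen from the typical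
UE at the origin; `points backhaul` are the MBSs as seen from the typical SBS at the origin. For
the `n`-th point, `blocking` decides the state of its link, `fading` is the fading of its link,
and (interfering SBSs) the two beam marks say whether the link lies in the main lobes. `load i`
is the number of UEs in the tagged cell if the tagged BS belongs to tier `i`. -/
inductive Source
  | points (k : Link)
  | blocking (k : Link) (n : ℕ)
  | fading (k : Link) (n : ℕ)
  | sbsBeam (n : ℕ)
  | userBeam (n : ℕ)
  | load (i : Tier)

/-- The space in which a source of randomness takes its values. -/
def Source.Val : Source → Type
  | .points _ => ℕ → Plane
  | .blocking _ _ => ℝ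
  | .fading _ _ => ℝ
  | .sbsBeam _ => Bool
  | .userBeam _ => Bool
  | .load _ => ℕ

instance Source.measurableSpaceVal : ∀ s : Source, MeasurableSpace s.Val
  | .points _ => inferInstanceAs (MeasurableSpace (ℕ → Plane))
  | .blocking _ _ => inferInstanceAs (MeasurableSpace ℝ)
  | .fading _ _ => inferInstanceAs (MeasurableSpace ℝ)
  | .sbsBeam _ => inferInstanceAs (MeasurableSpace Bool)
  | .userBeam _ => inferInstanceAs (MeasurableSpace Bool)
  | .load _ => inferInstanceAs (MeasurableSpace ℕ)

section Network

variable {Ω : Type*} (p : Params) (X : ∀ s : Source, Ω → s.Val)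

/-- The `n`-th point of a point process. -/
def point (k : Link) (n : ℕ) (ω : Ω) : Plane := (X (.points k) ω : ℕ → Plane) n

/-- The blocking variable of the `n`-th link. -/
def blockVar (k : Link) (n : ℕ) (ω : Ω) : ℝ := X (.blocking k n) ω

/-- The fading of the `n`-th link. -/
def fadingVar (k : Link) (n : ℕ) (ω : Ω) : ℝ := X (.fading k n) ω

/-- The beam marks of the `n`-th SBS. -/
def beamVar (n : ℕ) (ω : Ω) : Bool × Bool := (X (.sbsBeam n) ω, X (.userBeam n) ω)

/-- The load of the tagged cell if the tagged BS is of tier `i`. -/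
def loadVar (i : Tier) (ω : Ω) : ℕ := X (.load i) ω

/-- A link of length `r` is LOS iff its (uniform) blocking variable is at most `exp (-r / μ)`. -/
def linkState (k : Link) (n : ℕ) (ω : Ω) : LinkState :=
  open Classical in
  if blockVar X k n ω ≤ Real.exp (-‖point X k n ω‖ / p.losRange) then .los else .nlos

/-- Pathloss of the `n`-th link. -/
def pathloss (k : Link) (n : ℕ) (ω : Ω) : ℝ :=
  ‖point X k n ω‖ ^ p.exponent k (linkState p X k n ω)

/-- Biased average power received by the typical UE from the `q.2`-th BS of tier `q.1`. -/
def biasedPower (q : Tier × ℕ) (ω : Ω) : ℝ :=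
  p.power q.1 * p.bias q.1 * p.refLoss (.access q.1) * p.gain q.1 * p.userGain *
    (pathloss p X (.access q.1) q.2 ω)⁻¹

/-- The tagged BS: the one with maximum biased average received power. -/
def taggedBS (ω : Ω) : Tier × ℕ :=
  Classical.epsilon fun q => ∀ q', biasedPower p X q' ω ≤ biasedPower p X q ω

/-- The event that the tagged BS belongs to tier `i`. -/
def assocEvent (i : Tier) : Set Ω := {ω | (taggedBS p X ω).1 = i}

/-- The anchor MBS of the typical SBS: the MBS with maximum average power received there. -/
def anchorMBS (ω : Ω) : ℕ :=
  Classical.epsilon fun n => ∀ n',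
    p.power .mbs * p.refLoss .backhaul * p.gain .mbs * p.gain .sbs *
        (pathloss p X .backhaul n' ω)⁻¹ ≤
      p.power .mbs * p.refLoss .backhaul * p.gain .mbs * p.gain .sbs *
        (pathloss p X .backhaul n ω)⁻¹

/-- Aggregate interference at the typical UE from all SBSs other than its tagged BS. -/
def interference (ω : Ω) : ℝ≥0∞ :=
  open Classical in
  ∑' n : ℕ, if taggedBS p X ω = (.sbs, n) then 0 else
    ENNReal.ofReal (p.power .sbs * fadingVar X (.access .sbs) n ω * p.refLoss (.access .sbs) *
      p.interfGain (beamVar X n ω) * (pathloss p X (.access .sbs) n ω)⁻¹)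

/-- SINR of the access link between the typical UE and its tagged BS. -/
def sinrAccess (ω : Ω) : ℝ :=
  let q := taggedBS p X ω
  (ENNReal.ofReal (p.power q.1 * p.gain q.1 * p.userGain * p.refLoss (.access q.1) *
      fadingVar X (.access q.1) q.2 ω * (pathloss p X (.access q.1) q.2 ω)⁻¹) /
    (interference p X ω + ENNReal.ofReal p.noise)).toReal

/-- SNR of the backhaul link between the typical SBS and its anchor MBS. -/
def snrBackhaul (ω : Ω) : ℝ :=
  p.power .mbs * p.gain .mbs * p.gain .sbs * p.refLoss .backhaul *
    fadingVar X .backhaul (anchorMBS p X ω) ω *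
      (pathloss p X .backhaul (anchorMBS p X ω) ω)⁻¹ / p.noise

variable [MeasurableSpace Ω] (P : Measure Ω)

/-- Association probability of tier `i`. -/
def assocProb (i : Tier) : ℝ := P.real (assocEvent p X i)

/-- The joint law of the network: independent sources, homogeneous Poisson BSs, independent
exponential blocking, Rayleigh fading, uniform beam directions of the interferers, and
tagged-cell loads distributed according to `K_t(·; λ_i / A_i, λ_u)`. -/
structure IsNetwork : Prop where
  measurable : ∀ s, Measurable (X s)
  indep : iIndepFun X P
  points_law : ∀ k, IsPoissonProcess P (fun ω n => point X k n ω) (p.density k.tier)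
  blocking_law : ∀ k n, P.map (blockVar X k n) = volume.restrict (Set.Icc 0 1)
  fading_law : ∀ k n, P.map (fadingVar X k n) = expMeasure 1
  sbsBeam_law : ∀ n, P {ω | (beamVar X n ω).1 = true} =
    ENNReal.ofReal (p.sbsBeamwidth / (2 * Real.pi))
  userBeam_law : ∀ n, P {ω | (beamVar X n ω).2 = true} =
    ENNReal.ofReal (p.userBeamwidth / (2 * Real.pi))
  load_law : ∀ i n, P {ω | loadVar X i ω = n} =
    ENNReal.ofReal (loadKt n (p.density i / assocProb p X P i) p.userDensity)

/-! ## Data rates -/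

/-- Mean number of UEs in a typical access cell of tier `i`. -/
def meanUsers (i : Tier) : ℝ := meanLoad (p.density i / assocProb p X P i) p.userDensity

/-- Mean total number of UEs served by the SBSs of a backhaul cell: mean number of UEs per SBS
times the mean number of SBSs in the cell. -/
def meanBackhauledUsers : ℝ :=
  meanUsers p X P .sbs * meanLoad (p.density .mbs) (p.density .sbs)

/-- Fraction `ω` of the resources of the anchor MBS that integrated resource allocation gives to
the backhaul of an SBS with load `n`, when the anchor MBS directly serves `M` UEs and its other
SBSs serve `S` UEs. -/
def backhaulFraction (n M S : ℝ) : ℝ := n / (M + (n + S))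

/-- Rate of the typical UE under integrated resource allocation; the load of the tagged BS is
random, the remaining loads are replaced by their means. -/
def rateIRA (ω : Ω) : ℝ :=
  match (taggedBS p X ω).1 with
  | .mbs => p.bandwidth / (loadVar X .mbs ω + meanBackhauledUsers p X P) *
      Real.logb 2 (1 + sinrAccess p X ω)
  | .sbs =>
      let w := backhaulFraction (loadVar X .sbs ω) (meanUsers p X P .mbs)
        (meanBackhauledUsers p X P)
      p.bandwidth / loadVar X .sbs ω *
        min (w * Real.logb 2 (1 + snrBackhaul p X ω))
          ((1 - w) * Real.logb 2 (1 + sinrAccess p X ω))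

/-- Rate of the typical UE under orthogonal resource allocation with a fraction `η` of the
bandwidth reserved for access; the load of the tagged BS is random, the remaining loads are
replaced by their means. -/
def rateORA (η : ℝ) (ω : Ω) : ℝ :=
  match (taggedBS p X ω).1 with
  | .mbs => η * p.bandwidth / loadVar X .mbs ω * Real.logb 2 (1 + sinrAccess p X ω)
  | .sbs =>
      min (η * p.bandwidth / loadVar X .sbs ω * Real.logb 2 (1 + sinrAccess p X ω))
        ((1 - η) * p.bandwidth / (loadVar X .sbs ω + meanBackhauledUsers p X P) *
          Real.logb 2 (1 + snrBackhaul p X ω))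

end Network

/-! ## The explicit expressions -/

section Formulas

variable (p : Params)

/-- Intensity measure `Λ_k((0, l])` of the pathloss process of links of type `k`. -/
def pathlossIntensity (k : Link) (l : ℝ) : ℝ :=
  let μ := p.losRange
  let aL := p.exponent k .los
  let aN := p.exponent k .nlos
  2 * Real.pi * p.density k.tier *
    (μ * (μ - Real.exp (-(l ^ (1 / aL)) / μ) * (l ^ (1 / aL) + μ)) +
      l ^ (2 / aN) / 2 - μ * (μ - Real.exp (-(l ^ (1 / aN)) / μ) * (l ^ (1 / aN) + μ)))

/-- Density `λ_k(l)` of the pathloss process of links of type `k`. -/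
def pathlossDensity (k : Link) (l : ℝ) : ℝ :=
  let μ := p.losRange
  let aL := p.exponent k .los
  let aN := p.exponent k .nlos
  2 * Real.pi * p.density k.tier *
    (1 / aL * l ^ (2 / aL - 1) * Real.exp (-(l ^ (1 / aL)) / μ) +
      1 / aN * l ^ (2 / aN - 1) * (1 - Real.exp (-(l ^ (1 / aN)) / μ)))

/-- The integral expression of the association probability of tier `i`. -/
def assocFormula (i : Tier) : ℝ :=
  ∫ l in Set.Ioi (0 : ℝ),
    Real.exp (-(pathlossIntensity p (.access .mbs) (p.biasRatio .mbs i * l) +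
      pathlossIntensity p (.access .sbs) (p.biasRatio .sbs i * l))) *
      pathlossDensity p (.access i) l

/-- The integral expression of the access coverage at threshold `τ` given association to tier
`i`. -/
def accessCoverage (i : Tier) (τ : ℝ) : ℝ :=
  1 / assocFormula p i * ∫ l in Set.Ioi (0 : ℝ),
    Real.exp (-(∑ b : Bool × Bool, ∫ z in Set.Ioi (p.biasRatio .sbs i * l),
          (1 - 1 / (1 + τ * p.power .sbs * p.refLoss (.access .sbs) * p.interfGain b * l /
            (p.power i * p.refLoss (.access i) * p.gain i * p.userGain * z))) *
            p.interfGainProb b * pathlossDensity p (.access .sbs) z)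
        - τ * p.noise * l / (p.power i * p.refLoss (.access i) * p.gain i * p.userGain)
        - (pathlossIntensity p (.access .mbs) (p.biasRatio .mbs i * l) +
            pathlossIntensity p (.access .sbs) (p.biasRatio .sbs i * l))) *
      pathlossDensity p (.access i) l

/-- The integral expression of the coverage of the typical backhaul link at threshold `τ`. -/
def backhaulCoverage (τ : ℝ) : ℝ :=
  ∫ l in Set.Ioi (0 : ℝ),
    Real.exp (-(τ * p.noise * l / (p.power .mbs * p.refLoss .backhaul * p.gain .mbs * p.gain .sbs))
        - pathlossIntensity p .backhaul l) *
      pathlossDensity p .backhaul l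

end Formulas

end IAB

end

set_option linter.unusedSectionVars false

/-! A BS seen from the typical UE is a point with a loss ℓ (the inverse of its biased power) and an
interference weight w; the tagged BS is the point of least loss. Since the fading of the tagged link
is exponential, the conditional probability that it beats the threshold cℓ(I + N), given everything
else, is exp(-cℓ(I + N)). This is a noise factor times a product over the other points. The
requirement that no other point has smaller loss is a product of the same kind, in which a nearer
point costs ∞. Hence the probability that the n-th point is tagged and covered is the mean of the
noise factor times exp(-∑_{k ≠ n} `nearCost`), and summing over n calls for the Mecke formula: with
m the intensity of the marked points, the sum is the integral over m(dy) of the noise factor at ℓ(y)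
times exp(-∫ (1 - exp(-`nearCost`)) dm). In the inner integral the nearer points give the void
exponent ∑_j Λ_j, and the farther SBSs give 1 - 1/(1 + t) after their own fading is averaged. Polar
coordinates and the substitution l = r^α turn m into λ_k(l) dl. The threshold τ = 0 yields the
association probabilities.

The Poisson processes enter through their Laplace functional, which passes from counts to simple
functions to measurable functions (`IsPoissonProcess.isPPP`) and is stable under mapping, marking
and superposition. Differentiating it gives a weighted Campbell formula
(`IsPPP.lintegral_tsum_mul_expNeg`). Dividing out the factor of the distinguished point gives the
Mecke formula for a fixed exponent. Quantising the loss of that point from below and passing to the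
limit gives the exponent depending on this loss (`IsPPP.mecke`).

The expected number of points of least loss is ∫ e^{-Λ} dΛ = 1, and at least one exists because only
finitely many points lie below any level. So the tagged BS is almost surely unique
(`IsPPP.ae_existsUnique_isNearest`), and the coverage events of distinct candidates are almost
surely disjoint. With `IsPPP.tsum_measure_fadingThreshold_lt` and `nearExponent_access` this gives
the coverage formulas. The backhaul is the same argument with w = 0, and the joint law is a product
because access, backhaul and load use disjoint families of independent sources.

For the rates, the event is cut by the tier and the load n of the tagged BS (`exists_hasSum_rate`),
so the series converge by countable additivity. For fixed n the rate condition is a lower bound on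
SINR, together with one on SNR in the SBS case. The mean loads come from the negative binomial
series, `K(·; λ, λ')` having mean λ'/λ, and A_m + A_s = 1 collapses M + S to λ_u/λ_m. -/

namespace IAB

/-! ## The function `x ↦ exp (-x)` on the extended nonnegative reals -/

open Filter Topology

/-- `exp (-x)` for an extended nonnegative real `x`. -/
noncomputable def expNeg (x : ℝ≥0∞) : ℝ≥0∞ := EReal.exp (-(x : EReal))

lemma expNeg_ofReal {x : ℝ} (hx : 0 ≤ x) :
    expNeg (ENNReal.ofReal x) = ENNReal.ofReal (Real.exp (-x)) := by
  unfold expNeg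
  rw [EReal.coe_ennreal_ofReal, max_eq_left hx, ← EReal.coe_neg, EReal.exp_coe]

lemma expNeg_eq_of_ne_top {x : ℝ≥0∞} (hx : x ≠ ∞) :
    expNeg x = ENNReal.ofReal (Real.exp (-x.toReal)) := by
  rw [← expNeg_ofReal ENNReal.toReal_nonneg, ENNReal.ofReal_toReal hx]

@[simp] lemma expNeg_zero : expNeg 0 = 1 := by simp [expNeg]

@[simp] lemma expNeg_top : expNeg ∞ = 0 := by simp [expNeg]

lemma expNeg_add (x y : ℝ≥0∞) : expNeg (x + y) = expNeg x * expNeg y := by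
  by_cases hx : x = ∞
  · simp [hx]
  by_cases hy : y = ∞
  · simp [hy]
  rw [expNeg_eq_of_ne_top hx, expNeg_eq_of_ne_top hy,
    expNeg_eq_of_ne_top (ENNReal.add_ne_top.2 ⟨hx, hy⟩), ENNReal.toReal_add hx hy,
    ← ENNReal.ofReal_mul (Real.exp_pos _).le, ← Real.exp_add]
  ring_nf

lemma continuous_expNeg : Continuous expNeg :=
  ENNReal.continuous_exp.comp (continuous_neg.comp continuous_coe_ennreal_ereal)

@[fun_prop]
lemma measurable_expNeg : Measurable expNeg := continuous_expNeg.measurable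

@[fun_prop]
lemma _root_.Measurable.expNeg {α : Type*} {_ : MeasurableSpace α} {f : α → ℝ≥0∞}
    (hf : Measurable f) : Measurable fun a => expNeg (f a) :=
  measurable_expNeg.comp hf

lemma expNeg_antitone : Antitone expNeg := fun _ _ h =>
  EReal.exp_monotone (EReal.neg_le_neg_iff.2 (EReal.coe_ennreal_le_coe_ennreal_iff.2 h))

lemma expNeg_le_one (x : ℝ≥0∞) : expNeg x ≤ 1 := by
  simpa using expNeg_antitone (zero_le (a := x))

lemma expNeg_ne_top (x : ℝ≥0∞) : expNeg x ≠ ∞ :=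
  ((expNeg_le_one x).trans_lt ENNReal.one_lt_top).ne

lemma expNeg_ne_zero {x : ℝ≥0∞} (hx : x ≠ ∞) : expNeg x ≠ 0 := by
  rw [expNeg_eq_of_ne_top hx]
  simp [Real.exp_pos]

lemma expNeg_sum {ι : Type*} (s : Finset ι) (f : ι → ℝ≥0∞) :
    expNeg (∑ i ∈ s, f i) = ∏ i ∈ s, expNeg (f i) := by
  classical
  induction s using Finset.induction_on with
  | empty => simp
  | insert a s ha ih => rw [Finset.sum_insert ha, Finset.prod_insert ha, expNeg_add, ih]

/-- Continuity of `expNeg` on all of [0, ∞] makes infinite products of exponentials meaningful with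
no summability assumption; divergent sums give the limit 0. -/
lemma tendsto_prod_expNeg {ι : Type*} (f : ι → ℝ≥0∞) :
    Tendsto (fun s : Finset ι => ∏ i ∈ s, expNeg (f i)) atTop (𝓝 (expNeg (∑' i, f i))) := by
  simp_rw [← expNeg_sum]
  exact (continuous_expNeg.tendsto _).comp ENNReal.summable.hasSum

/-- The inverse of `expNeg` on `[0, 1]`. -/
noncomputable def negLog (x : ℝ≥0∞) : ℝ≥0∞ := (-(ENNReal.log x)).toENNReal

lemma expNeg_negLog {x : ℝ≥0∞} (hx : x ≤ 1) : expNeg (negLog x) = x := by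
  have h : 0 ≤ -(ENNReal.log x) := by
    rw [EReal.le_neg, neg_zero, ← ENNReal.log_one]
    exact ENNReal.log_monotone hx
  rw [expNeg, negLog, EReal.coe_toENNReal h, neg_neg, ENNReal.exp_log]

@[fun_prop]
lemma measurable_negLog : Measurable negLog :=
  measurable_ereal_toENNReal.comp
    (continuous_neg.measurable.comp ENNReal.measurable_log)

lemma one_sub_expNeg_le (x : ℝ≥0∞) : 1 - expNeg x ≤ x := by
  by_cases hx : x = ∞
  · simp [hx]
  rw [expNeg_eq_of_ne_top hx, ← ENNReal.ofReal_one,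
    ← ENNReal.ofReal_sub _ (Real.exp_pos _).le]
  apply ENNReal.ofReal_le_of_le_toReal
  linarith [Real.add_one_le_exp (-x.toReal)]

lemma one_sub_expNeg_add (x y : ℝ≥0∞) :
    1 - expNeg (x + y) = (1 - expNeg x) + expNeg x * (1 - expNeg y) := by
  rw [expNeg_add, ENNReal.mul_sub (fun _ _ => expNeg_ne_top x), mul_one]
  exact (tsub_add_tsub_cancel (expNeg_le_one x)
    (mul_le_of_le_one_right' (expNeg_le_one y))).symm

/-- Difference quotients of `1 - exp (-x)` at `0` along the step sizes `2 ^ (-k)`. -/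
noncomputable def expQuot (k : ℕ) (x : ℝ≥0∞) : ℝ≥0∞ := 2 ^ k * (1 - expNeg (x / 2 ^ k))

lemma expQuot_le (k : ℕ) (x : ℝ≥0∞) : expQuot k x ≤ x := by
  unfold expQuot
  refine (mul_le_mul_right (one_sub_expNeg_le _) _).trans_eq ?_
  exact ENNReal.mul_div_cancel (by simp) (by simp)

/-- Concavity of 1 - e^{-x}: cutting a step into two equal halves, the second half contributes at
most as much as the first. -/
lemma expQuot_mono (x : ℝ≥0∞) : Monotone fun k => expQuot k x := by
  refine monotone_nat_of_le_succ fun k => ?_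
  unfold expQuot
  have h : x / 2 ^ k = x / 2 ^ (k + 1) + x / 2 ^ (k + 1) := by
    rw [← ENNReal.add_div, ← two_mul, pow_succ', ENNReal.mul_div_mul_left _ _ (by simp) (by simp)]
  rw [h, one_sub_expNeg_add, pow_succ, mul_assoc]
  gcongr
  rw [two_mul]
  gcongr
  exact mul_le_of_le_one_left' (expNeg_le_one _)

lemma expQuot_mono_right (k : ℕ) : Monotone (expQuot k) := fun x y h => by
  unfold expQuot
  have : expNeg (y / 2 ^ k) ≤ expNeg (x / 2 ^ k) := expNeg_antitone (by gcongr)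
  gcongr

@[fun_prop]
lemma measurable_expQuot (k : ℕ) : Measurable (expQuot k) :=
  ((measurable_const.sub (measurable_id.div_const _).expNeg)).const_mul _

/-- For finite x this is the derivative of 1 - e^{-xt} at t = 0; for x = ∞ the quotient is 2^k
itself. -/
lemma tendsto_expQuot (x : ℝ≥0∞) : Tendsto (fun k => expQuot k x) atTop (𝓝 x) := by
  have h2 : Tendsto (fun k : ℕ => (2 : ℝ) ^ k) atTop atTop :=
    tendsto_pow_atTop_atTop_of_one_lt one_lt_two
  by_cases hx : x = ∞
  · subst hx
    have : (fun k => expQuot k ∞) = fun k : ℕ => ENNReal.ofReal ((2 : ℝ) ^ k) := by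
      ext k
      simp [expQuot, ENNReal.top_div, ENNReal.ofReal_pow]
    rw [this]
    exact ENNReal.tendsto_ofReal_atTop.comp h2
  have key : Tendsto (fun k : ℕ => (2 : ℝ) ^ k * (1 - Real.exp (-(x.toReal / 2 ^ k)))) atTop
      (𝓝 x.toReal) := by
    have hd : HasDerivAt (fun t : ℝ => 1 - Real.exp (-(x.toReal * t))) x.toReal 0 := by
      have := ((((hasDerivAt_id (0 : ℝ)).const_mul x.toReal).neg).exp).const_sub 1
      simpa using this
    have h0 : Tendsto (fun k : ℕ => ((2 : ℝ) ^ k)⁻¹) atTop (𝓝[≠] 0) :=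
      (tendsto_inv_atTop_nhdsGT_zero.comp h2).mono_right
        (nhdsWithin_mono _ fun _ h => ne_of_gt h)
    refine (hd.tendsto_slope.comp h0).congr fun k => ?_
    simp [slope_def_field, div_eq_mul_inv, mul_comm]
  have := ENNReal.tendsto_ofReal key
  rw [ENNReal.ofReal_toReal hx] at this
  refine this.congr fun k => ?_
  rw [ENNReal.ofReal_mul (by positivity), expQuot, ENNReal.ofReal_sub _ (Real.exp_pos _).le,
    ENNReal.ofReal_pow (by simp), ← expNeg_ofReal (by positivity),
    ENNReal.ofReal_div_of_pos (by positivity), ENNReal.ofReal_toReal hx,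
    ENNReal.ofReal_pow (by simp)]
  simp

lemma iSup_expQuot (x : ℝ≥0∞) : ⨆ k, expQuot k x = x :=
  iSup_eq_of_tendsto (expQuot_mono x) (tendsto_expQuot x)


/-! ## Poisson point processes in terms of their Laplace functional -/

section PPP

variable {Ω ι κ E F : Type*} [MeasurableSpace Ω] [MeasurableSpace E] [MeasurableSpace F]
  {P : Measure Ω} {Y : ι → Ω → E} {m : Measure E}

/-- The points `Y i`, `i : ι`, form a Poisson point process with intensity measure `m`: the
Laplace functional is `E exp (-∑ f (Y i)) = exp (-∫ (1 - exp (-f)) dm)`. -/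
structure IsPPP (Y : ι → Ω → E) (P : Measure Ω) (m : Measure E) : Prop where
  measurable : ∀ i, Measurable (Y i)
  laplace : ∀ f : E → ℝ≥0∞, Measurable f →
    ∫⁻ ω, expNeg (∑' i, f (Y i ω)) ∂P = expNeg (∫⁻ y, (1 - expNeg (f y)) ∂m)

/-- The Laplace functional of the image at f is the original one at f ∘ g. -/
lemma IsPPP.map (h : IsPPP Y P m) {g : E → F} (hg : Measurable g) :
    IsPPP (fun i ω => g (Y i ω)) P (m.map g) where
  measurable i := hg.comp (h.measurable i)
  laplace f hf := by
    rw [h.laplace (fun y => f (g y)) (hf.comp hg),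
      lintegral_map (by fun_prop) hg]

lemma IsPPP.reindex (h : IsPPP Y P m) (e : κ ≃ ι) : IsPPP (fun k => Y (e k)) P m where
  measurable k := h.measurable (e k)
  laplace f hf := by
    rw [← h.laplace f hf]
    refine lintegral_congr fun ω => ?_
    rw [e.tsum_eq (fun i => f (Y i ω))]

/-- The exponential of the combined sum splits into two independent factors, and the exponents of
the two Laplace functionals add. -/
lemma IsPPP.superpose [Countable ι] [Countable κ] {Z : κ → Ω → E} {m' : Measure E}
    (hY : IsPPP Y P m) (hZ : IsPPP Z P m')
    (hi : IndepFun (fun ω i => Y i ω) (fun ω k => Z k ω) P) :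
    IsPPP (Sum.elim Y Z) P (m + m') where
  measurable := by rintro (i | k); exacts [hY.measurable i, hZ.measurable k]
  laplace f hf := by
    rw [lintegral_add_measure, expNeg_add, ← hY.laplace f hf, ← hZ.laplace f hf,
      ← lintegral_mul_eq_lintegral_mul_lintegral_of_indepFun''
        (f := fun ω => expNeg (∑' i, f (Y i ω))) (g := fun ω => expNeg (∑' k, f (Z k ω)))]
    · refine lintegral_congr fun ω => ?_
      rw [← expNeg_add, Summable.tsum_sum ENNReal.summable ENNReal.summable]
      rfl
    · exact (Measurable.tsum fun i => hf.comp (hY.measurable i)).expNeg.aemeasurable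
    · exact (Measurable.tsum fun i => hf.comp (hZ.measurable i)).expNeg.aemeasurable
    · exact hi.comp (φ := fun y : ι → E => expNeg (∑' i, f (y i)))
        (ψ := fun z : κ → E => expNeg (∑' i, f (z i)))
        (Measurable.tsum fun i => hf.comp (measurable_pi_apply i)).expNeg
        (Measurable.tsum fun i => hf.comp (measurable_pi_apply i)).expNeg

/-- Independent variables with law `ν`: the expectation of an infinite product. -/
lemma lintegral_expNeg_tsum_of_iIndepFun [Countable ι] [IsProbabilityMeasure P]
    {M : ι → Ω → F} {ν : Measure F} (hM : ∀ i, Measurable (M i)) (hind : iIndepFun M P)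
    (hlaw : ∀ i, P.map (M i) = ν) {f : ι → F → ℝ≥0∞} (hf : ∀ i, Measurable (f i)) :
    ∫⁻ ω, expNeg (∑' i, f i (M i ω)) ∂P =
      expNeg (∑' i, negLog (∫⁻ z, expNeg (f i z) ∂ν)) := by
  have hle : ∀ i, ∫⁻ z, expNeg (f i z) ∂ν ≤ 1 := fun i => by
    have : IsProbabilityMeasure ν := hlaw i ▸ Measure.isProbabilityMeasure_map (hM i).aemeasurable
    refine (lintegral_mono fun z => expNeg_le_one _).trans ?_
    simp
  have h1 : Tendsto (fun s : Finset ι => ∫⁻ ω, ∏ i ∈ s, expNeg (f i (M i ω)) ∂P) atTop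
      (𝓝 (∫⁻ ω, expNeg (∑' i, f i (M i ω)) ∂P)) := by
    refine tendsto_lintegral_filter_of_dominated_convergence (fun _ => 1)
      (Eventually.of_forall fun s => ?_) (Eventually.of_forall fun s => ae_of_all _ fun ω => ?_)
      (by simp) (ae_of_all _ fun ω => tendsto_prod_expNeg _)
    · exact Finset.measurable_prod _ fun i _ => ((hf i).comp (hM i)).expNeg
    · exact Finset.prod_le_one' fun i _ => expNeg_le_one _
  have h2 := tendsto_prod_expNeg (fun i => negLog (∫⁻ z, expNeg (f i z) ∂ν))
  refine tendsto_nhds_unique h1 (h2.congr fun s => ?_)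
  rw [lintegral_prod_eq_prod_lintegral_of_indepFun s
    (fun i ω => expNeg (f i (M i ω)))
    (hind.comp (fun i z => expNeg (f i z)) fun i => (hf i).expNeg)
    (fun i => ((hf i).comp (hM i)).expNeg)]
  refine Finset.prod_congr rfl fun i _ => ?_
  rw [expNeg_negLog (hle i), ← hlaw i, lintegral_map (hf i).expNeg (hM i)]

/-- Marking theorem. -/
lemma IsPPP.marking [Countable ι] [IsProbabilityMeasure P] (hY : IsPPP Y P m) [SFinite m]
    {M : ι → Ω → F} {ν : Measure F} [IsProbabilityMeasure ν] (hM : ∀ i, Measurable (M i))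
    (hind : iIndepFun M P) (hlaw : ∀ i, P.map (M i) = ν)
    (hi : IndepFun (fun ω i => Y i ω) (fun ω i => M i ω) P) :
    IsPPP (fun i ω => (Y i ω, M i ω)) P (m.prod ν) where
  measurable i := (hY.measurable i).prodMk (hM i)
  laplace f hf := by
    have hYm : Measurable fun ω i => Y i ω := measurable_pi_iff.2 hY.measurable
    have hMm : Measurable fun ω i => M i ω := measurable_pi_iff.2 hM
    -- Averaging e^{-f(y, z)} over the mark gives e^{-g(y)} for this g, so that the Laplace
    -- functional of the positions can be applied to g.
    have hg : Measurable fun y => negLog (∫⁻ z, expNeg (f (y, z)) ∂ν) :=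
      measurable_negLog.comp hf.expNeg.lintegral_prod_right'
    have hle : ∀ y, ∫⁻ z, expNeg (f (y, z)) ∂ν ≤ 1 := fun y =>
      (lintegral_mono fun z => expNeg_le_one _).trans (by simp)
    have hmeas : Measurable fun q : (ι → E) × (ι → F) => expNeg (∑' i, f (q.1 i, q.2 i)) :=
      (Measurable.tsum fun i => hf.comp
        (((measurable_pi_apply i).comp measurable_fst).prodMk
          ((measurable_pi_apply i).comp measurable_snd))).expNeg
    -- By independence the marks may be resampled at a separate ω' while the positions stay frozen.
    have key : ∫⁻ ω, expNeg (∑' i, f (Y i ω, M i ω)) ∂P =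
        ∫⁻ ω, ∫⁻ ω', expNeg (∑' i, f (Y i ω, M i ω')) ∂P ∂P := by
      have h1 : ∫⁻ ω, expNeg (∑' i, f (Y i ω, M i ω)) ∂P =
          ∫⁻ q, expNeg (∑' i, f (q.1 i, q.2 i)) ∂(P.map fun ω => ((fun i => Y i ω), fun i => M i ω)) := by
        rw [lintegral_map hmeas (hYm.prodMk hMm)]
      rw [h1, (indepFun_iff_map_prod_eq_prod_map_map hYm.aemeasurable hMm.aemeasurable).1 hi]
      have : IsProbabilityMeasure (P.map fun ω i => M i ω) :=
        Measure.isProbabilityMeasure_map hMm.aemeasurable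
      rw [lintegral_prod _ hmeas.aemeasurable, lintegral_map hmeas.lintegral_prod_right' hYm]
      refine lintegral_congr fun ω => ?_
      exact lintegral_map (hmeas.comp measurable_prodMk_left) hMm
    rw [key]
    have : ∀ ω, ∫⁻ ω', expNeg (∑' i, f (Y i ω, M i ω')) ∂P =
        expNeg (∑' i, negLog (∫⁻ z, expNeg (f (Y i ω, z)) ∂ν)) := fun ω =>
      lintegral_expNeg_tsum_of_iIndepFun hM hind hlaw (f := fun i z => f (Y i ω, z))
        fun i => hf.comp measurable_prodMk_left
    simp_rw [this]
    rw [hY.laplace _ hg, lintegral_prod _ (by fun_prop)]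
    congr 1
    refine lintegral_congr fun y => ?_
    rw [expNeg_negLog (hle y), lintegral_sub (by fun_prop)
      ((hle y).trans_lt ENNReal.one_lt_top).ne (ae_of_all _ fun z => expNeg_le_one _)]
    simp

lemma iSup_lintegral_expQuot_mul {V G : Ω → ℝ≥0∞} (hV : Measurable V) (hG : Measurable G) :
    ⨆ k, ∫⁻ ω, expQuot k (V ω) * G ω ∂P = ∫⁻ ω, V ω * G ω ∂P := by
  have h := lintegral_iSup (μ := P) (f := fun k ω => expQuot k (V ω) * G ω)
    (fun k => by fun_prop) (fun j k hjk ω => mul_le_mul_left (expQuot_mono _ hjk) _)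
  rw [← h]
  refine lintegral_congr fun ω => ?_
  rw [← ENNReal.iSup_mul, iSup_expQuot]

/-- A Campbell formula weighted by an exponential functional. -/
lemma IsPPP.lintegral_tsum_mul_expNeg [Countable ι] [IsProbabilityMeasure P] (hY : IsPPP Y P m)
    {v f : E → ℝ≥0∞} (hv : Measurable v) (hf : Measurable f) :
    ∫⁻ ω, (∑' i, v (Y i ω)) * expNeg (∑' i, f (Y i ω)) ∂P =
      (∫⁻ y, v y * expNeg (f y) ∂m) * expNeg (∫⁻ y, (1 - expNeg (f y)) ∂m) := by
  have hVm : Measurable fun ω => ∑' i, v (Y i ω) :=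
    Measurable.tsum fun i => hv.comp (hY.measurable i)
  have hFm : Measurable fun ω => ∑' i, f (Y i ω) :=
    Measurable.tsum fun i => hf.comp (hY.measurable i)
  set J := ∫⁻ y, (1 - expNeg (f y)) ∂m with hJ
  set d : ℕ → ℝ≥0∞ := fun k => ∫⁻ y, expNeg (f y) * (1 - expNeg (v y / 2 ^ k)) ∂m with hd
  set D := ∫⁻ y, v y * expNeg (f y) ∂m with hD
  -- The factor ∑ v is the increasing limit of difference quotients of exponentials, so the left
  -- side is the derivative of the Laplace functional at f in direction v.
  have hLHS : ∫⁻ ω, (∑' i, v (Y i ω)) * expNeg (∑' i, f (Y i ω)) ∂P =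
      ⨆ k, ∫⁻ ω, expQuot k (∑' i, v (Y i ω)) * expNeg (∑' i, f (Y i ω)) ∂P :=
    (iSup_lintegral_expQuot_mul hVm hFm.expNeg).symm
  -- Each quotient is a difference of Laplace functionals at f and f + v / 2^k, whose exponents are
  -- J and J + d k.
  have hterm : ∀ k, ∫⁻ ω, expQuot k (∑' i, v (Y i ω)) * expNeg (∑' i, f (Y i ω)) ∂P =
      expNeg J * (2 ^ k * (1 - expNeg (d k))) := fun k => by
    have h1 : ∀ ω, expQuot k (∑' i, v (Y i ω)) * expNeg (∑' i, f (Y i ω)) =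
        2 ^ k * (expNeg (∑' i, f (Y i ω)) - expNeg (∑' i, (f (Y i ω) + v (Y i ω) / 2 ^ k))) := by
      intro ω
      rw [expQuot, mul_assoc, ENNReal.sub_mul (fun _ _ => expNeg_ne_top _), one_mul,
        ENNReal.tsum_add, expNeg_add, mul_comm (expNeg (∑' i, f (Y i ω)))]
      simp only [div_eq_mul_inv]
      rw [ENNReal.tsum_mul_right]
    have hfv : Measurable fun y => f y + v y / 2 ^ k := hf.add (hv.div_const _)
    have hFv : Measurable fun ω => ∑' i, (f (Y i ω) + v (Y i ω) / 2 ^ k) :=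
      Measurable.tsum fun i => hfv.comp (hY.measurable i)
    simp_rw [h1]
    rw [lintegral_const_mul _ (by fun_prop), lintegral_sub hFv.expNeg ?_
      (ae_of_all _ fun ω => expNeg_antitone (ENNReal.tsum_le_tsum fun i => le_self_add)),
      hY.laplace f hf, hY.laplace _ hfv, ← hJ]
    · have : ∫⁻ y, (1 - expNeg (f y + v y / 2 ^ k)) ∂m = J + d k := by
        simp_rw [one_sub_expNeg_add]
        rw [lintegral_add_left (by fun_prop)]
      rw [this, expNeg_add, mul_left_comm, ENNReal.mul_sub (fun _ _ => expNeg_ne_top _), mul_one]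
    · rw [hY.laplace _ hfv]
      exact expNeg_ne_top _
  have hdk : ∀ k, 2 ^ k * d k = ∫⁻ y, expQuot k (v y) * expNeg (f y) ∂m := fun k => by
    rw [hd]
    dsimp only
    rw [← lintegral_const_mul _ (by fun_prop)]
    refine lintegral_congr fun y => ?_
    rw [expQuot]; ring
  have hsup : ⨆ k, 2 ^ k * d k = D := by
    simp_rw [hdk]
    exact iSup_lintegral_expQuot_mul hv hf.expNeg
  have hmono : Monotone fun k => 2 ^ k * d k := by
    intro j k hjk
    simp only [hdk]
    exact lintegral_mono fun y => mul_le_mul_left (expQuot_mono _ hjk) _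
  have hq : ∀ k, 2 ^ k * (1 - expNeg (d k)) = expQuot k (2 ^ k * d k) := fun k => by
    rw [expQuot, mul_comm (2 ^ k) (d k), ENNReal.mul_div_cancel_right (by simp) (by simp)]
  rw [hLHS]
  simp_rw [hterm]
  rw [← ENNReal.mul_iSup, mul_comm]
  congr 1
  simp_rw [hq]
  -- Both the quotient and its argument depend on k; as each is monotone, the diagonal supremum
  -- equals the double supremum, evaluated at max j k.
  refine le_antisymm (iSup_le fun k => (expQuot_le _ _).trans (hsup ▸ le_iSup (fun k => 2 ^ k * d k) k)) ?_
  rw [← hsup]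
  refine iSup_le fun j => ?_
  rw [← iSup_expQuot (2 ^ j * d j)]
  refine iSup_le fun k => ?_
  exact le_iSup_of_le (max j k) ((expQuot_mono _ (le_max_right j k)).trans
    (expQuot_mono_right _ (hmono (le_max_left j k))))

/-- Campbell's formula. -/
lemma IsPPP.campbell [Countable ι] [IsProbabilityMeasure P] (hY : IsPPP Y P m)
    {v : E → ℝ≥0∞} (hv : Measurable v) :
    ∫⁻ ω, ∑' i, v (Y i ω) ∂P = ∫⁻ y, v y ∂m := by
  simpa using hY.lintegral_tsum_mul_expNeg hv (f := fun _ => 0) measurable_const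

end PPP


/-! ### The Mecke formula for exponents depending on the loss of the distinguished point -/

section Mecke

variable {Ω ι E : Type*} [MeasurableSpace Ω] [MeasurableSpace E] [Countable ι]
  {P : Measure Ω} [IsProbabilityMeasure P] {Y : ι → Ω → E} {m : Measure E}

open Classical in
/-- The Mecke formula for an exponential functional of the remaining points. -/
lemma IsPPP.mecke_const (hY : IsPPP Y P m) {v f : E → ℝ≥0∞} (hv : Measurable v)
    (hf : Measurable f) (hvf : ∀ y, v y ≠ 0 → f y ≠ ∞) :
    ∫⁻ ω, ∑' n, v (Y n ω) * expNeg (∑' k, if k = n then 0 else f (Y k ω)) ∂P =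
      (∫⁻ y, v y ∂m) * expNeg (∫⁻ y, (1 - expNeg (f y)) ∂m) := by
  have hcancel : ∀ y, v y * (expNeg (f y))⁻¹ * expNeg (f y) = v y := fun y => by
    by_cases h : v y = 0
    · simp [h]
    · rw [mul_assoc, ENNReal.inv_mul_cancel (expNeg_ne_zero (hvf y h)) (expNeg_ne_top _), mul_one]
  -- Weighting by the inverse of e^{-f} removes from the sum in the exponent the term of the
  -- distinguished point; f is finite wherever v is nonzero, so the inverse cancels.
  have h := hY.lintegral_tsum_mul_expNeg (v := fun y => v y * (expNeg (f y))⁻¹) (by fun_prop) hf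
  simp_rw [hcancel] at h
  rw [← h]
  refine lintegral_congr fun ω => ?_
  rw [← ENNReal.tsum_mul_right]
  refine tsum_congr fun n => ?_
  rw [ENNReal.tsum_eq_add_tsum_ite (f := fun k => f (Y k ω)) n, expNeg_add, ← mul_assoc,
    hcancel]

/-- Dyadic approximation from strictly below. -/
noncomputable def dyadicBelow (k : ℕ) (l : ℝ) : ℝ := ((⌈l * 2 ^ k⌉ : ℝ) - 1) / 2 ^ k

lemma dyadicBelow_lt (k : ℕ) (l : ℝ) : dyadicBelow k l < l := by
  rw [dyadicBelow, div_lt_iff₀ (by positivity)]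
  linarith [Int.ceil_lt_add_one (l * 2 ^ k)]

lemma sub_le_dyadicBelow (k : ℕ) (l : ℝ) : l - (2 ^ k)⁻¹ ≤ dyadicBelow k l := by
  rw [dyadicBelow, le_div_iff₀ (by positivity), sub_mul, inv_mul_cancel₀ (by positivity)]
  linarith [Int.le_ceil (l * 2 ^ k)]

lemma dyadicBelow_mono (l : ℝ) : Monotone fun k => dyadicBelow k l := by
  refine monotone_nat_of_le_succ fun k => ?_
  unfold dyadicBelow
  rw [div_le_div_iff₀ (by positivity) (by positivity), pow_succ]
  -- From ⌈x⌉ < x + 1 follows 2⌈x⌉ - 2 < 2x, which for integers reads 2⌈x⌉ - 1 ≤ ⌈2x⌉.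
  have h2 : (2 * ⌈l * 2 ^ k⌉ - 1 : ℤ) ≤ ⌈l * (2 ^ k * 2)⌉ := by
    have h := Int.ceil_lt_add_one (l * 2 ^ k)
    rw [Int.le_ceil_iff]
    push_cast
    linarith
  have h3 : (2 * (⌈l * 2 ^ k⌉ : ℝ) - 1) ≤ ⌈l * (2 ^ k * 2)⌉ := by exact_mod_cast h2
  have : (0 : ℝ) < 2 ^ k := by positivity
  nlinarith

lemma tendsto_dyadicBelow (l : ℝ) : Tendsto (fun k => dyadicBelow k l) atTop (𝓝 l) := by
  have h : Tendsto (fun k : ℕ => l - ((2 : ℝ) ^ k)⁻¹) atTop (𝓝 (l - 0)) :=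
    tendsto_const_nhds.sub (tendsto_inv_atTop_zero.comp
      (tendsto_pow_atTop_atTop_of_one_lt one_lt_two))
  rw [sub_zero] at h
  exact tendsto_of_tendsto_of_tendsto_of_le_of_le h tendsto_const_nhds
    (fun k => sub_le_dyadicBelow k l) fun k => (dyadicBelow_lt k l).le

open Classical in
/-- The exponent which forbids points of loss below `l`, and weights the points with a multiple
of `w`. -/
noncomputable def nearCost (ℓ : E → ℝ) (w : E → ℝ≥0∞) (c l : ℝ) (y : E) : ℝ≥0∞ :=
  (if ℓ y < l then ∞ else 0) + ENNReal.ofReal (c * l) * w y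

variable {ℓ : E → ℝ} {w : E → ℝ≥0∞} {c : ℝ}

lemma measurable_nearCost (hℓ : Measurable ℓ) (hw : Measurable w) :
    Measurable fun q : ℝ × E => nearCost ℓ w c q.1 q.2 := by
  unfold nearCost
  refine Measurable.add (Measurable.ite (measurableSet_lt (by fun_prop) (by fun_prop))
    measurable_const measurable_const) (by fun_prop)

@[fun_prop]
lemma measurable_nearCost_right (hℓ : Measurable ℓ) (hw : Measurable w) (l : ℝ) :
    Measurable (nearCost ℓ w c l) :=
  (measurable_nearCost hℓ hw).comp measurable_prodMk_left

lemma nearCost_ne_top (hwt : ∀ y, w y ≠ ∞) {l : ℝ} {y : E} (h : l ≤ ℓ y) :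
    nearCost ℓ w c l y ≠ ∞ := by
  simp [nearCost, h.not_gt, ENNReal.mul_ne_top, hwt y]

lemma nearCost_mono (hc : 0 ≤ c) (y : E) : Monotone fun l => nearCost ℓ w c l y := by
  intro a b hab
  unfold nearCost
  dsimp only
  gcongr
  split_ifs with h1 h2 <;> first | exact le_rfl | exact absurd (h1.trans_le hab) h2 | exact zero_le

/-- The strict inequality in `nearCost` makes it left continuous in the level: a point below l is
already forbidden at nearby smaller levels, and a point at l or beyond is forbidden at none of them.
-/
lemma tendsto_nearCost_dyadicBelow (hwt : ∀ y, w y ≠ ∞) (l : ℝ) (y : E) :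
    Tendsto (fun k => nearCost ℓ w c (dyadicBelow k l) y) atTop (𝓝 (nearCost ℓ w c l y)) := by
  unfold nearCost
  refine Tendsto.add ?_ (ENNReal.Tendsto.mul_const
    (ENNReal.tendsto_ofReal ((tendsto_dyadicBelow l).const_mul c)) (Or.inr (hwt y)))
  by_cases h : ℓ y < l
  · refine tendsto_const_nhds.congr' ?_
    filter_upwards [(tendsto_dyadicBelow l).eventually (lt_mem_nhds h)] with k hk
    simp [h, hk]
  · refine tendsto_const_nhds.congr fun k => ?_
    have : ¬ ℓ y < dyadicBelow k l := fun h' => h (h'.trans (dyadicBelow_lt k l))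
    simp [h, this]

/-- The logarithm of the probability that there are no points of loss below `l` and that an
exponential variable exceeds the weighted sum of the others. -/
noncomputable def nearExponent (m : Measure E) (ℓ : E → ℝ) (w : E → ℝ≥0∞) (c l : ℝ) : ℝ≥0∞ :=
  ∫⁻ y, (1 - expNeg (nearCost ℓ w c l y)) ∂m

open Classical in
/-- The sum of `nearCost` over all points but one. -/
noncomputable def nearSum (Y : ι → Ω → E) (ℓ : E → ℝ) (w : E → ℝ≥0∞) (c : ℝ) (n : ι) (l : ℝ)
    (ω : Ω) : ℝ≥0∞ :=
  ∑' k, if k = n then 0 else nearCost ℓ w c l (Y k ω)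

lemma tendsto_nearSum_dyadicBelow (hwt : ∀ y, w y ≠ ∞) (hc : 0 ≤ c) (n : ι) (l : ℝ) (ω : Ω) :
    Tendsto (fun k => nearSum Y ℓ w c n (dyadicBelow k l) ω) atTop (𝓝 (nearSum Y ℓ w c n l ω)) := by
  -- The sum over the points is an integral against counting measure, to which monotone convergence
  -- applies.
  let _ : MeasurableSpace ι := ⊤
  unfold nearSum
  simp_rw [← lintegral_count]
  refine lintegral_tendsto_of_tendsto_of_monotone (fun _ => measurable_from_top.aemeasurable)
    (ae_of_all _ fun i a b hab => ?_) (ae_of_all _ fun i => ?_)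
  · dsimp only
    split_ifs
    · exact le_rfl
    · exact nearCost_mono hc _ (dyadicBelow_mono l hab)
  · split_ifs
    · exact tendsto_const_nhds
    · exact tendsto_nearCost_dyadicBelow hwt l _

lemma tendsto_nearExponent_dyadicBelow (hℓ : Measurable ℓ) (hw : Measurable w)
    (hwt : ∀ y, w y ≠ ∞) (hc : 0 ≤ c) (l : ℝ) :
    Tendsto (fun k => nearExponent m ℓ w c (dyadicBelow k l)) atTop
      (𝓝 (nearExponent m ℓ w c l)) := by
  unfold nearExponent
  refine lintegral_tendsto_of_tendsto_of_monotone (fun k => by fun_prop)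
    (ae_of_all _ fun y a b hab => ?_) (ae_of_all _ fun y => ?_)
  · exact tsub_le_tsub_left (expNeg_antitone (nearCost_mono hc y (dyadicBelow_mono l hab))) 1
  · exact ENNReal.Tendsto.sub tendsto_const_nhds
      ((continuous_expNeg.tendsto _).comp (tendsto_nearCost_dyadicBelow hwt l y))
      (Or.inl ENNReal.one_ne_top)

lemma measurable_nearSum (hY : ∀ i, Measurable (Y i)) (hℓ : Measurable ℓ) (hw : Measurable w)
    (n : ι) {g : Ω → ℝ} (hg : Measurable g) :
    Measurable fun ω => nearSum Y ℓ w c n (g ω) ω := by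
  refine Measurable.tsum fun k => ?_
  split_ifs
  · exact measurable_const
  · exact (measurable_nearCost hℓ hw).comp (hg.prodMk (hY k))

lemma measurable_nearExponent (hℓ : Measurable ℓ) (hw : Measurable w) [SFinite m] :
    Measurable (nearExponent m ℓ w c) :=
  Measurable.lintegral_prod_right'
    (f := fun q : ℝ × E => 1 - expNeg (nearCost ℓ w c q.1 q.2))
    (measurable_const.sub (measurable_nearCost hℓ hw).expNeg)

omit [Countable ι] in
lemma tsum_mul_ceil (x : ℝ) (a : ℝ≥0∞) (g : ℤ → ℝ≥0∞) :
    ∑' j : ℤ, (if ⌈x⌉ = j then a else 0) * g j = a * g ⌈x⌉ := by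
  rw [tsum_eq_single ⌈x⌉ (fun j hj => by simp [hj.symm])]
  simp

/-- A quantised level takes countably many values. On the class of points sharing one value the
exponent no longer depends on the point, and `IsPPP.mecke_const` applies; the classes are then
summed. -/
lemma IsPPP.mecke_dyadicBelow (hY : IsPPP Y P m) (hℓ : Measurable ℓ) (hw : Measurable w)
    (hwt : ∀ y, w y ≠ ∞) {u : E → ℝ≥0∞} (hu : Measurable u) (k : ℕ) :
    ∫⁻ ω, ∑' n, u (Y n ω) * expNeg (nearSum Y ℓ w c n (dyadicBelow k (ℓ (Y n ω))) ω) ∂P =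
      ∫⁻ y, u y * expNeg (nearExponent m ℓ w c (dyadicBelow k (ℓ y))) ∂m := by
  set a : ℤ → ℝ := fun j => ((j : ℝ) - 1) / 2 ^ k with ha
  set v : ℤ → E → ℝ≥0∞ := fun j y => if ⌈ℓ y * 2 ^ k⌉ = j then u y else 0 with hv
  have hvm : ∀ j, Measurable (v j) := fun j =>
    Measurable.ite (measurableSet_eq_fun (by fun_prop) measurable_const) hu measurable_const
  have hda : ∀ y, dyadicBelow k (ℓ y) = a ⌈ℓ y * 2 ^ k⌉ := fun y => rfl
  have h1 : ∀ ω n, u (Y n ω) * expNeg (nearSum Y ℓ w c n (dyadicBelow k (ℓ (Y n ω))) ω) =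
      ∑' j, v j (Y n ω) * expNeg (nearSum Y ℓ w c n (a j) ω) := fun ω n =>
    (tsum_mul_ceil (ℓ (Y n ω) * 2 ^ k) (u (Y n ω))
      fun j => expNeg (nearSum Y ℓ w c n (a j) ω)).symm
  have h2 : ∀ y, u y * expNeg (nearExponent m ℓ w c (dyadicBelow k (ℓ y))) =
      ∑' j, v j y * expNeg (nearExponent m ℓ w c (a j)) := fun y =>
    (tsum_mul_ceil (ℓ y * 2 ^ k) (u y) fun j => expNeg (nearExponent m ℓ w c (a j))).symm
  simp_rw [h1, h2]
  have hR : ∫⁻ y, ∑' j, v j y * expNeg (nearExponent m ℓ w c (a j)) ∂m =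
      ∑' j, ∫⁻ y, v j y * expNeg (nearExponent m ℓ w c (a j)) ∂m :=
    lintegral_tsum fun j => ((hvm j).mul measurable_const).aemeasurable
  rw [hR]
  have h3 : ∀ ω, ∑' n, ∑' j, v j (Y n ω) * expNeg (nearSum Y ℓ w c n (a j) ω) =
      ∑' j, ∑' n, v j (Y n ω) * expNeg (nearSum Y ℓ w c n (a j) ω) := fun ω => ENNReal.tsum_comm
  simp_rw [h3]
  refine (lintegral_tsum fun j => (Measurable.tsum fun n => ((hvm j).comp (hY.measurable n)).mul
    (measurable_nearSum hY.measurable hℓ hw n measurable_const).expNeg).aemeasurable).trans ?_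
  refine tsum_congr fun j => ?_
  rw [lintegral_mul_const _ (hvm j)]
  -- The quantised level lies below the point's own loss, so the point does not forbid itself and
  -- its cost is finite.
  refine hY.mecke_const (hvm j) (measurable_nearCost_right hℓ hw _) fun y hy => ?_
  refine nearCost_ne_top hwt ?_
  have : ⌈ℓ y * 2 ^ k⌉ = j := by
    by_contra h
    simp [hv, h] at hy
  rw [← this, ← hda]
  exact (dyadicBelow_lt _ _).le

/-- Limit of the quantised formula by dominated convergence on both sides. The bound is u, whose
mean sum over the points is finite by Campbell's formula. -/
lemma IsPPP.mecke_of_ne_top [SFinite m] (hY : IsPPP Y P m) (hℓ : Measurable ℓ) (hw : Measurable w)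
    (hwt : ∀ y, w y ≠ ∞) (hc : 0 ≤ c) {u : E → ℝ≥0∞} (hu : Measurable u)
    (hfin : ∫⁻ y, u y ∂m ≠ ∞) (hut : ∀ y, u y ≠ ∞) :
    ∫⁻ ω, ∑' n, u (Y n ω) * expNeg (nearSum Y ℓ w c n (ℓ (Y n ω)) ω) ∂P =
      ∫⁻ y, u y * expNeg (nearExponent m ℓ w c (ℓ y)) ∂m := by
  let _ : MeasurableSpace ι := ⊤
  have hdm : ∀ k, Measurable (dyadicBelow k) := fun k => by unfold dyadicBelow; fun_prop
  have hEm : Measurable (nearExponent m ℓ w c) := measurable_nearExponent hℓ hw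
  have hm : ∀ n k, Measurable fun ω =>
      u (Y n ω) * expNeg (nearSum Y ℓ w c n (dyadicBelow k (ℓ (Y n ω))) ω) := fun n k =>
    (hu.comp (hY.measurable n)).mul (measurable_nearSum hY.measurable hℓ hw n
      ((hdm k).comp (hℓ.comp (hY.measurable n)))).expNeg
  have hm' : ∀ n, Measurable fun ω =>
      u (Y n ω) * expNeg (nearSum Y ℓ w c n (ℓ (Y n ω)) ω) := fun n =>
    (hu.comp (hY.measurable n)).mul (measurable_nearSum hY.measurable hℓ hw n
      (hℓ.comp (hY.measurable n))).expNeg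
  have hsum : ∑' n, ∫⁻ ω, u (Y n ω) ∂P = ∫⁻ y, u y ∂m := by
    rw [← hY.campbell hu]
    exact (lintegral_tsum fun n => (hu.comp (hY.measurable n)).aemeasurable).symm
  have hle : ∀ (a x : ℝ≥0∞), a * expNeg x ≤ a := fun a x => mul_le_of_le_one_right' (expNeg_le_one x)
  have hL : Tendsto (fun k => ∑' n, ∫⁻ ω,
      u (Y n ω) * expNeg (nearSum Y ℓ w c n (dyadicBelow k (ℓ (Y n ω))) ω) ∂P) atTop
      (𝓝 (∑' n, ∫⁻ ω, u (Y n ω) * expNeg (nearSum Y ℓ w c n (ℓ (Y n ω)) ω) ∂P)) := by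
    simp_rw [← lintegral_count]
    refine tendsto_lintegral_of_dominated_convergence (fun n => ∫⁻ ω, u (Y n ω) ∂P)
      (fun k => measurable_from_top) (fun k => ae_of_all _ fun n => lintegral_mono fun ω => hle _ _)
      (by rw [lintegral_count, hsum]; exact hfin) (ae_of_all _ fun n => ?_)
    refine tendsto_lintegral_of_dominated_convergence (fun ω => u (Y n ω))
      (fun k => hm n k) (fun k => ae_of_all _ fun ω => hle _ _)
      (ne_top_of_le_ne_top hfin (hsum ▸ ENNReal.le_tsum n)) (ae_of_all _ fun ω => ?_)
    exact ENNReal.Tendsto.const_mul ((continuous_expNeg.tendsto _).comp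
      (tendsto_nearSum_dyadicBelow hwt hc n _ ω)) (Or.inr (hut _))
  have hR : Tendsto (fun k => ∫⁻ y, u y * expNeg (nearExponent m ℓ w c (dyadicBelow k (ℓ y))) ∂m)
      atTop (𝓝 (∫⁻ y, u y * expNeg (nearExponent m ℓ w c (ℓ y)) ∂m)) := by
    refine tendsto_lintegral_of_dominated_convergence u
      (fun k => by fun_prop) (fun k => ae_of_all _ fun y => hle _ _) hfin (ae_of_all _ fun y => ?_)
    exact ENNReal.Tendsto.const_mul ((continuous_expNeg.tendsto _).comp
      (tendsto_nearExponent_dyadicBelow hℓ hw hwt hc _)) (Or.inr (hut _))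
  rw [lintegral_tsum fun n => (hm' n).aemeasurable]
  refine tendsto_nhds_unique hL (hR.congr fun k => ?_)
  rw [← hY.mecke_dyadicBelow hℓ hw hwt hu k, lintegral_tsum fun n => (hm n k).aemeasurable]

/-- The Mecke formula for the functionals `nearCost`. -/
lemma IsPPP.mecke [SFinite m] (hY : IsPPP Y P m) (hℓ : Measurable ℓ) (hw : Measurable w)
    (hwt : ∀ y, w y ≠ ∞) (hc : 0 ≤ c) (hfin : ∀ s, m {y | ℓ y ≤ s} ≠ ∞)
    {u : E → ℝ≥0∞} (hu : Measurable u) (hu1 : ∀ y, u y ≤ 1) :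
    ∫⁻ ω, ∑' n, u (Y n ω) * expNeg (nearSum Y ℓ w c n (ℓ (Y n ω)) ω) ∂P =
      ∫⁻ y, u y * expNeg (nearExponent m ℓ w c (ℓ y)) ∂m := by
  -- Slicing by ⌈ℓ⌉ makes every piece of u integrable, because m has finite mass below each loss.
  set v : ℤ → E → ℝ≥0∞ := fun j y => if ⌈ℓ y⌉ = j then u y else 0 with hv
  have hvm : ∀ j, Measurable (v j) := fun j =>
    Measurable.ite (measurableSet_eq_fun (by fun_prop) measurable_const) hu measurable_const
  have hEm : Measurable (nearExponent m ℓ w c) := measurable_nearExponent hℓ hw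
  have h1 : ∀ ω n, u (Y n ω) * expNeg (nearSum Y ℓ w c n (ℓ (Y n ω)) ω) =
      ∑' j, v j (Y n ω) * expNeg (nearSum Y ℓ w c n (ℓ (Y n ω)) ω) := fun ω n =>
    (tsum_mul_ceil (ℓ (Y n ω)) (u (Y n ω)) fun _ => _).symm
  have h2 : ∀ y, u y * expNeg (nearExponent m ℓ w c (ℓ y)) =
      ∑' j, v j y * expNeg (nearExponent m ℓ w c (ℓ y)) := fun y =>
    (tsum_mul_ceil (ℓ y) (u y) fun _ => _).symm
  simp_rw [h1, h2]
  have hR : ∫⁻ y, ∑' j, v j y * expNeg (nearExponent m ℓ w c (ℓ y)) ∂m =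
      ∑' j, ∫⁻ y, v j y * expNeg (nearExponent m ℓ w c (ℓ y)) ∂m :=
    lintegral_tsum fun j => ((hvm j).mul (hEm.comp hℓ).expNeg).aemeasurable
  rw [hR]
  have h3 : ∀ ω, ∑' n, ∑' j, v j (Y n ω) * expNeg (nearSum Y ℓ w c n (ℓ (Y n ω)) ω) =
      ∑' j, ∑' n, v j (Y n ω) * expNeg (nearSum Y ℓ w c n (ℓ (Y n ω)) ω) :=
    fun ω => ENNReal.tsum_comm
  simp_rw [h3]
  refine (lintegral_tsum fun j => (Measurable.tsum fun n => ((hvm j).comp (hY.measurable n)).mul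
    (measurable_nearSum hY.measurable hℓ hw n (hℓ.comp (hY.measurable n))).expNeg).aemeasurable).trans
    ?_
  have hv1 : ∀ j y, v j y ≤ 1 := fun j y => by
    simp only [hv]
    split_ifs
    · exact hu1 y
    · exact zero_le
  refine tsum_congr fun j => hY.mecke_of_ne_top hℓ hw hwt hc (hvm j) ?_
    fun y => ((hv1 j y).trans_lt ENNReal.one_lt_top).ne
  refine ne_top_of_le_ne_top (hfin j) ?_
  rw [← lintegral_indicator_one (measurableSet_le hℓ measurable_const)]
  refine lintegral_mono fun y => ?_
  simp only [hv]
  split_ifs with h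
  · rw [Set.indicator_of_mem (by
      show ℓ y ≤ j
      rw [← h]; exact Int.le_ceil _)]
    exact hu1 y
  · exact zero_le

end Mecke


/-! ### Exponential fading against an independent threshold -/

section Exponential

lemma expMeasure_lt_ofReal (t : ℝ≥0∞) : expMeasure 1 {x | t < ENNReal.ofReal x} = expNeg t := by
  have := isProbabilityMeasure_expMeasure one_pos
  by_cases ht : t = ∞
  · simp [ht]
  have h1 : {x | t < ENNReal.ofReal x} = (Set.Iic t.toReal)ᶜ := by
    ext x
    rw [Set.mem_ofPred_eq, Set.mem_compl_iff, Set.mem_Iic, not_le, ENNReal.lt_ofReal_iff_toReal_lt ht]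
  rw [h1, prob_compl_eq_one_sub measurableSet_Iic, ← ofReal_cdf, cdf_expMeasure_eq one_pos,
    if_pos ENNReal.toReal_nonneg, expNeg_eq_of_ne_top ht, ← ENNReal.ofReal_one,
    ← ENNReal.ofReal_sub _ (by simp)]
  simp

lemma ae_nonneg_of_map_eq_expMeasure {Ω : Type*} [MeasurableSpace Ω] {P : Measure Ω} {h : Ω → ℝ}
    (hh : Measurable h) (hlaw : P.map h = expMeasure 1) : ∀ᵐ ω ∂P, 0 < h ω := by
  have := isProbabilityMeasure_expMeasure one_pos
  have h1 : expMeasure 1 {x | 0 < x} = 1 := by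
    have := expMeasure_lt_ofReal 0
    simpa using this
  have h2 : ∀ᵐ x ∂(P.map h), 0 < x := by
    rw [hlaw]
    exact (prob_compl_eq_zero_iff (measurableSet_lt measurable_const measurable_id)).2 h1
  exact ae_of_ae_map hh.aemeasurable h2

/-- A threshold independent of an exponential variable is exceeded with conditional probability
`expNeg`. -/
lemma measure_lt_ofReal_exponential {Ω : Type*} {𝓕 mΩ : MeasurableSpace Ω} {P : Measure Ω}
    [IsProbabilityMeasure P] {h : Ω → ℝ} (hh : Measurable h) (hlaw : P.map h = expMeasure 1)
    (h𝓕 : 𝓕 ≤ mΩ) (hind : Indep (MeasurableSpace.comap h inferInstance) 𝓕 P) {T : Ω → ℝ≥0∞}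
    (hT : Measurable[𝓕] T) :
    P {ω | T ω < ENNReal.ofReal (h ω)} = ∫⁻ ω, expNeg (T ω) ∂P := by
  have hT' : Measurable T := hT.mono h𝓕 le_rfl
  have hi : IndepFun T h P :=
    (indep_of_indep_of_le_right hind (measurable_iff_comap_le.1 hT)).symm
  have hS : MeasurableSet {q : ℝ≥0∞ × ℝ | q.1 < ENNReal.ofReal q.2} :=
    measurableSet_lt (by fun_prop) (by fun_prop)
  have := isProbabilityMeasure_expMeasure one_pos
  have h1 : P {ω | T ω < ENNReal.ofReal (h ω)} =
      (P.map fun ω => (T ω, h ω)) {q : ℝ≥0∞ × ℝ | q.1 < ENNReal.ofReal q.2} := by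
    rw [Measure.map_apply (hT'.prodMk hh) hS]; rfl
  rw [h1, (indepFun_iff_map_prod_eq_prod_map_map hT'.aemeasurable hh.aemeasurable).1 hi, hlaw,
    Measure.prod_apply hS]
  rw [lintegral_map (measurable_measure_prodMk_left hS) hT']
  exact lintegral_congr fun ω => expMeasure_lt_ofReal (T ω)

end Exponential

/-! ### The point of least loss: existence, uniqueness and coverage -/

section Nearest

variable {Ω ι E : Type*} [mΩ : MeasurableSpace Ω] [MeasurableSpace E] [Countable ι]
  {P : Measure Ω} [IsProbabilityMeasure P] {Y : ι → Ω → E} {m : Measure E}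
  {ℓ : E → ℝ} {w : E → ℝ≥0∞} {c : ℝ}

/-- The `n`-th point has the least loss. -/
def IsNearest (Y : ι → Ω → E) (ℓ : E → ℝ) (n : ι) (ω : Ω) : Prop :=
  ∀ k, ℓ (Y n ω) ≤ ℓ (Y k ω)

open Classical in
lemma nearSum_of_isNearest {n : ι} {ω : Ω} (h : IsNearest Y ℓ n ω) :
    nearSum Y ℓ w c n (ℓ (Y n ω)) ω =
      ENNReal.ofReal (c * ℓ (Y n ω)) * ∑' k, if k = n then 0 else w (Y k ω) := by
  rw [nearSum, ← ENNReal.tsum_mul_left]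
  refine tsum_congr fun k => ?_
  split_ifs
  · simp
  · simp [nearCost, (h k).not_gt]

/-- A single nearer point costs ∞. Thus exp(-`nearSum`) contains the indicator that the n-th point
is nearest. -/
lemma nearSum_of_not_isNearest {n : ι} {ω : Ω} (h : ¬ IsNearest Y ℓ n ω) :
    nearSum Y ℓ w c n (ℓ (Y n ω)) ω = ∞ := by
  classical
  unfold IsNearest at h
  push Not at h
  obtain ⟨k, hk⟩ := h
  have hkn : k ≠ n := fun h => by simp [h] at hk
  refine top_le_iff.1 (le_trans ?_ (ENNReal.le_tsum k))
  simp [hkn, nearCost, hk]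

lemma nearExponent_zero (hℓ : Measurable ℓ) (l : ℝ) :
    nearExponent m ℓ (fun _ => 0) 0 l = m {y | ℓ y < l} := by
  rw [nearExponent, ← lintegral_indicator_one (measurableSet_lt hℓ measurable_const)]
  refine lintegral_congr fun y => ?_
  by_cases h : ℓ y < l <;> simp [nearCost, h]

lemma measurableSet_isNearest (hY : ∀ i, Measurable (Y i)) (hℓ : Measurable ℓ) (n : ι) :
    MeasurableSet {ω | IsNearest Y ℓ n ω} := by
  have : {ω | IsNearest Y ℓ n ω} = ⋂ k, {ω | ℓ (Y n ω) ≤ ℓ (Y k ω)} := by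
    ext ω; simp [IsNearest]
  rw [this]
  exact MeasurableSet.iInter fun k =>
    measurableSet_le (hℓ.comp (hY n)) (hℓ.comp (hY k))

open Classical in
/-- The expected number of nearest points in a set. -/
lemma IsPPP.tsum_measure_isNearest [SFinite m] (hY : IsPPP Y P m) (hℓ : Measurable ℓ)
    (hfin : ∀ s, m {y | ℓ y ≤ s} ≠ ∞) {B : Set E} (hB : MeasurableSet B) :
    ∑' n, P {ω | IsNearest Y ℓ n ω ∧ Y n ω ∈ B} =
      ∫⁻ y in B, expNeg (m {x | ℓ x < ℓ y}) ∂m := by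
  -- With no weights only the void condition is left: the exponential is the indicator of being
  -- nearest, and the exponent is the mass of the points of smaller loss.
  have h := hY.mecke (w := fun _ => 0) (c := 0) hℓ measurable_const (by simp) le_rfl hfin
    (u := B.indicator 1) (measurable_one.indicator hB)
    (fun y => Set.indicator_le_self' (by simp) y)
  have hm : ∀ n, MeasurableSet {ω | IsNearest Y ℓ n ω ∧ Y n ω ∈ B} := fun n =>
    (measurableSet_isNearest hY.measurable hℓ n).inter (hY.measurable n hB)
  have h1 : ∀ ω n, B.indicator 1 (Y n ω) * expNeg (nearSum Y ℓ (fun _ => 0) 0 n (ℓ (Y n ω)) ω) =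
      {ω | IsNearest Y ℓ n ω ∧ Y n ω ∈ B}.indicator (1 : Ω → ℝ≥0∞) ω := fun ω n => by
    by_cases hn : IsNearest Y ℓ n ω
    · rw [nearSum_of_isNearest hn]
      by_cases hb : Y n ω ∈ B <;> simp [hn, hb]
    · rw [nearSum_of_not_isNearest hn]
      simp [hn]
  simp_rw [h1, nearExponent_zero hℓ] at h
  rw [← lintegral_indicator hB]
  have h2 : ∀ y, B.indicator (fun y => expNeg (m {x | ℓ x < ℓ y})) y =
      B.indicator 1 y * expNeg (m {x | ℓ x < ℓ y}) := fun y => by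
    by_cases hb : y ∈ B <;> simp [hb]
  simp_rw [h2]
  rw [← h, lintegral_tsum fun n => (measurable_one.indicator (hm n)).aemeasurable]
  exact tsum_congr fun n => (lintegral_indicator_one (hm n)).symm

/-- Campbell's formula makes the number of points below each integer level almost surely finite, so
the minimum is taken over a finite nonempty set. -/
lemma IsPPP.ae_exists_isNearest [Nonempty ι] (hY : IsPPP Y P m) (hℓ : Measurable ℓ)
    (hfin : ∀ s, m {y | ℓ y ≤ s} ≠ ∞) : ∀ᵐ ω ∂P, ∃ n, IsNearest Y ℓ n ω := by
  classical
  have h1 : ∀ s : ℕ, ∀ᵐ ω ∂P, {n | ℓ (Y n ω) ≤ s}.Finite := fun s => by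
    have hS : MeasurableSet {y | ℓ y ≤ s} := measurableSet_le hℓ measurable_const
    have h2 := hY.campbell (v := {y | ℓ y ≤ s}.indicator 1) (measurable_one.indicator hS)
    rw [lintegral_indicator_one hS] at h2
    have h3 := ae_lt_top (Measurable.tsum fun n =>
      (measurable_one.indicator hS).comp (hY.measurable n)) (h2.trans_ne (hfin s))
    filter_upwards [h3] with ω hω
    have h4 := ENNReal.finite_const_le_of_tsum_ne_top hω.ne one_ne_zero
    refine h4.subset fun n hn => ?_
    have : Y n ω ∈ {y | ℓ y ≤ s} := hn
    simp [Set.indicator_of_mem this]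
  filter_upwards [ae_all_iff.2 h1] with ω hω
  obtain ⟨n₀⟩ := ‹Nonempty ι›
  obtain ⟨s, hs⟩ := exists_nat_ge (ℓ (Y n₀ ω))
  obtain ⟨n, hn, hmin⟩ := Set.exists_min_image _ (fun n => ℓ (Y n ω)) (hω s) ⟨n₀, hs⟩
  refine ⟨n, fun k => ?_⟩
  by_cases hk : ℓ (Y k ω) ≤ s
  · exact hmin k hk
  · exact le_trans hn (not_le.1 hk).le

/-- Almost surely there is exactly one nearest point. -/
lemma IsPPP.ae_existsUnique_isNearest [Nonempty ι] [SFinite m] (hY : IsPPP Y P m)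
    (hℓ : Measurable ℓ) (hfin : ∀ s, m {y | ℓ y ≤ s} ≠ ∞)
    (hone : ∫⁻ y, expNeg (m {x | ℓ x < ℓ y}) ∂m = 1) : ∀ᵐ ω ∂P, ∃! n, IsNearest Y ℓ n ω := by
  classical
  have hm := measurableSet_isNearest (ℓ := ℓ) hY.measurable hℓ
  have h1 := hY.tsum_measure_isNearest hℓ hfin MeasurableSet.univ
  simp only [Set.mem_univ, and_true, Measure.restrict_univ] at h1
  rw [hone] at h1
  set G : Ω → ℝ≥0∞ := fun ω => ∑' n, {ω | IsNearest Y ℓ n ω}.indicator 1 ω with hG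
  have hGm : Measurable G := Measurable.tsum fun n => measurable_one.indicator (hm n)
  have hint : ∫⁻ ω, G ω ∂P = 1 := by
    rw [hG, ← h1]
    refine (lintegral_tsum fun n => (measurable_one.indicator (hm n)).aemeasurable).trans ?_
    exact tsum_congr fun n => lintegral_indicator_one (hm n)
  have hge : ∀ᵐ ω ∂P, 1 ≤ G ω := by
    filter_upwards [hY.ae_exists_isNearest hℓ hfin] with ω ⟨n, hn⟩
    refine le_trans ?_ (ENNReal.le_tsum n)
    simp [hn]
  -- A count that is almost surely at least one and has mean one is almost surely one.
  have heq : (fun _ => (1 : ℝ≥0∞)) =ᵐ[P] G :=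
    ae_eq_of_ae_le_of_lintegral_le hge (by simp) hGm.aemeasurable (by simp [hint])
  filter_upwards [heq, hY.ae_exists_isNearest hℓ hfin] with ω hω ⟨n, hn⟩
  refine ⟨n, hn, fun k hk => ?_⟩
  by_contra hkn
  have h2 := ENNReal.sum_le_tsum (f := fun n => {ω | IsNearest Y ℓ n ω}.indicator (1 : Ω → ℝ≥0∞) ω)
    {k, n}
  rw [Finset.sum_pair hkn] at h2
  have h3 : (1 : ℝ≥0∞) + 1 ≤ 1 := by
    have hω' : (∑' n, {ω | IsNearest Y ℓ n ω}.indicator (1 : Ω → ℝ≥0∞) ω) = 1 := hω.symm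
    rw [hω'] at h2
    simpa [hn, hk] using h2
  norm_num at h3

lemma IsPPP.ae_forall_notMem (hY : IsPPP Y P m) {B : Set E} (hB : MeasurableSet B) (h0 : m B = 0) :
    ∀ᵐ ω ∂P, ∀ n, Y n ω ∉ B := by
  have h := hY.campbell (v := B.indicator 1) (measurable_one.indicator hB)
  rw [lintegral_indicator_one hB, h0] at h
  filter_upwards [(lintegral_eq_zero_iff (Measurable.tsum fun n =>
      (measurable_one.indicator hB).comp (hY.measurable n))).1 h] with ω hω n hn
  have := ENNReal.tsum_eq_zero.1 hω n
  simp [hn] at this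

/-- The sum of the weights is finite if far points contribute little. -/
lemma IsPPP.ae_tsum_ne_top (hY : IsPPP Y P m) (hw : Measurable w)
    (hwt : ∀ y, w y ≠ ∞) {S : Set E} (hS : MeasurableSet S) (hSm : m S ≠ ∞)
    (hfin : ∫⁻ y in Sᶜ, w y ∂m ≠ ∞) : ∀ᵐ ω ∂P, ∑' n, w (Y n ω) ≠ ∞ := by
  classical
  have h1 := hY.campbell (v := S.indicator 1) (measurable_one.indicator hS)
  rw [lintegral_indicator_one hS] at h1
  have h2 := hY.campbell (v := Sᶜ.indicator w) (hw.indicator hS.compl)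
  rw [lintegral_indicator hS.compl] at h2
  filter_upwards [ae_lt_top (Measurable.tsum fun n =>
      (measurable_one.indicator hS).comp (hY.measurable n)) (h1.trans_ne hSm),
    ae_lt_top (Measurable.tsum fun n =>
      (hw.indicator hS.compl).comp (hY.measurable n)) (h2.trans_ne hfin)] with ω hω1 hω2
  have h4 := ENNReal.finite_const_le_of_tsum_ne_top hω1.ne one_ne_zero
  have h5 : ∀ n, w (Y n ω) = S.indicator w (Y n ω) + Sᶜ.indicator w (Y n ω) := fun n =>
    (congrFun (Set.indicator_self_add_compl S w) (Y n ω)).symm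
  simp_rw [h5]
  rw [ENNReal.tsum_add, ENNReal.add_ne_top]
  refine ⟨?_, hω2.ne⟩
  -- Only finitely many points lie in S, and each has finite weight.
  rw [tsum_eq_sum (s := h4.toFinset)]
  · refine ENNReal.sum_ne_top.2 fun n _ => ?_
    exact ne_top_of_le_ne_top (hwt (Y n ω)) (Set.indicator_le_self S w _)
  · intro n hn
    by_contra h
    have : Y n ω ∈ S := Set.mem_of_indicator_ne_zero h
    exact hn (by simp [this])

open Classical in
/-- The threshold which the fading of the `n`-th link has to exceed in order that the point is
nearest, lies in `B` and is covered. -/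
noncomputable def fadingThreshold (Y : ι → Ω → E) (ℓ : E → ℝ) (w : E → ℝ≥0∞) (c : ℝ) (N : ℝ≥0∞)
    (B : Set E) (n : ι) (ω : Ω) : ℝ≥0∞ :=
  nearSum Y ℓ w c n (ℓ (Y n ω)) ω + ENNReal.ofReal (c * ℓ (Y n ω)) * N +
    if Y n ω ∈ B then 0 else ∞

open Classical in
-- The threshold is ∞ unless the point is nearest and lies in B, so one inequality encodes all three
-- conditions.
lemma fadingThreshold_lt_iff {N : ℝ≥0∞} {B : Set E} {n : ι} {ω : Ω} {x : ℝ} :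
    fadingThreshold Y ℓ w c N B n ω < ENNReal.ofReal x ↔ IsNearest Y ℓ n ω ∧ Y n ω ∈ B ∧
      ENNReal.ofReal (c * ℓ (Y n ω)) * ((∑' k, if k = n then 0 else w (Y k ω)) + N) <
        ENNReal.ofReal x := by
  unfold fadingThreshold
  by_cases hn : IsNearest Y ℓ n ω
  · rw [nearSum_of_isNearest hn]
    by_cases hb : Y n ω ∈ B <;> simp [hn, hb, mul_add]
  · rw [nearSum_of_not_isNearest hn]
    simp [hn]

/-- Of the n-th point only its loss and its membership in B enter, never its weight. The weight of
an SBS contains its own fading, so this is what makes the threshold independent of the fading it is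
compared with. -/
lemma measurable_fadingThreshold_of {𝓕 : MeasurableSpace Ω} {n : ι}
    (hℓ : Measurable ℓ) (hw : Measurable w) {N : ℝ≥0∞} {B : Set E}
    (h1 : ∀ k, k ≠ n → Measurable[𝓕] (Y k)) (h2 : Measurable[𝓕] fun ω => ℓ (Y n ω))
    (h3 : MeasurableSet[𝓕] {ω | Y n ω ∈ B}) : Measurable[𝓕] (fadingThreshold Y ℓ w c N B n) := by
  unfold fadingThreshold
  refine Measurable.add (Measurable.add ?_ ((h2.const_mul c).ennreal_ofReal.mul_const N))
    (Measurable.ite h3 measurable_const measurable_const)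
  unfold nearSum
  refine Measurable.tsum fun k => ?_
  split_ifs with hk
  · exact measurable_const
  · exact (measurable_nearCost hℓ hw).comp (h2.prodMk (h1 k hk))

/-- Coverage by the nearest point. -/
lemma IsPPP.tsum_measure_fadingThreshold_lt [SFinite m] (hY : IsPPP Y P m) (hℓ : Measurable ℓ)
    (hw : Measurable w) (hwt : ∀ y, w y ≠ ∞) (hc : 0 ≤ c) (hfin : ∀ s, m {y | ℓ y ≤ s} ≠ ∞)
    {B : Set E} (hB : MeasurableSet B) (N : ℝ≥0∞) {h : ι → Ω → ℝ} (hh : ∀ n, Measurable (h n))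
    (hlaw : ∀ n, P.map (h n) = expMeasure 1) (𝓕 : ι → MeasurableSpace Ω) (h𝓕 : ∀ n, 𝓕 n ≤ mΩ)
    (hind : ∀ n, Indep (MeasurableSpace.comap (h n) inferInstance) (𝓕 n) P)
    (h1 : ∀ n k, k ≠ n → Measurable[𝓕 n] (Y k)) (h2 : ∀ n, Measurable[𝓕 n] fun ω => ℓ (Y n ω))
    (h3 : ∀ n, MeasurableSet[𝓕 n] {ω | Y n ω ∈ B}) :
    ∑' n, P {ω | fadingThreshold Y ℓ w c N B n ω < ENNReal.ofReal (h n ω)} =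
      ∫⁻ y in B, expNeg (ENNReal.ofReal (c * ℓ y) * N) * expNeg (nearExponent m ℓ w c (ℓ y)) ∂m := by
  classical
  -- The noise factor depends only on the loss of the point itself and is put into u; interference
  -- and the void condition form `nearCost`.
  have hmec := hY.mecke hℓ hw hwt hc hfin
    (u := B.indicator fun y => expNeg (ENNReal.ofReal (c * ℓ y) * N))
    (Measurable.indicator (by fun_prop) hB)
    (fun y => (Set.indicator_le_self _ _ y).trans (expNeg_le_one _))
  rw [← lintegral_indicator hB]
  have e1 : ∀ y, B.indicator (fun y => expNeg (ENNReal.ofReal (c * ℓ y) * N) *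
      expNeg (nearExponent m ℓ w c (ℓ y))) y =
      B.indicator (fun y => expNeg (ENNReal.ofReal (c * ℓ y) * N)) y *
        expNeg (nearExponent m ℓ w c (ℓ y)) := fun y => by
    by_cases hb : y ∈ B <;> simp [hb]
  simp_rw [e1]
  rw [← hmec]
  have hTm : ∀ n, Measurable (fadingThreshold Y ℓ w c N B n) := fun n =>
    (measurable_fadingThreshold_of hℓ hw (h1 n) (h2 n) (h3 n)).mono (h𝓕 n) le_rfl
  have e2 : ∀ ω n, B.indicator (fun y => expNeg (ENNReal.ofReal (c * ℓ y) * N)) (Y n ω) *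
      expNeg (nearSum Y ℓ w c n (ℓ (Y n ω)) ω) = expNeg (fadingThreshold Y ℓ w c N B n ω) :=
      fun ω n => by
    unfold fadingThreshold
    rw [expNeg_add, expNeg_add]
    by_cases hb : Y n ω ∈ B <;> simp [hb, mul_comm]
  simp_rw [e2]
  rw [lintegral_tsum fun n => (hTm n).expNeg.aemeasurable]
  exact tsum_congr fun n => measure_lt_ofReal_exponential (hh n) (hlaw n) (h𝓕 n) (hind n)
    (measurable_fadingThreshold_of hℓ hw (h1 n) (h2 n) (h3 n))

end Nearest


/-! ### From Poisson counts to the Laplace functional -/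

section Poisson

variable {Ω : Type*} [MeasurableSpace Ω] {P : Measure Ω} [IsProbabilityMeasure P]
  {Φ : Ω → ℕ → Plane} {lam : ℝ}

lemma lintegral_countingMeasure (pts : ℕ → Plane) {f : Plane → ℝ≥0∞} (hf : Measurable f) :
    ∫⁻ x, f x ∂(countingMeasure pts) = ∑' n, f (pts n) := by
  rw [countingMeasure, lintegral_sum_measure]
  exact tsum_congr fun n => lintegral_dirac' _ hf

lemma IsPoissonProcess.measurable_apply (h : IsPoissonProcess P Φ lam) (n : ℕ) :
    Measurable fun ω => Φ ω n :=
  (measurable_pi_apply n).comp h.measurable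

lemma IsPoissonProcess.measurable_count (h : IsPoissonProcess P Φ lam) {A : Set Plane}
    (hA : MeasurableSet A) : Measurable fun ω => countingMeasure (Φ ω) A := by
  have : ∀ ω, countingMeasure (Φ ω) A = ∑' n, A.indicator 1 (Φ ω n) := fun ω => by
    rw [← lintegral_countingMeasure _ (measurable_one.indicator hA), lintegral_indicator_one hA]
  simp_rw [this]
  exact Measurable.tsum fun n => (measurable_one.indicator hA).comp (h.measurable_apply n)

lemma hasSum_poisson (a t : ℝ) :
    HasSum (fun k : ℕ => Real.exp (-a) * a ^ k / k.factorial * Real.exp (-t) ^ k)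
      (Real.exp (-(a * (1 - Real.exp (-t))))) := by
  have h := (NormedSpace.expSeries_div_hasSum_exp (a * Real.exp (-t))).mul_left (Real.exp (-a))
  rw [← Real.exp_eq_exp_ℝ, ← Real.exp_add] at h
  have e : -a + a * Real.exp (-t) = -(a * (1 - Real.exp (-t))) := by ring
  rw [e] at h
  refine h.congr_fun fun k => ?_
  rw [mul_pow]; ring

/-- The Poisson masses add up to 1, so the count is almost surely a natural number and the mean is
the generating function of the Poisson law at e^{-t}. -/
lemma IsPoissonProcess.lintegral_expNeg_count (h : IsPoissonProcess P Φ lam) (hlam : 0 ≤ lam)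
    {A : Set Plane} (hA : MeasurableSet A) (hAv : volume A ≠ ∞) {t : ℝ≥0∞} (ht : t ≠ ∞) :
    ∫⁻ ω, expNeg (t * countingMeasure (Φ ω) A) ∂P =
      expNeg ((1 - expNeg t) * (ENNReal.ofReal lam * volume A)) := by
  set a : ℝ := lam * (volume A).toReal with ha
  have ha0 : 0 ≤ a := by positivity
  set N : Ω → ℝ≥0∞ := fun ω => countingMeasure (Φ ω) A with hN
  have hNm : Measurable N := h.measurable_count hA
  have hS : ∀ k : ℕ, MeasurableSet {ω | N ω = k} := fun k =>
    hNm (measurableSet_singleton _)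
  have hdisj : Pairwise fun j k : ℕ => Disjoint {ω | N ω = j} {ω | N ω = k} := fun j k hjk =>
    Set.disjoint_left.2 fun ω h1 h2 => hjk (by
      have h1 : N ω = j := h1
      have h2 : N ω = k := h2
      exact_mod_cast h1.symm.trans h2)
  have hlawk := h.count_law A hA hAv
  have htot : P (⋃ k : ℕ, {ω | N ω = k}) = 1 := by
    rw [measure_iUnion hdisj hS]
    have h1 : ∀ k : ℕ, P {ω | N ω = k} =
        ENNReal.ofReal (Real.exp (-a) * a ^ k / k.factorial * Real.exp (-0) ^ k) := fun k => by
      rw [hN, hlawk k]; simp [ha]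
    simp_rw [h1]
    have h2 := hasSum_poisson a 0
    rw [← ENNReal.ofReal_tsum_of_nonneg (fun k => by positivity) h2.summable, h2.tsum_eq]
    simp
  have hae : ∀ᵐ ω ∂P, ω ∈ ⋃ k : ℕ, {ω | N ω = k} :=
    (prob_compl_eq_zero_iff (MeasurableSet.iUnion hS)).2 htot
  have h3 : ∫⁻ ω, expNeg (t * N ω) ∂P =
      ∫⁻ ω in ⋃ k : ℕ, {ω | N ω = k}, expNeg (t * N ω) ∂P := by
    rw [Measure.restrict_eq_self_of_ae_mem hae]
  rw [h3, lintegral_iUnion hS hdisj]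
  have h4 : ∀ k : ℕ, ∫⁻ ω in {ω | N ω = k}, expNeg (t * N ω) ∂P =
      ENNReal.ofReal (Real.exp (-a) * a ^ k / k.factorial * Real.exp (-t.toReal) ^ k) := fun k => by
    rw [setLIntegral_congr_fun (g := fun _ => expNeg (t * k)) (hS k) (fun ω hω => by
      have : N ω = k := hω
      simp only [this]), setLIntegral_const, hN, hlawk k, ← ha, mul_comm,
      ENNReal.ofReal_mul (by positivity), expNeg_eq_of_ne_top (by finiteness),
      ENNReal.toReal_mul, ENNReal.toReal_natCast, ← Real.exp_nat_mul]
    congr 3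
    ring
  have h5 := hasSum_poisson a t.toReal
  simp_rw [h4]
  rw [← ENNReal.ofReal_tsum_of_nonneg (fun k => by positivity) h5.summable, h5.tsum_eq]
  have h6 : (1 - expNeg t) * (ENNReal.ofReal lam * volume A) =
      ENNReal.ofReal (a * (1 - Real.exp (-t.toReal))) := by
    rw [ENNReal.ofReal_mul ha0, ha, ENNReal.ofReal_mul hlam, ENNReal.ofReal_toReal hAv, mul_comm,
      expNeg_eq_of_ne_top ht, ENNReal.ofReal_sub _ (Real.exp_pos _).le, ENNReal.ofReal_one]
  rw [h6, expNeg_ofReal]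
  have : Real.exp (-t.toReal) ≤ 1 := Real.exp_le_one_iff.2 (by simp)
  exact mul_nonneg ha0 (by linarith)

/-- The level sets of f are disjoint, so their counts are independent and the Laplace functional is
a product of Poisson transforms. -/
lemma IsPoissonProcess.laplace_simpleFunc (h : IsPoissonProcess P Φ lam) (hlam : 0 ≤ lam)
    (f : SimpleFunc Plane ℝ≥0∞) (hft : ∀ x, f x ≠ ∞) (hv : ∀ t ≠ 0, volume (f ⁻¹' {t}) ≠ ∞) :
    ∫⁻ ω, expNeg (∑' n, f (Φ ω n)) ∂P =
      expNeg (∫⁻ x, (1 - expNeg (f x)) ∂(ENNReal.ofReal lam • volume)) := by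
  classical
  -- The value 0 is left out: it contributes nothing, and its level set may have infinite area.
  set s : Finset ℝ≥0∞ := f.range.filter (· ≠ 0) with hs
  set e : Fin s.card ≃ s := s.equivFin.symm with he
  set A : Fin s.card → Set Plane := fun i => f ⁻¹' {(e i : ℝ≥0∞)} with hA
  have hAm : ∀ i, MeasurableSet (A i) := fun i => f.measurableSet_fiber _
  have hAd : Pairwise fun i j => Disjoint (A i) (A j) := fun i j hij =>
    Set.disjoint_left.2 fun x h1 h2 => hij (e.injective (Subtype.ext (by
      have h1 : f x = e i := h1
      have h2 : f x = e j := h2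
      exact h1.symm.trans h2)))
  have hne : ∀ i, (e i : ℝ≥0∞) ≠ 0 := fun i => (Finset.mem_filter.1 (e i).2).2
  have het : ∀ i, (e i : ℝ≥0∞) ≠ ∞ := fun i => by
    obtain ⟨x, hx⟩ := SimpleFunc.mem_range.1 (Finset.mem_filter.1 (e i).2).1
    exact hx ▸ hft x
  have hsum : ∀ (g : ℝ≥0∞ → ℝ≥0∞), g 0 = 0 → ∀ μ : Measure Plane,
      ∫⁻ x, g (f x) ∂μ = ∑ i, g (e i) * μ (A i) := fun g hg μ => by
    have h1 : ∫⁻ x, g (f x) ∂μ = ∑ t ∈ f.range, g t * μ (f ⁻¹' {t}) := by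
      rw [← SimpleFunc.map_lintegral, ← SimpleFunc.lintegral_eq_lintegral]; rfl
    rw [h1, Equiv.sum_comp e (fun t : s => g t * μ (f ⁻¹' {(t : ℝ≥0∞)})),
      Finset.sum_coe_sort s (fun t => g t * μ (f ⁻¹' {t})), hs, Finset.sum_filter]
    refine Finset.sum_congr rfl fun t _ => ?_
    split_ifs with h0
    · rfl
    · rw [not_not] at h0
      simp [h0, hg]
  have h1 : ∀ ω, expNeg (∑' n, f (Φ ω n)) =
      ∏ i, expNeg ((e i : ℝ≥0∞) * countingMeasure (Φ ω) (A i)) := fun ω => by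
    rw [← lintegral_countingMeasure _ f.measurable, hsum (fun t => t) rfl, expNeg_sum]
  simp_rw [h1]
  rw [lintegral_prod_eq_prod_lintegral_of_indepFun Finset.univ
    (fun i ω => expNeg ((e i : ℝ≥0∞) * countingMeasure (Φ ω) (A i)))
    ((h.count_indep _ A hAm hAd).comp (fun i t => expNeg ((e i : ℝ≥0∞) * t))
      fun i => by fun_prop)
    (fun i => ((h.measurable_count (hAm i)).const_mul _).expNeg),
    hsum (fun t => 1 - expNeg t) (by simp), expNeg_sum]
  refine Finset.prod_congr rfl fun i _ => ?_
  rw [h.lintegral_expNeg_count hlam (hAm i) (hv _ (hne i)) (het i)]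
  simp

/-- The Laplace functional of a homogeneous Poisson process. -/
lemma IsPoissonProcess.isPPP (h : IsPoissonProcess P Φ lam) (hlam : 0 ≤ lam) :
    IsPPP (fun n ω => Φ ω n) P (ENNReal.ofReal lam • volume) where
  measurable := h.measurable_apply
  laplace f hf := by
    have hball : ∀ k : ℕ, MeasurableSet (Metric.ball (0 : Plane) k) := fun k => measurableSet_ball
    -- Restriction to balls gives the nonzero level sets finite area while keeping the approximation
    -- increasing.
    set F : ℕ → SimpleFunc Plane ℝ≥0∞ := fun k =>
      (SimpleFunc.eapprox f k).restrict (Metric.ball 0 k) with hF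
    have hFa : ∀ k x, F k x =
        (Metric.ball (0 : Plane) k).indicator (SimpleFunc.eapprox f k) x := fun k x =>
      SimpleFunc.restrict_apply _ (hball k) x
    have hFmono : ∀ x, Monotone fun k => F k x := fun x j k hjk => by
      simp only [hFa]
      refine (Set.indicator_le_indicator (SimpleFunc.monotone_eapprox f hjk x)).trans
        (Set.indicator_le_indicator_of_subset (Metric.ball_subset_ball (by exact_mod_cast hjk))
          (fun _ => zero_le) x)
    have hFlim : ∀ x, Tendsto (fun k => F k x) atTop (𝓝 (f x)) := fun x => by
      refine (SimpleFunc.tendsto_eapprox hf x).congr' ?_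
      obtain ⟨K, hK⟩ := exists_nat_gt ‖x‖
      filter_upwards [eventually_ge_atTop K] with k hk
      rw [hFa, Set.indicator_of_mem]
      rw [mem_ball_zero_iff]
      exact hK.trans_le (by exact_mod_cast hk)
    have hFt : ∀ k x, F k x ≠ ∞ := fun k x => by
      rw [hFa]
      exact ((Set.indicator_le_self _ _ x).trans_lt (SimpleFunc.eapprox_lt_top f k x)).ne
    have hFv : ∀ k, ∀ t ≠ 0, volume (F k ⁻¹' {t}) ≠ ∞ := fun k t ht => by
      refine ne_top_of_le_ne_top (measure_ball_lt_top (μ := volume) (x := (0 : Plane)) (r := k)).ne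
        (measure_mono fun x hx => ?_)
      have hx : F k x = t := hx
      by_contra hb
      rw [hFa, Set.indicator_of_notMem hb] at hx
      exact ht hx.symm
    have hL : Tendsto (fun k => ∫⁻ ω, expNeg (∑' n, F k (Φ ω n)) ∂P) atTop
        (𝓝 (∫⁻ ω, expNeg (∑' n, f (Φ ω n)) ∂P)) := by
      refine tendsto_lintegral_of_dominated_convergence (fun _ => 1)
        (fun k => (Measurable.tsum fun n =>
          (F k).measurable.comp (h.measurable_apply n)).expNeg)
        (fun k => ae_of_all _ fun ω => expNeg_le_one _) (by simp) (ae_of_all _ fun ω => ?_)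
      refine (continuous_expNeg.tendsto _).comp ?_
      simp_rw [← lintegral_countingMeasure (Φ ω) hf,
        fun k => (lintegral_countingMeasure (Φ ω) (F k).measurable).symm]
      exact lintegral_tendsto_of_tendsto_of_monotone (fun k => (F k).measurable.aemeasurable)
        (ae_of_all _ fun x => hFmono x) (ae_of_all _ hFlim)
    have hR : Tendsto (fun k => expNeg (∫⁻ x, (1 - expNeg (F k x)) ∂(ENNReal.ofReal lam • volume)))
        atTop (𝓝 (expNeg (∫⁻ x, (1 - expNeg (f x)) ∂(ENNReal.ofReal lam • volume)))) := by
      refine (continuous_expNeg.tendsto _).comp ?_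
      refine lintegral_tendsto_of_tendsto_of_monotone
        (fun k => (measurable_const.sub (F k).measurable.expNeg).aemeasurable)
        (ae_of_all _ fun x j k hjk => tsub_le_tsub_left (expNeg_antitone (hFmono x hjk)) 1)
        (ae_of_all _ fun x => ?_)
      exact ENNReal.Tendsto.sub tendsto_const_nhds
        ((continuous_expNeg.tendsto _).comp (hFlim x)) (Or.inl ENNReal.one_ne_top)
    exact tendsto_nhds_unique hL (hR.congr fun k =>
      (h.laplace_simpleFunc hlam (F k) (hFt k) (hFv k)).symm)

end Poisson


/-! ### Intensity of the pathlosses and its analytic properties -/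

section Calculus

lemma lintegral_plane_norm {f : ℝ → ℝ≥0∞} (hf : Measurable f) :
    ∫⁻ x : Plane, f ‖x‖ = ∫⁻ r in Set.Ioi (0 : ℝ), ENNReal.ofReal (2 * Real.pi * r) * f r := by
  have hdim : Module.finrank ℝ Plane = 2 := by simp
  have h1 : ∫⁻ x : Plane, f ‖x‖ =
      ∫⁻ x : ({0}ᶜ : Set Plane), f ‖x.1‖ ∂(Measure.comap Subtype.val volume) := by
    rw [lintegral_subtype_comap (measurableSet_singleton _).compl fun x : Plane => f ‖x‖,
      restrict_compl_singleton]
  have h2 : ∫⁻ x : ({0}ᶜ : Set Plane), f ‖x.1‖ ∂(Measure.comap Subtype.val volume) =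
      ∫⁻ q, f q.2 ∂((volume : Measure Plane).toSphere.prod
        (Measure.volumeIoiPow (Module.finrank ℝ Plane - 1))) := by
    have := (volume : Measure Plane).measurePreserving_homeomorphUnitSphereProd.lintegral_comp
      (f := fun q => f q.2) (by fun_prop)
    simpa using this
  -- The total mass on the unit circle is the dimension 2 times the area π of the unit disc.
  have h3 : (volume : Measure Plane).toSphere Set.univ = ENNReal.ofReal (2 * Real.pi) := by
    rw [Measure.toSphere_apply_univ, hdim, EuclideanSpace.volume_ball_fin_two,
      ENNReal.ofReal_mul zero_le_two]
    rw [← NNReal.coe_real_pi, ENNReal.ofReal_coe_nnreal]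
    simp
  rw [h1, h2, lintegral_prod _ (by fun_prop)]
  simp only [lintegral_const]
  rw [h3, hdim, Measure.volumeIoiPow, lintegral_withDensity_eq_lintegral_mul _ (by fun_prop)
    (by fun_prop)]
  have h4 := lintegral_subtype_comap (μ := volume) (measurableSet_Ioi (a := (0 : ℝ)))
    fun r => ENNReal.ofReal (r ^ (2 - 1)) * f r
  simp only [Pi.mul_apply]
  rw [h4, ← lintegral_mul_const' _ _ ENNReal.ofReal_ne_top]
  refine setLIntegral_congr_fun measurableSet_Ioi fun r (hr : 0 < r) => ?_
  simp only [Nat.add_one_sub_one, pow_one]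
  rw [ENNReal.ofReal_mul (by positivity : 0 ≤ 2 * Real.pi)]
  ring

lemma lintegral_Ioi_comp_rpow {a : ℝ} (ha : 0 < a) (u : ℝ → ℝ≥0∞) :
    ∫⁻ r in Set.Ioi (0 : ℝ), u r =
      ∫⁻ l in Set.Ioi (0 : ℝ), ENNReal.ofReal (1 / a * l ^ (1 / a - 1)) * u (l ^ (1 / a)) := by
  have himg : (fun l : ℝ => l ^ (1 / a)) '' Set.Ioi 0 = Set.Ioi 0 := by
    ext r
    constructor
    · rintro ⟨l, hl, rfl⟩
      exact Real.rpow_pos_of_pos hl _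
    · intro hr
      refine ⟨r ^ a, Real.rpow_pos_of_pos hr _, ?_⟩
      dsimp only
      rw [← Real.rpow_mul (le_of_lt hr), mul_one_div_cancel ha.ne', Real.rpow_one]
  have h := lintegral_image_eq_lintegral_deriv_mul_of_monotoneOn (s := Set.Ioi (0 : ℝ))
    (f := fun l : ℝ => l ^ (1 / a)) (f' := fun l => 1 / a * l ^ (1 / a - 1)) measurableSet_Ioi
    (fun x hx => (Real.hasDerivAt_rpow_const (Or.inl (ne_of_gt hx))).hasDerivWithinAt)
    (fun x hx y hy hxy => Real.rpow_le_rpow (le_of_lt hx) hxy (by positivity)) u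
  rw [himg] at h
  exact h

lemma lintegral_Ioi_comp_mul {a : ℝ} (ha : 0 < a) (u : ℝ → ℝ≥0∞) :
    ∫⁻ r in Set.Ioi (0 : ℝ), u r =
      ∫⁻ l in Set.Ioi (0 : ℝ), ENNReal.ofReal a * u (a * l) := by
  have himg : (fun l : ℝ => a * l) '' Set.Ioi 0 = Set.Ioi 0 := by
    rw [Set.image_mul_left_Ioi ha, mul_zero]
  have h := lintegral_image_eq_lintegral_deriv_mul_of_monotoneOn (s := Set.Ioi (0 : ℝ))
    (f := fun l : ℝ => a * l) (f' := fun _ => a) measurableSet_Ioi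
    (fun x _ => by simpa using ((hasDerivAt_id x).const_mul a).hasDerivWithinAt)
    (fun x _ y _ hxy => mul_le_mul_of_nonneg_left hxy ha.le) u
  rw [himg] at h
  exact h

variable (p : Params)

open Classical in
/-- Pathloss of a link as a function of the position of its BS and its blocking variable. -/
noncomputable def linkLoss (k : Link) (q : Plane × ℝ) : ℝ :=
  ‖q.1‖ ^ p.exponent k (if q.2 ≤ Real.exp (-‖q.1‖ / p.losRange) then .los else .nlos)

lemma linkLoss_eq (k : Link) (q : Plane × ℝ) : linkLoss p k q =
    if q.2 ≤ Real.exp (-‖q.1‖ / p.losRange) then ‖q.1‖ ^ p.exponent k .los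
      else ‖q.1‖ ^ p.exponent k .nlos := by
  unfold linkLoss
  split_ifs <;> rfl

@[fun_prop]
lemma measurable_linkLoss (k : Link) : Measurable (linkLoss p k) := by
  have : linkLoss p k = fun q => _ := funext (linkLoss_eq p k)
  rw [this]
  exact Measurable.ite (measurableSet_le (by fun_prop) (by fun_prop)) (by fun_prop) (by fun_prop)

lemma one_div_add_one_div_sub {l a : ℝ} (hl : 0 < l) :
    1 / a * l ^ (1 / a - 1) * l ^ (1 / a) = 1 / a * l ^ (2 / a - 1) := by
  rw [mul_assoc, ← Real.rpow_add hl]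
  congr 2
  ring

lemma pathlossDensity_nonneg (k : Link) {l : ℝ} (hl : 0 ≤ l) : 0 ≤ pathlossDensity p k l := by
  have := p.density_pos k.tier
  have h1 := p.exponent_pos k .los
  have h2 := p.exponent_pos k .nlos
  have h3 := p.losRange_pos
  have h4 : Real.exp (-(l ^ (1 / p.exponent k .nlos)) / p.losRange) ≤ 1 := by
    rw [Real.exp_le_one_iff, neg_div]
    have : 0 ≤ l ^ (1 / p.exponent k .nlos) / p.losRange := by positivity
    linarith
  have h5 : 0 ≤ 1 - Real.exp (-(l ^ (1 / p.exponent k .nlos)) / p.losRange) := by linarith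
  unfold pathlossDensity
  positivity

lemma pathlossDensity_pos (k : Link) {l : ℝ} (hl : 0 < l) : 0 < pathlossDensity p k l := by
  have := p.density_pos k.tier
  have h1 := p.exponent_pos k .los
  have h2 := p.exponent_pos k .nlos
  have h3 := p.losRange_pos
  have h4 : Real.exp (-(l ^ (1 / p.exponent k .nlos)) / p.losRange) ≤ 1 := by
    rw [Real.exp_le_one_iff, neg_div]
    have : 0 ≤ l ^ (1 / p.exponent k .nlos) / p.losRange := by positivity
    linarith
  have h5 : 0 ≤ 1 - Real.exp (-(l ^ (1 / p.exponent k .nlos)) / p.losRange) := by linarith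
  unfold pathlossDensity
  positivity

@[fun_prop]
lemma measurable_pathlossDensity (k : Link) : Measurable (pathlossDensity p k) := by
  unfold pathlossDensity
  fun_prop

/-- The uniform blocking variable is split at e^{-‖x‖/μ}: the lower part is LOS, the upper part
NLOS. -/
lemma lintegral_linkLoss_blocking (k : Link) {φ : ℝ → ℝ≥0∞} (x : Plane) :
    ∫⁻ b in Set.Icc (0 : ℝ) 1, φ (linkLoss p k (x, b)) =
      ENNReal.ofReal (Real.exp (-‖x‖ / p.losRange)) * φ (‖x‖ ^ p.exponent k .los) +
      ENNReal.ofReal (1 - Real.exp (-‖x‖ / p.losRange)) * φ (‖x‖ ^ p.exponent k .nlos) := by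
  set e := Real.exp (-‖x‖ / p.losRange) with he
  have he0 : 0 ≤ e := (Real.exp_pos _).le
  have he1 : e ≤ 1 := by
    rw [he, Real.exp_le_one_iff, neg_div]
    have := p.losRange_pos
    have : 0 ≤ ‖x‖ / p.losRange := by positivity
    linarith
  have hu : Set.Icc (0 : ℝ) 1 = Set.Icc 0 e ∪ Set.Ioc e 1 := (Set.Icc_union_Ioc_eq_Icc he0 he1).symm
  rw [hu, lintegral_union measurableSet_Ioc (Set.disjoint_left.2 fun b h1 h2 => h2.1.not_ge h1.2)]
  congr 1
  · rw [setLIntegral_congr_fun (g := fun _ => φ (‖x‖ ^ p.exponent k .los)) measurableSet_Icc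
      (fun b hb => by simp only [linkLoss_eq]; rw [if_pos hb.2])]
    rw [setLIntegral_const, Real.volume_Icc, sub_zero, mul_comm]
  · rw [setLIntegral_congr_fun (g := fun _ => φ (‖x‖ ^ p.exponent k .nlos)) measurableSet_Ioc
      (fun b hb => by simp only [linkLoss_eq]; rw [if_neg hb.1.not_ge])]
    rw [setLIntegral_const, Real.volume_Ioc, mul_comm]

/-- The points of a Poisson process with independent blocking have pathlosses with intensity
`pathlossDensity`. -/
lemma lintegral_linkLoss (k : Link) {φ : ℝ → ℝ≥0∞} (hφ : Measurable φ) :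
    ∫⁻ q, φ (linkLoss p k q) ∂((ENNReal.ofReal (p.density k.tier) • (volume : Measure Plane)).prod
        (volume.restrict (Set.Icc (0 : ℝ) 1))) =
      ∫⁻ l in Set.Ioi (0 : ℝ), ENNReal.ofReal (pathlossDensity p k l) * φ l := by
  have hd := (p.density_pos k.tier).le
  have hL := p.exponent_pos k .los
  have hN := p.exponent_pos k .nlos
  have hμ := p.losRange_pos
  rw [lintegral_prod _ (by fun_prop), lintegral_smul_measure]
  simp_rw [lintegral_linkLoss_blocking]
  rw [lintegral_plane_norm (f := fun r =>
      ENNReal.ofReal (Real.exp (-r / p.losRange)) * φ (r ^ p.exponent k .los) +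
      ENNReal.ofReal (1 - Real.exp (-r / p.losRange)) * φ (r ^ p.exponent k .nlos)) (by fun_prop)]
  simp_rw [mul_add]
  rw [lintegral_add_left (by fun_prop), lintegral_Ioi_comp_rpow hL,
    lintegral_Ioi_comp_rpow hN (fun r => ENNReal.ofReal (2 * Real.pi * r) *
      (ENNReal.ofReal (1 - Real.exp (-r / p.losRange)) * φ (r ^ p.exponent k .nlos))),
    ← lintegral_add_left (by fun_prop), smul_eq_mul, ← lintegral_const_mul _ (by fun_prop)]
  refine setLIntegral_congr_fun measurableSet_Ioi fun l (hl : 0 < l) => ?_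
  have hinv : ∀ a : ℝ, 0 < a → (l ^ (1 / a)) ^ a = l := fun a ha => by
    rw [← Real.rpow_mul hl.le, one_div_mul_cancel ha.ne', Real.rpow_one]
  rw [hinv _ hL, hinv _ hN]
  have h5 : 0 ≤ 1 - Real.exp (-(l ^ (1 / p.exponent k .nlos)) / p.losRange) := by
    have : Real.exp (-(l ^ (1 / p.exponent k .nlos)) / p.losRange) ≤ 1 := by
      rw [Real.exp_le_one_iff, neg_div]
      have : 0 ≤ l ^ (1 / p.exponent k .nlos) / p.losRange := by positivity
      linarith
    linarith
  rw [← mul_assoc, ← mul_assoc, ← mul_assoc, ← mul_assoc, ← add_mul, ← mul_assoc]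
  congr 1
  rw [← ENNReal.ofReal_mul (by positivity), ← ENNReal.ofReal_mul (by positivity),
    ← ENNReal.ofReal_mul (by positivity), ← ENNReal.ofReal_mul (by positivity),
    ← ENNReal.ofReal_add (by positivity) (by positivity), ← ENNReal.ofReal_mul hd]
  congr 1
  unfold pathlossDensity
  dsimp only
  rw [← one_div_add_one_div_sub hl, ← one_div_add_one_div_sub hl]
  ring

/-! ### The intensity function -/

@[fun_prop]
lemma continuous_pathlossIntensity (k : Link) : Continuous (pathlossIntensity p k) := by
  have h : ∀ a : ℝ, 0 ≤ a → Continuous fun l : ℝ => l ^ a := fun a ha =>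
    Real.continuous_rpow_const ha
  have h1 := h (1 / p.exponent k .los) (one_div_pos.2 (p.exponent_pos _ _)).le
  have h2 := h (1 / p.exponent k .nlos) (one_div_pos.2 (p.exponent_pos _ _)).le
  have h3 := h (2 / p.exponent k .nlos) (div_pos two_pos (p.exponent_pos _ _)).le
  unfold pathlossIntensity
  fun_prop

lemma pathlossIntensity_zero (k : Link) : pathlossIntensity p k 0 = 0 := by
  have h1 := (p.exponent_pos k .los).ne'
  have h2 := (p.exponent_pos k .nlos).ne'
  unfold pathlossIntensity
  simp [Real.zero_rpow, h1, h2]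

lemma hasDerivAt_pathlossIntensity (k : Link) {l : ℝ} (hl : 0 < l) :
    HasDerivAt (pathlossIntensity p k) (pathlossDensity p k l) l := by
  have hμ := p.losRange_pos.ne'
  have hN := (p.exponent_pos k .nlos).ne'
  have key : ∀ a : ℝ, HasDerivAt (fun l : ℝ => p.losRange * (p.losRange -
      Real.exp (-(l ^ (1 / a)) / p.losRange) * (l ^ (1 / a) + p.losRange)))
      (1 / a * l ^ (2 / a - 1) * Real.exp (-(l ^ (1 / a)) / p.losRange)) l := fun a => by
    have hr : HasDerivAt (fun l : ℝ => l ^ (1 / a)) (1 / a * l ^ (1 / a - 1)) l :=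
      Real.hasDerivAt_rpow_const (Or.inl hl.ne')
    have := ((((hr.neg.div_const p.losRange).exp).mul (hr.add_const p.losRange)).const_sub
      p.losRange).const_mul p.losRange
    refine this.congr_deriv ?_
    rw [← one_div_add_one_div_sub hl]
    simp only [Pi.neg_apply]
    field_simp
    ring
  have h3 : HasDerivAt (fun l : ℝ => l ^ (2 / p.exponent k .nlos) / 2)
      (1 / p.exponent k .nlos * l ^ (2 / p.exponent k .nlos - 1)) l := by
    refine ((Real.hasDerivAt_rpow_const (Or.inl hl.ne')).div_const 2).congr_deriv ?_
    field_simp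
  have := ((((key (p.exponent k .los)).add h3).sub (key (p.exponent k .nlos))).const_mul
    (2 * Real.pi * p.density k.tier))
  refine this.congr_deriv ?_
  unfold pathlossDensity
  ring

lemma pathlossIntensity_mono (k : Link) : MonotoneOn (pathlossIntensity p k) (Set.Ici 0) := by
  refine monotoneOn_of_deriv_nonneg (convex_Ici 0) (continuous_pathlossIntensity p k).continuousOn
    (fun l hl => ?_) fun l hl => ?_ <;> rw [interior_Ici] at hl
  · exact (hasDerivAt_pathlossIntensity p k hl).differentiableAt.differentiableWithinAt
  · rw [(hasDerivAt_pathlossIntensity p k hl).deriv]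
    exact pathlossDensity_nonneg p k (le_of_lt hl)

lemma pathlossIntensity_nonneg (k : Link) {l : ℝ} (hl : 0 ≤ l) : 0 ≤ pathlossIntensity p k l := by
  rw [← pathlossIntensity_zero p k]
  exact pathlossIntensity_mono p k (Set.mem_Ici.2 le_rfl) hl hl

/-- The LOS bracket is nonnegative and the subtracted NLOS bracket is at most μ², so up to a
positive factor the intensity is at least l^{2/α_n}/2 - μ². -/
lemma tendsto_pathlossIntensity (k : Link) : Tendsto (pathlossIntensity p k) atTop atTop := by
  have hd := p.density_pos k.tier
  have hN := p.exponent_pos k .nlos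
  have hμ := p.losRange_pos
  have h1 : Tendsto (fun l : ℝ => 2 * Real.pi * p.density k.tier *
      (l ^ (2 / p.exponent k .nlos) / 2 - p.losRange * p.losRange)) atTop atTop :=
    Tendsto.const_mul_atTop (by positivity) (tendsto_atTop_add_const_right _ _
      ((tendsto_rpow_atTop (by positivity)).atTop_div_const two_pos))
  refine tendsto_atTop_mono' _ ?_ h1
  filter_upwards [eventually_ge_atTop 0] with l hl
  unfold pathlossIntensity
  dsimp only
  refine mul_le_mul_of_nonneg_left ?_ (by positivity)
  have e1 : Real.exp (-(l ^ (1 / p.exponent k .los)) / p.losRange) *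
      (l ^ (1 / p.exponent k .los) + p.losRange) ≤ p.losRange := by
    set r := l ^ (1 / p.exponent k .los)
    have h2 := Real.add_one_le_exp (r / p.losRange)
    rw [neg_div, Real.exp_neg, inv_mul_le_iff₀ (Real.exp_pos _)]
    calc r + p.losRange = (r / p.losRange + 1) * p.losRange := by field_simp
      _ ≤ _ := mul_le_mul_of_nonneg_right h2 hμ.le
  have e2 : 0 ≤ Real.exp (-(l ^ (1 / p.exponent k .nlos)) / p.losRange) *
      (l ^ (1 / p.exponent k .nlos) + p.losRange) := by positivity
  have e3 := mul_le_mul_of_nonneg_left e1 hμ.le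
  have e4 := mul_nonneg hμ.le e2
  nlinarith

lemma lintegral_Ioo_pathlossDensity (k : Link) {s : ℝ} (hs : 0 ≤ s) :
    ∫⁻ l in Set.Ioo 0 s, ENNReal.ofReal (pathlossDensity p k l) =
      ENNReal.ofReal (pathlossIntensity p k s) := by
  have hcont := (continuous_pathlossIntensity p k).continuousOn (s := Set.Icc 0 s)
  have hder : ∀ x ∈ Set.Ioo 0 s, HasDerivAt (pathlossIntensity p k) (pathlossDensity p k x) x :=
    fun x hx => hasDerivAt_pathlossIntensity p k hx.1
  -- The density can be unbounded near 0 when an exponent exceeds 2; it is integrable as the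
  -- nonnegative derivative of a function continuous up to 0.
  have hint : IntegrableOn (pathlossDensity p k) (Set.Ioc 0 s) :=
    intervalIntegral.integrableOn_deriv_of_nonneg hcont hder fun x hx =>
      pathlossDensity_nonneg p k hx.1.le
  have h1 := intervalIntegral.integral_eq_sub_of_hasDerivAt_of_le hs hcont hder
    ((intervalIntegrable_iff_integrableOn_Ioc_of_le hs).2 hint)
  rw [pathlossIntensity_zero, sub_zero, intervalIntegral.integral_of_le hs] at h1
  rw [← h1, setLIntegral_congr Ioo_ae_eq_Ioc, ofReal_integral_eq_lintegral_ofReal hint]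
  filter_upwards [ae_restrict_mem measurableSet_Ioc] with l hl
  exact pathlossDensity_nonneg p k hl.1.le

/-- `∫ e^{-D} D' = 1`. -/
lemma lintegral_deriv_mul_exp_neg {D D' : ℝ → ℝ} (hD : Continuous D) (h0 : D 0 = 0)
    (hder : ∀ s, 0 < s → HasDerivAt D (D' s) s) (hnn : ∀ s, 0 < s → 0 ≤ D' s)
    (htop : Tendsto D atTop atTop) :
    ∫⁻ s in Set.Ioi (0 : ℝ), ENNReal.ofReal (D' s * Real.exp (-D s)) = 1 := by
  have hg : Tendsto (fun s => -Real.exp (-D s)) atTop (𝓝 (-0)) :=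
    (Real.tendsto_exp_neg_atTop_nhds_zero.comp htop).neg
  have hd : ∀ s ∈ Set.Ioi (0 : ℝ), HasDerivAt (fun s => -Real.exp (-D s)) (D' s * Real.exp (-D s)) s :=
    fun s hs => by
      refine ((hder s hs).neg.exp.neg).congr_deriv ?_
      simp only [Pi.neg_apply]
      ring
  have hp : ∀ s ∈ Set.Ioi (0 : ℝ), 0 ≤ D' s * Real.exp (-D s) := fun s hs =>
    mul_nonneg (hnn s hs) (Real.exp_pos _).le
  have hc : ContinuousWithinAt (fun s => -Real.exp (-D s)) (Set.Ici 0) 0 :=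
    (by fun_prop : Continuous fun s => -Real.exp (-D s)).continuousWithinAt
  have hi := integrableOn_Ioi_deriv_of_nonneg hc hd hp hg
  have h1 := integral_Ioi_of_hasDerivAt_of_nonneg hc hd hp hg
  rw [← ofReal_integral_eq_lintegral_ofReal hi, h1, h0]
  · simp
  · filter_upwards [ae_restrict_mem measurableSet_Ioi] with s hs
    exact hp s hs

/-- The far SBSs contribute finitely to the interference. -/
lemma integrableOn_pathlossDensity_div {a : ℝ} (ha : 0 < a) :
    IntegrableOn (fun z => pathlossDensity p (.access .sbs) z / z) (Set.Ioi a) := by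
  set k := Link.access .sbs
  have hd := p.density_pos k.tier
  have hL := p.exponent_pos k .los
  have hN := p.exponent_pos k .nlos
  have h2 := p.two_lt_exponent
  have hμ := p.losRange_pos
  set C := 2 * Real.pi * p.density k.tier with hC
  have hC0 : 0 ≤ C := by positivity
  -- The NLOS part of the quotient: its exponent is below -1 exactly because α_n > 2.
  have hi1 : IntegrableOn (fun z : ℝ => z ^ (2 / p.exponent k .nlos - 2)) (Set.Ioi a) := by
    refine integrableOn_Ioi_rpow_of_lt ?_ ha
    have : 2 / p.exponent k .nlos < 1 := (div_lt_one hN).2 h2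
    linarith
  have hi2 : IntegrableOn (fun z : ℝ => z ^ (-2 : ℝ)) (Set.Ioi a) :=
    integrableOn_Ioi_rpow_of_lt (by norm_num) ha
  have hi : IntegrableOn (fun z : ℝ => C * (1 / p.exponent k .los * (2 * p.losRange ^ 2) * z ^ (-2 : ℝ) +
      1 / p.exponent k .nlos * z ^ (2 / p.exponent k .nlos - 2))) (Set.Ioi a) :=
    ((hi2.const_mul _).add (hi1.const_mul _)).const_mul C
  refine hi.mono' ((measurable_pathlossDensity p k).div measurable_id).aestronglyMeasurable ?_
  filter_upwards [ae_restrict_mem measurableSet_Ioi] with z hz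
  have hz0 : 0 < z := ha.trans hz
  rw [Real.norm_of_nonneg (div_nonneg (pathlossDensity_nonneg p k hz0.le) hz0.le),
    div_le_iff₀ hz0]
  unfold pathlossDensity
  dsimp only
  rw [← hC, mul_assoc C]
  refine mul_le_mul_of_nonneg_left ?_ hC0
  rw [add_mul]
  have e2 : z ^ (2 / p.exponent k .nlos - 1) = z ^ (2 / p.exponent k .nlos - 2) * z := by
    conv_rhs => rw [← Real.rpow_one z, ← Real.rpow_mul hz0.le, one_mul, ← Real.rpow_add hz0]
    congr 1; ring
  refine add_le_add ?_ ?_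
  · set t := z ^ (1 / p.exponent k .los) with ht
    have ht0 : 0 < t := Real.rpow_pos_of_pos hz0 _
    have e1 : z ^ (2 / p.exponent k .los - 1) = t ^ 2 * z ^ (-2 : ℝ) * z := by
      rw [ht, ← Real.rpow_natCast, ← Real.rpow_mul hz0.le, ← Real.rpow_add hz0]
      conv_rhs => rw [← Real.rpow_one z, ← Real.rpow_mul hz0.le, one_mul, ← Real.rpow_add hz0]
      congr 1; push_cast; ring
    -- From x²/2 ≤ e^x: the exponential rarity of LOS links beats any LOS exponent and bounds that
    -- part of the quotient by a multiple of z^{-2}.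
    have e3 : t ^ 2 * Real.exp (-t / p.losRange) ≤ 2 * p.losRange ^ 2 := by
      have h3 : (t / p.losRange) ^ 2 / 2 ≤ Real.exp (t / p.losRange) := by
        have := Real.quadratic_le_exp_of_nonneg (div_pos ht0 hμ).le
        have h4 := (div_pos ht0 hμ).le
        linarith
      rw [neg_div, Real.exp_neg, ← div_eq_mul_inv, div_le_iff₀ (Real.exp_pos _)]
      calc t ^ 2 = 2 * p.losRange ^ 2 * ((t / p.losRange) ^ 2 / 2) := by field_simp
        _ ≤ _ := mul_le_mul_of_nonneg_left h3 (by positivity)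
    rw [e1]
    calc 1 / p.exponent k .los * (t ^ 2 * z ^ (-2 : ℝ) * z) * Real.exp (-t / p.losRange)
        = 1 / p.exponent k .los * (t ^ 2 * Real.exp (-t / p.losRange)) * z ^ (-2 : ℝ) * z := by ring
      _ ≤ _ := by gcongr
  · rw [e2, ← mul_assoc]
    refine mul_le_of_le_one_right (by positivity) ?_
    linarith [Real.exp_pos (-(z ^ (1 / p.exponent k .nlos)) / p.losRange)]

end Calculus


/-! ### Tiers as a finite discrete space; measurability of links -/

instance : DecidableEq Tier := fun i j => by
  cases i <;> cases j <;> first | exact isTrue rfl | exact isFalse (by simp)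

instance : Fintype Tier := ⟨{.mbs, .sbs}, fun i => by cases i <;> simp⟩

instance : MeasurableSpace Tier := ⊤

instance : DiscreteMeasurableSpace Tier := ⟨fun _ => trivial⟩

section Links

variable {Ω : Type*} {mΩ : MeasurableSpace Ω} {p : Params} {X : ∀ s : Source, Ω → s.Val}

lemma measurable_tuple {ι E : Type*} [MeasurableSpace E] {f : ι → Ω → E}
    (h : ∀ i, Measurable (f i)) : Measurable fun ω i => f i ω :=
  measurable_pi_iff.2 h

lemma measurable_point (k : Link) (n : ℕ) (h : Measurable (X (.points k))) :
    Measurable (point X k n) :=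
  (measurable_pi_apply (X := fun _ : ℕ => Plane) n).comp h

lemma pathloss_eq (k : Link) (n : ℕ) (ω : Ω) :
    pathloss p X k n ω = linkLoss p k (point X k n ω, blockVar X k n ω) := rfl

lemma measurable_pathloss (k : Link) (n : ℕ) (h1 : Measurable (X (.points k)))
    (h2 : Measurable (X (.blocking k n))) : Measurable (pathloss p X k n) := by
  have h3 : Measurable (blockVar X k n) := h2
  have h4 : pathloss p X k n = fun ω => linkLoss p k (point X k n ω, blockVar X k n ω) :=
    funext fun ω => pathloss_eq k n ω
  rw [h4]
  exact (measurable_linkLoss p k).comp ((measurable_point k n h1).prodMk h3)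

end Links

/-! ### Independence by disjoint sources; the marked Poisson processes of links -/

section Sources

variable {Ω : Type*} [mΩ : MeasurableSpace Ω] {P : Measure Ω} [IsProbabilityMeasure P]
  {p : Params} {X : ∀ s : Source, Ω → s.Val}

/-- The information contained in a set of sources of randomness. -/
@[reducible]
def sourceAlgebra (X : ∀ s : Source, Ω → s.Val) (S : Set Source) : MeasurableSpace Ω :=
  ⨆ s ∈ S, MeasurableSpace.comap (X s) (Source.measurableSpaceVal s)

lemma measurable_source {S : Set Source} {s : Source} (hs : s ∈ S) :
    Measurable[sourceAlgebra X S] (X s) := by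
  rw [measurable_iff_comap_le]
  exact le_iSup₂ (f := fun s (_ : s ∈ S) =>
    MeasurableSpace.comap (X s) (Source.measurableSpaceVal s)) s hs

lemma sourceAlgebra_le (hX : IsNetwork p X P) (S : Set Source) : sourceAlgebra X S ≤ mΩ :=
  iSup₂_le fun s _ => (hX.measurable s).comap_le

/-- Independence claims about the network quantities reduce to listing the sources used and checking
that two lists are disjoint. -/
lemma indep_sourceAlgebra (hX : IsNetwork p X P) {S T : Set Source} (hST : Disjoint S T) :
    Indep (sourceAlgebra X S) (sourceAlgebra X T) P :=
  indep_iSup_of_disjoint (fun s => (hX.measurable s).comap_le) hX.indep.iIndep hST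

lemma indepFun_of_sources (hX : IsNetwork p X P) {S T : Set Source} (hST : Disjoint S T)
    {β γ : Type*} [MeasurableSpace β] [MeasurableSpace γ] {f : Ω → β} {g : Ω → γ}
    (hf : Measurable[sourceAlgebra X S] f) (hg : Measurable[sourceAlgebra X T] g) :
    IndepFun f g P :=
  indep_of_indep_of_le (indep_sourceAlgebra hX hST) (measurable_iff_comap_le.1 hf)
    (measurable_iff_comap_le.1 hg)

/-- Positions and blocking variables of the links of a given type. -/
lemma isPPP_link (hX : IsNetwork p X P) (k : Link) :
    IsPPP (fun n ω => (point X k n ω, blockVar X k n ω)) P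
      ((ENNReal.ofReal (p.density k.tier) • (volume : Measure Plane)).prod
        (volume.restrict (Set.Icc (0 : ℝ) 1))) := by
  have h1 : IsPPP (fun n ω => point X k n ω) P
      (ENNReal.ofReal (p.density k.tier) • (volume : Measure Plane)) :=
    (hX.points_law k).isPPP (p.density_pos _).le
  have : IsProbabilityMeasure ((volume : Measure ℝ).restrict (Set.Icc (0 : ℝ) 1)) :=
    ⟨by simp⟩
  refine h1.marking (M := blockVar X k) (fun n => hX.measurable (.blocking k n))
    (hX.indep.precomp (g := fun n => Source.blocking k n) fun m n h => by injection h)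
    (hX.blocking_law k) ?_
  refine indepFun_of_sources hX (S := {.points k}) (T := Set.range (Source.blocking k)) ?_ ?_ ?_
  · rw [Set.disjoint_singleton_left]
    rintro ⟨n, hn⟩
    cases hn
  · exact measurable_tuple fun n => measurable_point k n (measurable_source rfl)
  · exact measurable_tuple fun n => measurable_source (X := X) (s := .blocking k n) ⟨n, rfl⟩

/-- The law of a beam mark which is `true` with probability `θ / 2π`. -/
noncomputable def beamMeasure (θ : ℝ) : Measure Bool :=
  ENNReal.ofReal (θ / (2 * Real.pi)) • Measure.dirac true +
    ENNReal.ofReal ((2 * Real.pi - θ) / (2 * Real.pi)) • Measure.dirac false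

lemma lintegral_beamMeasure (θ : ℝ) (f : Bool → ℝ≥0∞) :
    ∫⁻ b, f b ∂(beamMeasure θ) = ENNReal.ofReal (θ / (2 * Real.pi)) * f true +
      ENNReal.ofReal ((2 * Real.pi - θ) / (2 * Real.pi)) * f false := by
  rw [beamMeasure, lintegral_add_measure, lintegral_smul_measure, lintegral_smul_measure]
  simp

lemma isProbabilityMeasure_beamMeasure {θ : ℝ} (hθ : θ ∈ Set.Icc 0 (2 * Real.pi)) :
    IsProbabilityMeasure (beamMeasure θ) := by
  have := Real.pi_pos
  refine ⟨?_⟩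
  simp only [beamMeasure, Measure.add_apply, Measure.smul_apply, measure_univ, smul_eq_mul, mul_one]
  rw [← ENNReal.ofReal_add (div_nonneg hθ.1 (by positivity))
    (div_nonneg (by linarith [hθ.2]) (by positivity)), ← add_div]
  simp [this.ne']

lemma map_eq_beamMeasure {θ : ℝ} (hθ : θ ∈ Set.Icc 0 (2 * Real.pi)) {b : Ω → Bool}
    (hb : Measurable b) (h : P {ω | b ω = true} = ENNReal.ofReal (θ / (2 * Real.pi))) :
    P.map b = beamMeasure θ := by
  have h1 := isProbabilityMeasure_beamMeasure hθ
  have h2 : IsProbabilityMeasure (P.map b) := Measure.isProbabilityMeasure_map hb.aemeasurable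
  have ht : P.map b {true} = beamMeasure θ {true} := by
    rw [Measure.map_apply hb (measurableSet_singleton _)]
    have h' : P (b ⁻¹' {true}) = ENNReal.ofReal (θ / (2 * Real.pi)) := h
    simpa [beamMeasure] using h'
  refine Measure.ext_of_singleton fun c => ?_
  cases c
  · have : ({false} : Set Bool) = {true}ᶜ := by ext c; cases c <;> simp
    rw [this, prob_compl_eq_one_sub (measurableSet_singleton _),
      prob_compl_eq_one_sub (measurableSet_singleton _), ht]
  · exact ht

/-- Positions, blocking variables, fading and beam marks of the access links of the SBSs. -/
lemma isPPP_sbs (hX : IsNetwork p X P) :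
    IsPPP (fun n ω => ((((point X (.access .sbs) n ω, blockVar X (.access .sbs) n ω),
        fadingVar X (.access .sbs) n ω), (beamVar X n ω).1), (beamVar X n ω).2)) P
      ((((((ENNReal.ofReal (p.density .sbs) • (volume : Measure Plane)).prod
        (volume.restrict (Set.Icc (0 : ℝ) 1))).prod (expMeasure 1)).prod
          (beamMeasure p.sbsBeamwidth))).prod (beamMeasure p.userBeamwidth)) := by
  have i1 := isProbabilityMeasure_expMeasure one_pos
  have i2 := isProbabilityMeasure_beamMeasure p.sbsBeamwidth_mem
  have i3 := isProbabilityMeasure_beamMeasure p.userBeamwidth_mem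
  set k : Link := .access .sbs with hk
  set S1 : Set Source := {.points k} ∪ Set.range (Source.blocking k) with hS1
  set S2 : Set Source := S1 ∪ Set.range (Source.fading k) with hS2
  set S3 : Set Source := S2 ∪ Set.range Source.sbsBeam with hS3
  have m1 : ∀ {S : Set Source}, S1 ⊆ S → ∀ n, Measurable[sourceAlgebra X S]
      fun ω => (point X k n ω, blockVar X k n ω) := fun hS n =>
    (measurable_point k n (measurable_source (hS (Or.inl rfl)))).prodMk
      (measurable_source (s := .blocking k n) (hS (Or.inr ⟨n, rfl⟩)))
  have m2 : ∀ {S : Set Source}, S2 ⊆ S → ∀ n, Measurable[sourceAlgebra X S]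
      fun ω => ((point X k n ω, blockVar X k n ω), fadingVar X k n ω) := fun hS n =>
    (m1 (Set.subset_union_left.trans hS) n).prodMk
      (measurable_source (s := .fading k n) (hS (Or.inr ⟨n, rfl⟩)))
  have m3 : ∀ n, Measurable[sourceAlgebra X S3]
      fun ω => (((point X k n ω, blockVar X k n ω), fadingVar X k n ω), (beamVar X n ω).1) :=
    fun n => (m2 Set.subset_union_left n).prodMk
      (measurable_source (s := .sbsBeam n) (Or.inr ⟨n, rfl⟩))
  -- Fading and the two beam marks are attached one at a time; each new family of sources is
  -- disjoint from those already used.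
  have p2 := (isPPP_link hX k).marking (M := fadingVar X k) (fun n => hX.measurable (.fading k n))
    (hX.indep.precomp (g := fun n => Source.fading k n) fun m n h => by injection h)
    (hX.fading_law k)
    (indepFun_of_sources hX (S := S1) (T := Set.range (Source.fading k))
      (by
        rw [Set.disjoint_left]
        rintro s (rfl | ⟨n, rfl⟩) ⟨n', hn'⟩ <;> cases hn')
      (measurable_tuple fun n => m1 subset_rfl n)
      (measurable_tuple fun n => measurable_source (X := X) (s := .fading k n) ⟨n, rfl⟩))
  have p3 := p2.marking (M := fun n ω => (beamVar X n ω).1) (fun n => hX.measurable (.sbsBeam n))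
    (hX.indep.precomp (g := fun n => Source.sbsBeam n) fun m n h => by injection h)
    (fun n => map_eq_beamMeasure p.sbsBeamwidth_mem (hX.measurable (.sbsBeam n)) (hX.sbsBeam_law n))
    (indepFun_of_sources hX (S := S2) (T := Set.range Source.sbsBeam)
      (by
        rw [Set.disjoint_left]
        rintro s ((rfl | ⟨n, rfl⟩) | ⟨n, rfl⟩) ⟨n', hn'⟩ <;> cases hn')
      (measurable_tuple fun n => m2 subset_rfl n)
      (measurable_tuple fun n => measurable_source (X := X) (s := .sbsBeam n) ⟨n, rfl⟩))
  exact p3.marking (M := fun n ω => (beamVar X n ω).2) (fun n => hX.measurable (.userBeam n))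
    (hX.indep.precomp (g := fun n => Source.userBeam n) fun m n h => by injection h)
    (fun n => map_eq_beamMeasure p.userBeamwidth_mem (hX.measurable (.userBeam n))
      (hX.userBeam_law n))
    (indepFun_of_sources hX (S := S3) (T := Set.range Source.userBeam)
      (by
        rw [Set.disjoint_left]
        rintro s (((rfl | ⟨n, rfl⟩) | ⟨n, rfl⟩) | ⟨n, rfl⟩) ⟨n', hn'⟩ <;> cases hn')
      (measurable_tuple m3)
      (measurable_tuple fun n => measurable_source (X := X) (s := .userBeam n) ⟨n, rfl⟩))

end Sources


/-! ### The access process: both tiers as one Poisson process -/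

section Access

variable {Ω : Type*} [mΩ : MeasurableSpace Ω] {P : Measure Ω} [IsProbabilityMeasure P]
  {p : Params} {X : ∀ s : Source, Ω → s.Val}

/-- The biased received power is `biasConst p i` divided by the pathloss. -/
def biasConst (p : Params) (i : Tier) : ℝ :=
  p.power i * p.bias i * p.refLoss (.access i) * p.gain i * p.userGain

lemma biasConst_pos (p : Params) (i : Tier) : 0 < biasConst p i := by
  have h1 := p.power_pos i
  have h2 := p.bias_pos i
  have h3 := p.refLoss_pos (.access i)
  have h4 := p.gain_pos i
  have h5 := p.userGain_pos
  unfold biasConst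
  positivity

/-- The interfering power of a BS. -/
noncomputable def interfPower (p : Params) (i : Tier) (h : ℝ) (b : Bool × Bool) (l : ℝ) : ℝ :=
  match i with
  | .mbs => 0
  | .sbs => p.power .sbs * h * p.refLoss (.access .sbs) * p.interfGain b * l⁻¹

lemma measurable_interfGain : Measurable p.interfGain := measurable_of_finite _

/-- A BS as seen from the typical UE: tier, inverse of the biased power, and interference. -/
noncomputable def accessPoint (p : Params) (X : ∀ s : Source, Ω → s.Val) (q : Tier × ℕ) (ω : Ω) :
    Tier × ℝ × ℝ :=
  (q.1, pathloss p X (.access q.1) q.2 ω / biasConst p q.1,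
    interfPower p q.1 (fadingVar X (.access .sbs) q.2 ω) (beamVar X q.2 ω)
      (pathloss p X (.access q.1) q.2 ω))

/-- The intensity measure of positions, blocking variables, fading and beam marks of the SBSs. -/
noncomputable abbrev sbsMarkIntensity (p : Params) :
    Measure ((((Plane × ℝ) × ℝ) × Bool) × Bool) :=
  (((((ENNReal.ofReal (p.density .sbs) • (volume : Measure Plane)).prod
    (volume.restrict (Set.Icc (0 : ℝ) 1))).prod (expMeasure 1)).prod
      (beamMeasure p.sbsBeamwidth))).prod (beamMeasure p.userBeamwidth)

/-- Together with `sbsImage`, the deterministic map that sends a marked BS to its `accessPoint`, so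
that the mapping theorem yields the intensity. The last entry is 0 because MBS interference is
neglected. -/
noncomputable def mbsImage (p : Params) (q : Plane × ℝ) : Tier × ℝ × ℝ :=
  (.mbs, linkLoss p (.access .mbs) q / biasConst p .mbs, 0)

noncomputable def sbsImage (p : Params) (q : (((Plane × ℝ) × ℝ) × Bool) × Bool) : Tier × ℝ × ℝ :=
  (.sbs, linkLoss p (.access .sbs) q.1.1.1 / biasConst p .sbs,
    interfPower p .sbs q.1.1.2 (q.1.2, q.2) (linkLoss p (.access .sbs) q.1.1.1))

@[fun_prop]
lemma measurable_mbsImage : Measurable (mbsImage p) := by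
  unfold mbsImage
  fun_prop

lemma measurable_interfPower (i : Tier) :
    Measurable fun r : (ℝ × (Bool × Bool)) × ℝ => interfPower p i r.1.1 r.1.2 r.2 := by
  cases i
  · exact measurable_const
  · have := measurable_interfGain (p := p)
    unfold interfPower
    fun_prop

@[fun_prop]
lemma measurable_sbsImage : Measurable (sbsImage p) := by
  unfold sbsImage
  refine measurable_const.prodMk ((by fun_prop : Measurable _).prodMk ?_)
  have h : Measurable fun q : (((Plane × ℝ) × ℝ) × Bool) × Bool =>
    ((q.1.1.2, (q.1.2, q.2)), linkLoss p (.access .sbs) q.1.1.1) := by fun_prop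
  exact (measurable_interfPower (p := p) .sbs).comp h

/-- The intensity measure of the access process. -/
noncomputable def accessIntensity (p : Params) : Measure (Tier × ℝ × ℝ) :=
  (((ENNReal.ofReal (p.density .mbs) • (volume : Measure Plane)).prod
    (volume.restrict (Set.Icc (0 : ℝ) 1))).map (mbsImage p)) +
    (sbsMarkIntensity p).map (sbsImage p)

instance : SFinite (accessIntensity p) := by
  have i1 := isProbabilityMeasure_expMeasure one_pos
  have i2 := isProbabilityMeasure_beamMeasure p.sbsBeamwidth_mem
  have i3 := isProbabilityMeasure_beamMeasure p.userBeamwidth_mem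
  have i4 : SFinite (sbsMarkIntensity p) := inferInstance
  have i5 : SFinite ((sbsMarkIntensity p).map (sbsImage p)) := inferInstance
  unfold accessIntensity
  infer_instance

/-- The sources of the access links. -/
def accessSources : Set Source :=
  {s | (∃ i, s = .points (.access i)) ∨ (∃ i n, s = .blocking (.access i) n) ∨
    (∃ i n, s = .fading (.access i) n) ∨ (∃ n, s = .sbsBeam n) ∨ (∃ n, s = .userBeam n)}

lemma measurable_accessPoint_of {Ω : Type*} {𝓕 : MeasurableSpace Ω}
    {X : ∀ s : Source, Ω → s.Val} (q : Tier × ℕ)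
    (h1 : Measurable (X (.points (.access q.1))))
    (h2 : Measurable (X (.blocking (.access q.1) q.2)))
    (h3 : q.1 = .sbs → Measurable (fadingVar X (.access .sbs) q.2))
    (h4 : q.1 = .sbs → Measurable (beamVar X q.2)) :
    Measurable (accessPoint p X q) := by
  have h5 := measurable_pathloss (p := p) (.access q.1) q.2 h1 h2
  unfold accessPoint
  refine measurable_const.prodMk ((h5.div_const _).prodMk ?_)
  obtain ⟨i, n⟩ := q
  cases i
  · exact measurable_const
  · exact (measurable_interfPower (p := p) .sbs).comp (((h3 rfl).prodMk (h4 rfl)).prodMk h5)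

/-- Image processes of the two tiers are Poisson and use disjoint sources, so their superposition is
Poisson; it only has to be reindexed by tier and number. -/
lemma isPPP_access (hX : IsNetwork p X P) :
    IsPPP (accessPoint p X) P (accessIntensity p) := by
  have h1 := (isPPP_link hX (.access .mbs)).map (measurable_mbsImage (p := p))
  have h2 := (isPPP_sbs hX).map (measurable_sbsImage (p := p))
  have hind : IndepFun (fun ω n => mbsImage p (point X (.access .mbs) n ω,
      blockVar X (.access .mbs) n ω)) (fun ω n => sbsImage p ((((point X (.access .sbs) n ω,
        blockVar X (.access .sbs) n ω), fadingVar X (.access .sbs) n ω), (beamVar X n ω).1),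
        (beamVar X n ω).2)) P := by
    refine indepFun_of_sources hX
      (S := {s | s = .points (.access .mbs) ∨ ∃ n, s = .blocking (.access .mbs) n})
      (T := {s | s = .points (.access .sbs) ∨ (∃ n, s = .blocking (.access .sbs) n) ∨
        (∃ n, s = .fading (.access .sbs) n) ∨ (∃ n, s = .sbsBeam n) ∨ (∃ n, s = .userBeam n)})
      ?_ ?_ ?_
    · rw [Set.disjoint_left]
      rintro s (rfl | ⟨n, rfl⟩) <;>
        rintro (h | ⟨k, h⟩ | ⟨k, h⟩ | ⟨k, h⟩ | ⟨k, h⟩) <;> simp at h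
    · exact measurable_tuple fun n => measurable_mbsImage.comp
        ((measurable_point _ n (measurable_source (Or.inl rfl))).prodMk
          (measurable_source (s := .blocking _ n) (Or.inr ⟨n, rfl⟩)))
    · exact measurable_tuple fun n => measurable_sbsImage.comp
        (((((measurable_point _ n (measurable_source (Or.inl rfl))).prodMk
          (measurable_source (s := .blocking _ n) (Or.inr (Or.inl ⟨n, rfl⟩)))).prodMk
          (measurable_source (s := .fading _ n) (Or.inr (Or.inr (Or.inl ⟨n, rfl⟩))))).prodMk
          (measurable_source (s := .sbsBeam n) (Or.inr (Or.inr (Or.inr (Or.inl ⟨n, rfl⟩)))))).prodMk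
          (measurable_source (s := .userBeam n) (Or.inr (Or.inr (Or.inr (Or.inr ⟨n, rfl⟩))))))
  set e : Tier × ℕ ≃ ℕ ⊕ ℕ :=
    { toFun := fun q => match q with
        | (.mbs, n) => .inl n
        | (.sbs, n) => .inr n
      invFun := Sum.elim (fun n => (.mbs, n)) (fun n => (.sbs, n))
      left_inv := by rintro ⟨i, n⟩; cases i <;> rfl
      right_inv := by rintro (n | n) <;> rfl } with he
  have h3 := (h1.superpose h2 hind).reindex e
  have h4 : accessPoint p X = fun q => Sum.elim
      (fun n ω => mbsImage p (point X (.access .mbs) n ω, blockVar X (.access .mbs) n ω))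
      (fun n ω => sbsImage p ((((point X (.access .sbs) n ω, blockVar X (.access .sbs) n ω),
        fadingVar X (.access .sbs) n ω), (beamVar X n ω).1), (beamVar X n ω).2)) (e q) := by
    funext q ω
    obtain ⟨i, n⟩ := q
    cases i <;> rfl
  rw [h4]
  exact h3

/-- The average over fading and beam marks of a function of an SBS. -/
noncomputable def sbsAverage (p : Params) (G : Tier × ℝ × ℝ → ℝ≥0∞) (l : ℝ) : ℝ≥0∞ :=
  ∑ b : Bool × Bool, ENNReal.ofReal (p.interfGainProb b) *
    ∫⁻ h, G (.sbs, l / biasConst p .sbs, interfPower p .sbs h b l) ∂(expMeasure 1)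

lemma interfGainProb_nonneg (b : Bool × Bool) : 0 ≤ p.interfGainProb b := by
  have h1 := p.sbsBeamwidth_mem
  have h2 := p.userBeamwidth_mem
  have h3 : 0 ≤ 2 * Real.pi - p.sbsBeamwidth := sub_nonneg.2 h1.2
  have h4 : 0 ≤ 2 * Real.pi - p.userBeamwidth := sub_nonneg.2 h2.2
  unfold Params.interfGainProb
  refine div_nonneg (mul_nonneg ?_ ?_) (by positivity) <;> split_ifs <;>
    first | exact h1.1 | exact h2.1 | assumption

lemma sum_interfGainProb : ∑ b : Bool × Bool, p.interfGainProb b = 1 := by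
  have := Real.pi_pos.ne'
  rw [Fintype.sum_prod_type]
  simp only [Fintype.sum_bool, Params.interfGainProb]
  simp
  field_simp
  ring

/-- Fubini over the marks, then positions and blocking are reduced to the pathloss by
`lintegral_linkLoss`. The two independent beam marks combine into the four gain probabilities. -/
lemma lintegral_accessIntensity {G : Tier × ℝ × ℝ → ℝ≥0∞} (hG : Measurable G) :
    ∫⁻ y, G y ∂(accessIntensity p) =
      (∫⁻ l in Set.Ioi (0 : ℝ), ENNReal.ofReal (pathlossDensity p (.access .mbs) l) *
        G (.mbs, l / biasConst p .mbs, 0)) +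
      ∫⁻ l in Set.Ioi (0 : ℝ), ENNReal.ofReal (pathlossDensity p (.access .sbs) l) *
        sbsAverage p G l := by
  have i1 := isProbabilityMeasure_expMeasure one_pos
  have i2 := isProbabilityMeasure_beamMeasure p.sbsBeamwidth_mem
  have i3 := isProbabilityMeasure_beamMeasure p.userBeamwidth_mem
  rw [accessIntensity, lintegral_add_measure, lintegral_map hG measurable_mbsImage,
    lintegral_map hG measurable_sbsImage]
  congr 1
  · exact lintegral_linkLoss p (.access .mbs)
      (φ := fun l => G (.mbs, l / biasConst p .mbs, 0)) (by fun_prop)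
  · have hm : ∀ b, Measurable fun q : ℝ × ℝ =>
        G (.sbs, q.1 / biasConst p .sbs, interfPower p .sbs q.2 b q.1) := fun b => by
      refine hG.comp (measurable_const.prodMk ((by fun_prop : Measurable _).prodMk ?_))
      exact (measurable_interfPower (p := p) .sbs).comp
        ((measurable_snd.prodMk measurable_const).prodMk measurable_fst)
    have hφ : Measurable (sbsAverage p G) := by
      unfold sbsAverage
      exact Finset.measurable_sum _ fun b _ => (hm b).lintegral_prod_right'.const_mul _
    rw [← lintegral_linkLoss p (.access .sbs) hφ]
    have hGm : Measurable fun q => G (sbsImage p q) := hG.comp measurable_sbsImage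
    rw [lintegral_prod _ hGm.aemeasurable, lintegral_prod _ (by
      exact hGm.lintegral_prod_right'.aemeasurable), lintegral_prod _ (by
      exact (hGm.lintegral_prod_right'.lintegral_prod_right').aemeasurable)]
    refine lintegral_congr fun q => ?_
    simp only [lintegral_beamMeasure]
    have hm' : ∀ b : Bool × Bool, Measurable fun h => G (sbsImage p (((q, h), b.1), b.2)) := fun b =>
      hGm.comp (by fun_prop)
    have e1 := fun b : Bool × Bool => hm' b
    have r1 : ∀ b : Bool × Bool, ∫⁻ h, G (.sbs, linkLoss p (.access .sbs) q / biasConst p .sbs,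
        interfPower p .sbs h b (linkLoss p (.access .sbs) q)) ∂(expMeasure 1) =
        ∫⁻ h, G (sbsImage p (((q, h), b.1), b.2)) ∂(expMeasure 1) := fun b => rfl
    unfold sbsAverage
    simp only [r1]
    rw [Fintype.sum_prod_type]
    simp only [Fintype.sum_bool]
    have m1 := hm' (true, true)
    have m2 := hm' (true, false)
    have m3 := hm' (false, true)
    have m4 := hm' (false, false)
    simp only at m1 m2 m3 m4
    rw [lintegral_add_left (by fun_prop), lintegral_const_mul _ (by fun_prop),
      lintegral_const_mul _ (by fun_prop), lintegral_add_left (by fun_prop),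
      lintegral_add_left (by fun_prop), lintegral_const_mul _ (by fun_prop),
      lintegral_const_mul _ (by fun_prop), lintegral_const_mul _ (by fun_prop),
      lintegral_const_mul _ (by fun_prop)]
    have h1 := p.sbsBeamwidth_mem
    have h2 := p.userBeamwidth_mem
    have hπ := Real.pi_pos
    have h3 : 0 ≤ 2 * Real.pi - p.sbsBeamwidth := sub_nonneg.2 h1.2
    have h4 : 0 ≤ 2 * Real.pi - p.userBeamwidth := sub_nonneg.2 h2.2
    have hp : ∀ b : Bool × Bool, ENNReal.ofReal (p.interfGainProb b) =
        ENNReal.ofReal ((if b.1 then p.sbsBeamwidth else 2 * Real.pi - p.sbsBeamwidth) /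
          (2 * Real.pi)) * ENNReal.ofReal ((if b.2 then p.userBeamwidth else
            2 * Real.pi - p.userBeamwidth) / (2 * Real.pi)) := fun b => by
      rw [← ENNReal.ofReal_mul]
      · congr 1
        unfold Params.interfGainProb
        field_simp
        ring
      · refine div_nonneg ?_ (by positivity)
        split_ifs
        exacts [h1.1, h3]
    simp only [hp]
    simp
    ring

end Access


/-! ### Integrals against the exponential law -/

section ExpIntegrals

lemma lintegral_expMeasure (f : ℝ → ℝ≥0∞) :
    ∫⁻ h, f h ∂(expMeasure 1) =
      ∫⁻ h in Set.Ioi (0 : ℝ), ENNReal.ofReal (Real.exp (-h)) * f h := by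
  have hm : Measurable (gammaPDF 1 1) :=
    (measurable_gammaPDFReal 1 1).ennreal_ofReal
  have h1 : ∀ h, gammaPDF 1 1 h = (Set.Ici (0 : ℝ)).indicator
      (fun h => ENNReal.ofReal (Real.exp (-h))) h := fun h => by
    by_cases hh : 0 ≤ h
    · rw [gammaPDF_of_nonneg hh, Set.indicator_of_mem (Set.mem_Ici.2 hh)]
      simp
    · rw [gammaPDF_of_neg (not_le.1 hh), Set.indicator_of_notMem (by simpa using hh)]
  rw [expMeasure, gammaMeasure, lintegral_withDensity_eq_lintegral_mul_non_measurable _ hm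
    (ae_of_all _ fun h => by simp [gammaPDF])]
  have h2 : ∀ h, (gammaPDF 1 1 * f) h = (Set.Ici (0 : ℝ)).indicator
      (fun h => ENNReal.ofReal (Real.exp (-h)) * f h) h := fun h => by
    rw [Pi.mul_apply, h1]
    by_cases hh : h ∈ Set.Ici (0 : ℝ) <;> simp [hh]
  simp_rw [h2]
  rw [lintegral_indicator measurableSet_Ici, setLIntegral_congr Ioi_ae_eq_Ici]

/-- The Laplace transform of the exponential distribution. -/
lemma lintegral_expNeg_expMeasure {t : ℝ} (ht : 0 ≤ t) :
    ∫⁻ h, expNeg (ENNReal.ofReal (t * h)) ∂(expMeasure 1) = ENNReal.ofReal (1 / (1 + t)) := by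
  have h1 : (0 : ℝ) < 1 + t := by linarith
  have h := lintegral_deriv_mul_exp_neg (D := fun s => (1 + t) * s) (D' := fun _ => 1 + t)
    (by fun_prop) (by simp) (fun s _ => by simpa using (hasDerivAt_id s).const_mul (1 + t))
    (fun _ _ => h1.le) (tendsto_id.const_mul_atTop h1)
  simp_rw [ENNReal.ofReal_mul h1.le] at h
  rw [lintegral_const_mul _ (by fun_prop)] at h
  rw [lintegral_expMeasure, one_div, ENNReal.ofReal_inv_of_pos h1]
  refine ENNReal.eq_inv_of_mul_eq_one_left ?_
  rw [mul_comm, ← h]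
  congr 1
  refine setLIntegral_congr_fun measurableSet_Ioi fun s (hs : 0 < s) => ?_
  rw [expNeg_ofReal (by positivity), ← ENNReal.ofReal_mul (Real.exp_pos _).le, ← Real.exp_add]
  ring_nf

lemma lintegral_ofReal_expMeasure_ne_top : ∫⁻ h, ENNReal.ofReal h ∂(expMeasure 1) ≠ ∞ := by
  rw [lintegral_expMeasure]
  have h := Real.GammaIntegral_convergent (s := 2) two_pos
  have h2 := h.setLIntegral_lt_top
  refine (lt_of_le_of_lt (le_of_eq ?_) h2).ne
  refine setLIntegral_congr_fun measurableSet_Ioi fun s (hs : 0 < s) => ?_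
  rw [← ENNReal.ofReal_mul (Real.exp_pos _).le]
  norm_num

end ExpIntegrals

/-! ### Explicit exponents of the access process -/

section AccessFacts

variable {p : Params}

/-- The inverse biased power. -/
def accessLoss (y : Tier × ℝ × ℝ) : ℝ := y.2.1

/-- The interference weight. -/
noncomputable def accessWeight (y : Tier × ℝ × ℝ) : ℝ≥0∞ := ENNReal.ofReal y.2.2

@[fun_prop]
lemma measurable_accessLoss : Measurable accessLoss := by unfold accessLoss; fun_prop

@[fun_prop]
lemma measurable_accessWeight : Measurable accessWeight := by unfold accessWeight; fun_prop

lemma accessWeight_ne_top (y : Tier × ℝ × ℝ) : accessWeight y ≠ ∞ := ENNReal.ofReal_ne_top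

lemma sum_ofReal_interfGainProb : ∑ b : Bool × Bool, ENNReal.ofReal (p.interfGainProb b) = 1 := by
  rw [← ENNReal.ofReal_sum_of_nonneg fun b _ => interfGainProb_nonneg b, sum_interfGainProb,
    ENNReal.ofReal_one]

/-- The integrand ignores the interference weight, so fading and beam marks average out to 1. -/
lemma lintegral_access_loss {ψ : Tier → ℝ → ℝ≥0∞} (hψ : ∀ i, Measurable (ψ i)) :
    ∫⁻ y, ψ y.1 (accessLoss y) ∂(accessIntensity p) =
      (∫⁻ l in Set.Ioi (0 : ℝ), ENNReal.ofReal (pathlossDensity p (.access .mbs) l) *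
        ψ .mbs (l / biasConst p .mbs)) +
      ∫⁻ l in Set.Ioi (0 : ℝ), ENNReal.ofReal (pathlossDensity p (.access .sbs) l) *
        ψ .sbs (l / biasConst p .sbs) := by
  have i1 := isProbabilityMeasure_expMeasure one_pos
  have h1 : Measurable fun q : Tier × ℝ => ψ q.1 q.2 :=
    measurable_from_prod_countable_right fun i => hψ i
  have h2 : Measurable fun y : Tier × ℝ × ℝ => ψ y.1 (accessLoss y) :=
    h1.comp (measurable_fst.prodMk measurable_accessLoss)
  rw [lintegral_accessIntensity h2]
  congr 1
  refine lintegral_congr fun l => ?_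
  congr 1
  simp only [sbsAverage, accessLoss, lintegral_const, measure_univ, mul_one]
  rw [← Finset.sum_mul, sum_ofReal_interfGainProb, one_mul]

/-- The intensity of BSs with biased power above a level. -/
noncomputable def biasedIntensity (p : Params) (s : ℝ) : ℝ :=
  pathlossIntensity p (.access .mbs) (biasConst p .mbs * s) +
    pathlossIntensity p (.access .sbs) (biasConst p .sbs * s)

lemma biasedIntensity_nonneg {s : ℝ} (hs : 0 ≤ s) : 0 ≤ biasedIntensity p s :=
  add_nonneg (pathlossIntensity_nonneg p _ (mul_nonneg (biasConst_pos p _).le hs))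
    (pathlossIntensity_nonneg p _ (mul_nonneg (biasConst_pos p _).le hs))

lemma lintegral_pathlossDensity_indicator (k : Link) {κ s : ℝ} (hκ : 0 < κ) (hs : 0 ≤ s) :
    ∫⁻ l in Set.Ioi (0 : ℝ), ENNReal.ofReal (pathlossDensity p k l) *
      (Set.Iio s).indicator 1 (l / κ) = ENNReal.ofReal (pathlossIntensity p k (κ * s)) := by
  rw [← lintegral_Ioo_pathlossDensity p k (by positivity)]
  have h : ∀ l, ENNReal.ofReal (pathlossDensity p k l) * (Set.Iio s).indicator 1 (l / κ) =
      (Set.Iio (κ * s)).indicator (fun l => ENNReal.ofReal (pathlossDensity p k l)) l := fun l => by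
    have : l / κ ∈ Set.Iio s ↔ l ∈ Set.Iio (κ * s) := by
      rw [Set.mem_Iio, Set.mem_Iio, div_lt_iff₀ hκ, mul_comm]
    by_cases hl : l ∈ Set.Iio (κ * s)
    · simp [Set.indicator_of_mem hl, Set.indicator_of_mem (this.2 hl)]
    · rw [Set.indicator_of_notMem hl, Set.indicator_of_notMem (fun h => hl (this.1 h)), mul_zero]
  simp_rw [h]
  rw [lintegral_indicator measurableSet_Iio, Measure.restrict_restrict measurableSet_Iio,
    Set.inter_comm, Set.Ioi_inter_Iio]

lemma accessIntensity_lt {s : ℝ} (hs : 0 ≤ s) :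
    accessIntensity p {y | accessLoss y < s} = ENNReal.ofReal (biasedIntensity p s) := by
  have h1 : MeasurableSet {y : Tier × ℝ × ℝ | accessLoss y < s} :=
    measurableSet_lt measurable_accessLoss measurable_const
  have h2 := lintegral_access_loss (p := p) (ψ := fun _ => (Set.Iio s).indicator 1)
    fun _ => measurable_one.indicator measurableSet_Iio
  rw [lintegral_pathlossDensity_indicator _ (biasConst_pos p _) hs,
    lintegral_pathlossDensity_indicator _ (biasConst_pos p _) hs, ← ENNReal.ofReal_add
    (pathlossIntensity_nonneg p _ (mul_nonneg (biasConst_pos p _).le hs))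
    (pathlossIntensity_nonneg p _ (mul_nonneg (biasConst_pos p _).le hs))] at h2
  rw [← lintegral_indicator_one h1, biasedIntensity, ← h2]
  rfl

lemma accessIntensity_le_ne_top (s : ℝ) : accessIntensity p {y | accessLoss y ≤ s} ≠ ∞ := by
  have h := accessIntensity_lt (p := p) (s := |s| + 1) (by positivity)
  refine ne_top_of_le_ne_top (h.trans_ne ENNReal.ofReal_ne_top) (measure_mono fun y hy => ?_)
  have hy : accessLoss y ≤ s := hy
  have : accessLoss y < |s| + 1 := by linarith [le_abs_self s]
  exact this

lemma accessIntensity_nonpos : accessIntensity p {y | accessLoss y ≤ 0} = 0 := by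
  have h1 : MeasurableSet {y : Tier × ℝ × ℝ | accessLoss y ≤ 0} :=
    measurableSet_le measurable_accessLoss measurable_const
  have h2 := lintegral_access_loss (p := p) (ψ := fun _ => (Set.Iic 0).indicator 1)
    fun _ => measurable_one.indicator measurableSet_Iic
  have h3 : ∀ i, ∫⁻ l in Set.Ioi (0 : ℝ), ENNReal.ofReal (pathlossDensity p (.access i) l) *
      (Set.Iic 0).indicator 1 (l / biasConst p i) = 0 := fun i => by
    rw [setLIntegral_congr_fun (g := fun _ => 0) measurableSet_Ioi (fun l (hl : 0 < l) => by
      have : ¬ l / biasConst p i ∈ Set.Iic 0 := not_le.2 (div_pos hl (biasConst_pos p i))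
      dsimp only
      rw [Set.indicator_of_notMem this, mul_zero])]
    simp
  rw [h3, h3, add_zero] at h2
  rw [← lintegral_indicator_one h1]
  exact h2

/-- The nearest BS exists and is unique on average. -/
lemma lintegral_expNeg_accessIntensity :
    ∫⁻ y, expNeg (accessIntensity p {x | accessLoss x < accessLoss y}) ∂(accessIntensity p) = 1 := by
  -- This is the derivative of `biasedIntensity`. The substitutions l = `biasConst p i` * s bring
  -- both tiers to the common variable s, where the integral becomes ∫ e^{-D} D'.
  set D' : ℝ → ℝ := fun s => biasConst p .mbs * pathlossDensity p (.access .mbs) (biasConst p .mbs * s) +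
    biasConst p .sbs * pathlossDensity p (.access .sbs) (biasConst p .sbs * s) with hD'
  have hm := biasConst_pos p .mbs
  have hs := biasConst_pos p .sbs
  have hDc : Continuous (biasedIntensity p) := by unfold biasedIntensity; fun_prop
  have h := lintegral_deriv_mul_exp_neg (D := biasedIntensity p) (D' := D')
    hDc (by simp [biasedIntensity, pathlossIntensity_zero])
    (fun s hs' => by
      have h1 := (hasDerivAt_pathlossIntensity p (.access .mbs) (mul_pos hm hs')).comp s
        ((hasDerivAt_id s).const_mul (biasConst p .mbs))
      have h2 := (hasDerivAt_pathlossIntensity p (.access .sbs) (mul_pos hs hs')).comp s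
        ((hasDerivAt_id s).const_mul (biasConst p .sbs))
      refine (h1.add h2).congr_deriv ?_
      simp only [hD']; ring)
    (fun s hs' => add_nonneg
      (mul_nonneg hm.le (pathlossDensity_nonneg p _ (mul_pos hm hs').le))
      (mul_nonneg hs.le (pathlossDensity_nonneg p _ (mul_pos hs hs').le)))
    (tendsto_atTop_mono' _ (by
      filter_upwards [eventually_ge_atTop 0] with s hs'
      exact le_add_of_nonneg_right (pathlossIntensity_nonneg p _ (mul_nonneg hs.le hs')))
      ((tendsto_pathlossIntensity p (.access .mbs)).comp (tendsto_id.const_mul_atTop hm)))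
  rw [← h]
  have hψm : Measurable fun s => expNeg (ENNReal.ofReal (biasedIntensity p s)) :=
    hDc.measurable.ennreal_ofReal.expNeg
  have h1 : ∫⁻ y, expNeg (accessIntensity p {x | accessLoss x < accessLoss y}) ∂(accessIntensity p) =
      ∫⁻ y, expNeg (ENNReal.ofReal (biasedIntensity p (accessLoss y))) ∂(accessIntensity p) := by
    refine lintegral_congr_ae ?_
    have : ∀ᵐ y ∂(accessIntensity p), ¬ accessLoss y ≤ 0 := by
      rw [ae_iff]; simpa only [not_not] using accessIntensity_nonpos (p := p)
    filter_upwards [this] with y hy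
    rw [accessIntensity_lt (not_le.1 hy).le]
  rw [h1, lintegral_access_loss (ψ := fun _ s => expNeg (ENNReal.ofReal (biasedIntensity p s)))
    fun _ => hψm, lintegral_Ioi_comp_mul hm, lintegral_Ioi_comp_mul hs (fun l =>
      ENNReal.ofReal (pathlossDensity p (.access .sbs) l) *
        expNeg (ENNReal.ofReal (biasedIntensity p (l / biasConst p .sbs)))),
    ← lintegral_add_left (by fun_prop)]
  refine setLIntegral_congr_fun measurableSet_Ioi fun s (hs' : 0 < s) => ?_
  have e1 := pathlossDensity_nonneg p (.access .mbs) (mul_pos hm hs').le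
  have e2 := pathlossDensity_nonneg p (.access .sbs) (mul_pos hs hs').le
  rw [mul_div_cancel_left₀ _ hm.ne', mul_div_cancel_left₀ _ hs.ne', hD', ← mul_assoc, ← mul_assoc,
    ← add_mul, expNeg_ofReal (biasedIntensity_nonneg hs'.le), ← ENNReal.ofReal_mul hm.le,
    ← ENNReal.ofReal_mul hs.le, ← ENNReal.ofReal_add (by positivity) (by positivity),
    ← ENNReal.ofReal_mul (by positivity)]

/-- Interfering SBSs beyond the level `s` weighted by their probability of spoiling coverage. -/
noncomputable def interfIntegral (p : Params) (a s : ℝ) : ℝ :=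
  ∑ b : Bool × Bool, ∫ z in Set.Ioi s, (1 - 1 / (1 + a * p.interfGain b / z)) *
    p.interfGainProb b * pathlossDensity p (.access .sbs) z

lemma interfGain_nonneg (b : Bool × Bool) : 0 ≤ p.interfGain b := by
  have h1 := (p.gain_pos .sbs).le
  have h2 := p.userGain_pos.le
  have h3 := p.sbsSideGain_nonneg
  have h4 := p.userSideGain_nonneg
  unfold Params.interfGain
  refine mul_nonneg ?_ ?_ <;> split_ifs <;> assumption

lemma one_sub_one_div_nonneg {t : ℝ} (ht : 0 ≤ t) : 0 ≤ 1 - 1 / (1 + t) := by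
  rw [sub_nonneg, div_le_one (by linarith)]
  linarith

lemma interfIntegrand_nonneg {a z : ℝ} (ha : 0 ≤ a) (hz : 0 < z) (b : Bool × Bool) :
    0 ≤ (1 - 1 / (1 + a * p.interfGain b / z)) * p.interfGainProb b *
      pathlossDensity p (.access .sbs) z :=
  mul_nonneg (mul_nonneg (one_sub_one_div_nonneg
    (div_nonneg (mul_nonneg ha (interfGain_nonneg b)) hz.le)) (interfGainProb_nonneg b))
    (pathlossDensity_nonneg p _ hz.le)

lemma integrableOn_interfIntegrand {a s : ℝ} (ha : 0 ≤ a) (hs : 0 < s) (b : Bool × Bool) :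
    IntegrableOn (fun z => (1 - 1 / (1 + a * p.interfGain b / z)) * p.interfGainProb b *
      pathlossDensity p (.access .sbs) z) (Set.Ioi s) := by
  have h1 := (integrableOn_pathlossDensity_div p hs).const_mul
    (a * p.interfGain b * p.interfGainProb b)
  refine h1.mono' (by fun_prop) ?_
  filter_upwards [ae_restrict_mem measurableSet_Ioi] with z hz
  have hz0 : 0 < z := hs.trans hz
  rw [Real.norm_of_nonneg (interfIntegrand_nonneg ha hz0 b)]
  set t := a * p.interfGain b / z with ht
  have ht0 : 0 ≤ t := div_nonneg (mul_nonneg ha (interfGain_nonneg b)) hz0.le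
  have h2 : 1 - 1 / (1 + t) ≤ t := by
    have h3 : (0 : ℝ) < 1 + t := by linarith
    have e : 1 - 1 / (1 + t) = t / (1 + t) := by field_simp; ring
    rw [e]
    exact div_le_self ht0 (by linarith)
  calc (1 - 1 / (1 + t)) * p.interfGainProb b * pathlossDensity p (.access .sbs) z
      ≤ t * p.interfGainProb b * pathlossDensity p (.access .sbs) z := by
        have := pathlossDensity_nonneg p (.access .sbs) hz0.le
        have := interfGainProb_nonneg (p := p) b
        gcongr
    _ = _ := by rw [ht]; ring

lemma interfIntegral_nonneg {a s : ℝ} (ha : 0 ≤ a) (hs : 0 ≤ s) : 0 ≤ interfIntegral p a s :=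
  Finset.sum_nonneg fun b _ => setIntegral_nonneg measurableSet_Ioi fun _ hz =>
    interfIntegrand_nonneg ha (lt_of_le_of_lt hs hz) b

lemma sbsAverage_const_of_marks {G : Tier × ℝ × ℝ → ℝ≥0∞} {l : ℝ} {x : ℝ≥0∞}
    (h : ∀ w, G (.sbs, l / biasConst p .sbs, w) = x) : sbsAverage p G l = x := by
  have i1 := isProbabilityMeasure_expMeasure one_pos
  simp only [sbsAverage, h, lintegral_const, measure_univ, mul_one]
  rw [← Finset.sum_mul, sum_ofReal_interfGainProb, one_mul]

/-- BSs of loss below l contribute 1 each and give the biased intensity. Beyond l an MBS contributes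
nothing, and an SBS contributes 1 - 1/(1 + t), the Laplace transform of its exponential fading,
averaged over the gains. -/
lemma nearExponent_access {c l : ℝ} (hc : 0 ≤ c) (hl : 0 < l) :
    nearExponent (accessIntensity p) accessLoss accessWeight c l =
      ENNReal.ofReal (biasedIntensity p l + interfIntegral p
        (c * l * p.power .sbs * p.refLoss (.access .sbs)) (biasConst p .sbs * l)) := by
  have i1 := isProbabilityMeasure_expMeasure one_pos
  have hκ := biasConst_pos p .sbs
  have hP := p.power_pos .sbs
  have hβ := p.refLoss_pos (.access .sbs)
  set a := c * l * p.power .sbs * p.refLoss (.access .sbs) with ha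
  have ha0 : 0 ≤ a := by positivity
  have hGm : Measurable fun y => 1 - expNeg (nearCost accessLoss accessWeight c l y) := by fun_prop
  rw [nearExponent, lintegral_accessIntensity hGm]
  have h1 : ∀ z, 1 - expNeg (nearCost accessLoss accessWeight c l
      ((.mbs, z / biasConst p .mbs, 0) : Tier × ℝ × ℝ)) =
      (Set.Iio l).indicator 1 (z / biasConst p .mbs) := fun z => by
    by_cases hz : z / biasConst p .mbs < l
    · rw [Set.indicator_of_mem (Set.mem_Iio.2 hz)]
      simp [nearCost, accessLoss, hz]
    · rw [Set.indicator_of_notMem (by simpa using hz)]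
      simp [nearCost, accessLoss, accessWeight, hz]
  simp_rw [h1]
  rw [lintegral_pathlossDensity_indicator _ (biasConst_pos p _) hl.le]
  have hsplit : Set.Ioi (0 : ℝ) = Set.Ioo 0 (biasConst p .sbs * l) ∪ Set.Ici (biasConst p .sbs * l) :=
    (Set.Ioo_union_Ici_eq_Ioi (by positivity)).symm
  rw [hsplit, lintegral_union measurableSet_Ici
    (Set.disjoint_left.2 fun z h1 h2 => h1.2.not_ge h2)]
  have hA : ∫⁻ z in Set.Ioo 0 (biasConst p .sbs * l),
      ENNReal.ofReal (pathlossDensity p (.access .sbs) z) *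
        sbsAverage p (fun y => 1 - expNeg (nearCost accessLoss accessWeight c l y)) z =
      ENNReal.ofReal (pathlossIntensity p (.access .sbs) (biasConst p .sbs * l)) := by
    rw [← lintegral_Ioo_pathlossDensity p _ (by positivity)]
    refine setLIntegral_congr_fun measurableSet_Ioo fun z hz => ?_
    rw [sbsAverage_const_of_marks (x := 1), mul_one]
    intro w
    have : z / biasConst p .sbs < l := by rw [div_lt_iff₀ hκ, mul_comm]; exact hz.2
    simp [nearCost, accessLoss, this]
  have hB : ∫⁻ z in Set.Ici (biasConst p .sbs * l),
      ENNReal.ofReal (pathlossDensity p (.access .sbs) z) *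
        sbsAverage p (fun y => 1 - expNeg (nearCost accessLoss accessWeight c l y)) z =
      ENNReal.ofReal (interfIntegral p a (biasConst p .sbs * l)) := by
    have hs : 0 < biasConst p .sbs * l := by positivity
    rw [setLIntegral_congr Ioi_ae_eq_Ici.symm, interfIntegral, ENNReal.ofReal_sum_of_nonneg
      (fun b _ => setIntegral_nonneg measurableSet_Ioi fun z hz =>
        interfIntegrand_nonneg ha0 (hs.trans hz) b)]
    have e1 : ∀ b, ENNReal.ofReal (∫ z in Set.Ioi (biasConst p .sbs * l),
        (1 - 1 / (1 + a * p.interfGain b / z)) * p.interfGainProb b *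
          pathlossDensity p (.access .sbs) z) = ∫⁻ z in Set.Ioi (biasConst p .sbs * l),
        ENNReal.ofReal ((1 - 1 / (1 + a * p.interfGain b / z)) * p.interfGainProb b *
          pathlossDensity p (.access .sbs) z) := fun b => by
      rw [ofReal_integral_eq_lintegral_ofReal (integrableOn_interfIntegrand ha0 hs b)]
      filter_upwards [ae_restrict_mem measurableSet_Ioi] with z hz
      exact interfIntegrand_nonneg ha0 (hs.trans hz) b
    simp_rw [e1]
    rw [← lintegral_finsetSum _ (fun b _ => by fun_prop)]
    refine setLIntegral_congr_fun measurableSet_Ioi fun z hz => ?_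
    have hz0 : 0 < z := hs.trans hz
    rw [sbsAverage, Finset.mul_sum]
    refine Finset.sum_congr rfl fun b _ => ?_
    have hzl : ¬ z / biasConst p .sbs < l := by
      rw [div_lt_iff₀ hκ, mul_comm]; exact (le_of_lt hz).not_gt
    have ht0 : 0 ≤ a * p.interfGain b / z :=
      div_nonneg (mul_nonneg ha0 (interfGain_nonneg b)) hz0.le
    have e2 : ∀ h, expNeg (nearCost accessLoss accessWeight c l
        ((.sbs, z / biasConst p .sbs, interfPower p .sbs h b z) : Tier × ℝ × ℝ)) =
        expNeg (ENNReal.ofReal (a * p.interfGain b / z * h)) := fun h => by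
      simp only [nearCost, accessLoss, accessWeight, interfPower, hzl, if_false, zero_add]
      rw [← ENNReal.ofReal_mul (by positivity), ha]
      congr 2
      ring
    simp_rw [e2]
    rw [lintegral_sub (by fun_prop) ((lintegral_mono fun h => expNeg_le_one _).trans_lt
      (by simp)).ne (ae_of_all _ fun h => expNeg_le_one _), lintegral_expNeg_expMeasure ht0,
      lintegral_one, measure_univ, ← ENNReal.ofReal_one, ← ENNReal.ofReal_sub _ (by positivity),
      ← ENNReal.ofReal_mul (interfGainProb_nonneg b),
      ← ENNReal.ofReal_mul (pathlossDensity_nonneg p _ hz0.le)]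
    congr 1
    ring
  rw [hA, hB, ← add_assoc, ← ENNReal.ofReal_add
    (pathlossIntensity_nonneg p _ (mul_nonneg (biasConst_pos p _).le hl.le))
    (pathlossIntensity_nonneg p _ (mul_nonneg (biasConst_pos p _).le hl.le))]
  exact (ENNReal.ofReal_add (biasedIntensity_nonneg hl.le)
    (interfIntegral_nonneg ha0 (by positivity))).symm

/-- The fading has finite mean and the gains are bounded, so the weights decay like 1/z, which is
integrable against the density of SBS pathlosses away from 0. This makes the interference finite. -/
lemma lintegral_accessWeight_far_ne_top :
    ∫⁻ y in {y | accessLoss y ≤ 1}ᶜ, accessWeight y ∂(accessIntensity p) ≠ ∞ := by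
  have hS : MeasurableSet {y : Tier × ℝ × ℝ | accessLoss y ≤ 1} :=
    measurableSet_le measurable_accessLoss measurable_const
  have hκ := biasConst_pos p .sbs
  have hP := p.power_pos .sbs
  have hβ := p.refLoss_pos (.access .sbs)
  rw [← lintegral_indicator hS.compl, lintegral_accessIntensity
    (measurable_accessWeight.indicator hS.compl)]
  have h1 : ∀ z, ({y : Tier × ℝ × ℝ | accessLoss y ≤ 1}ᶜ.indicator accessWeight
      (.mbs, z / biasConst p .mbs, 0)) = 0 := fun z =>
    Set.indicator_apply_eq_zero.2 fun _ => by simp [accessWeight]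
  simp only [h1, mul_zero, lintegral_zero, zero_add]
  set M := ∫⁻ h, ENNReal.ofReal h ∂(expMeasure 1) with hM
  have hMt : M ≠ ∞ := lintegral_ofReal_expMeasure_ne_top
  set C : ℝ≥0∞ := ∑ b : Bool × Bool, ENNReal.ofReal (p.interfGainProb b) *
    (ENNReal.ofReal (p.power .sbs * p.refLoss (.access .sbs) * p.interfGain b) * M) with hC
  have hCt : C ≠ ∞ := ENNReal.sum_ne_top.2 fun b _ => by finiteness
  have hle : ∫⁻ z in Set.Ioi (0 : ℝ), ENNReal.ofReal (pathlossDensity p (.access .sbs) z) *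
      sbsAverage p ({y : Tier × ℝ × ℝ | accessLoss y ≤ 1}ᶜ.indicator accessWeight) z ≤
      ∫⁻ z in Set.Ioi (biasConst p .sbs), C *
        ENNReal.ofReal (pathlossDensity p (.access .sbs) z / z) := by
    rw [← lintegral_indicator measurableSet_Ioi, ← lintegral_indicator measurableSet_Ioi]
    refine lintegral_mono fun z => ?_
    by_cases hz : z ∈ Set.Ioi (biasConst p .sbs)
    · have hz0 : 0 < z := hκ.trans hz
      rw [Set.indicator_of_mem (Set.mem_Ioi.2 hz0), Set.indicator_of_mem hz]
      have h2 : sbsAverage p ({y : Tier × ℝ × ℝ | accessLoss y ≤ 1}ᶜ.indicator accessWeight) z ≤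
          C * ENNReal.ofReal z⁻¹ := by
        rw [sbsAverage, hC, Finset.sum_mul]
        refine Finset.sum_le_sum fun b _ => ?_
        rw [mul_assoc]
        gcongr
        refine (lintegral_mono fun h => Set.indicator_le_self _ _ _).trans (le_of_eq ?_)
        rw [hM, ← lintegral_const_mul _ (by fun_prop), ← lintegral_mul_const _ (by fun_prop)]
        refine lintegral_congr fun h => ?_
        rw [← ENNReal.ofReal_mul (mul_nonneg (by positivity) (interfGain_nonneg b)),
          ← ENNReal.ofReal_mul' (by positivity), accessWeight, interfPower]
        congr 1
        ring
      refine (mul_le_mul_right h2 _).trans (le_of_eq ?_)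
      rw [mul_left_comm, ← ENNReal.ofReal_mul (pathlossDensity_nonneg p _ hz0.le), div_eq_mul_inv]
    · rw [Set.indicator_of_notMem hz]
      by_cases hz0 : z ∈ Set.Ioi (0 : ℝ)
      · rw [Set.indicator_of_mem hz0, sbsAverage_const_of_marks (x := 0), mul_zero]
        intro w
        refine Set.indicator_of_notMem (Set.notMem_compl_iff.2 ?_) _
        show z / biasConst p .sbs ≤ 1
        rw [div_le_one hκ]
        exact not_lt.1 hz
      · rw [Set.indicator_of_notMem hz0]
  refine ne_top_of_le_ne_top ?_ hle
  rw [lintegral_const_mul _ (by fun_prop)]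
  refine ENNReal.mul_ne_top hCt ?_
  exact (integrableOn_pathlossDensity_div p hκ).setLIntegral_lt_top.ne

end AccessFacts


/-! ### The coverage event of the nearest point -/

section CoverSet

variable {Ω ι E : Type*} [MeasurableSpace E] [Countable ι] {Y : ι → Ω → E} {m : Measure E}
  {ℓ : E → ℝ} {w : E → ℝ≥0∞} {c : ℝ} {N : ℝ≥0∞} {B : Set E} {h : ι → Ω → ℝ}

/-- The nearest point lies in `B` and is covered. -/
def coverSet (Y : ι → Ω → E) (ℓ : E → ℝ) (w : E → ℝ≥0∞) (c : ℝ) (N : ℝ≥0∞)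
    (B : Set E) (h : ι → Ω → ℝ) : Set Ω :=
  ⋃ n, {ω | fadingThreshold Y ℓ w c N B n ω < ENNReal.ofReal (h n ω)}

lemma measurableSet_coverSet {𝓕 : MeasurableSpace Ω} (hℓ : Measurable ℓ) (hw : Measurable w)
    (hB : MeasurableSet B) (hY : ∀ n, Measurable[𝓕] (Y n)) (hh : ∀ n, Measurable[𝓕] (h n)) :
    MeasurableSet[𝓕] (coverSet Y ℓ w c N B h) :=
  MeasurableSet.iUnion fun n => measurableSet_lt
    (measurable_fadingThreshold_of hℓ hw (fun k _ => hY k) (hℓ.comp (hY n)) (hY n hB))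
    (hh n).ennreal_ofReal

open Classical in
lemma mem_coverSet_iff [MeasurableSpace Ω] {ω : Ω} {n : ι} (hn : IsNearest Y ℓ n ω)
    (huniq : ∀ k, IsNearest Y ℓ k ω → k = n) :
    ω ∈ coverSet Y ℓ w c N B h ↔ Y n ω ∈ B ∧ ENNReal.ofReal (c * ℓ (Y n ω)) *
      ((∑' k, if k = n then 0 else w (Y k ω)) + N) < ENNReal.ofReal (h n ω) := by
  simp only [coverSet, Set.mem_iUnion, Set.mem_ofPred_eq, fadingThreshold_lt_iff]
  constructor
  · rintro ⟨k, hk, h1⟩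
    obtain rfl := huniq k hk
    exact h1
  · exact fun h1 => ⟨n, hn, h1⟩

/-- Uniqueness of the nearest point makes the events of different candidates almost surely disjoint.
-/
lemma measure_coverSet {mΩ : MeasurableSpace Ω} {P : Measure Ω}
    (hℓ : Measurable ℓ) (hw : Measurable w) (hB : MeasurableSet B) (hY : ∀ n, Measurable (Y n))
    (hh : ∀ n, Measurable (h n)) (huniq : ∀ᵐ ω ∂P, ∃! n, IsNearest Y ℓ n ω) :
    P (coverSet Y ℓ w c N B h) =
      ∑' n, P {ω | fadingThreshold Y ℓ w c N B n ω < ENNReal.ofReal (h n ω)} := by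
  refine measure_iUnion₀ (fun n k hnk => ?_) fun n => ?_
  · refine measure_mono_null (fun ω hω => ?_) huniq
    rintro ⟨q, -, hq⟩
    exact hnk ((hq n (fadingThreshold_lt_iff.1 hω.1).1).trans
      (hq k (fadingThreshold_lt_iff.1 hω.2).1).symm)
  · exact (measurableSet_lt (measurable_fadingThreshold_of hℓ hw (fun k _ => hY k)
      (hℓ.comp (hY n)) (hY n hB)) (hh n).ennreal_ofReal).nullMeasurableSet

end CoverSet

/-! ### Association probabilities and access coverage -/

section AccessCoverage

variable {Ω : Type*} [mΩ : MeasurableSpace Ω] {P : Measure Ω} [IsProbabilityMeasure P]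
  {p : Params} {X : ∀ s : Source, Ω → s.Val}

lemma biasedPower_eq (q : Tier × ℕ) (ω : Ω) :
    biasedPower p X q ω = (accessLoss (accessPoint p X q ω))⁻¹ := by
  simp [biasedPower, accessLoss, accessPoint, biasConst, div_eq_mul_inv]

/-- The regular configurations of the access links. -/
structure AccessRegular (p : Params) (X : ∀ s : Source, Ω → s.Val) (ω : Ω) : Prop where
  nearest : ∃! q, IsNearest (accessPoint p X) accessLoss q ω
  loss_pos : ∀ q, 0 < accessLoss (accessPoint p X q ω)
  fading_pos : ∀ i n, 0 < fadingVar X (.access i) n ω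
  weight : ∑' q, accessWeight (accessPoint p X q ω) ≠ ∞

lemma measurable_fadingVar (hX : IsNetwork p X P) (k : Link) (n : ℕ) :
    Measurable (fadingVar X k n) :=
  hX.measurable (.fading k n)

lemma measurable_accessPoint (hX : IsNetwork p X P) (q : Tier × ℕ) :
    Measurable (accessPoint p X q) :=
  (isPPP_access hX).measurable q

lemma ae_accessRegular (hX : IsNetwork p X P) : ∀ᵐ ω ∂P, AccessRegular p X ω := by
  have hY := isPPP_access hX
  have h1 := hY.ae_existsUnique_isNearest measurable_accessLoss accessIntensity_le_ne_top
    lintegral_expNeg_accessIntensity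
  have h2 := hY.ae_forall_notMem (measurableSet_le measurable_accessLoss measurable_const)
    (accessIntensity_nonpos (p := p))
  have h3 : ∀ᵐ ω ∂P, ∀ i n, 0 < fadingVar X (.access i) n ω :=
    ae_all_iff.2 fun i => ae_all_iff.2 fun n =>
      ae_nonneg_of_map_eq_expMeasure (measurable_fadingVar hX (.access i) n) (hX.fading_law _ n)
  have h4 := hY.ae_tsum_ne_top measurable_accessWeight accessWeight_ne_top
    (measurableSet_le measurable_accessLoss measurable_const) (accessIntensity_le_ne_top 1)
    lintegral_accessWeight_far_ne_top
  filter_upwards [h1, h2, h3, h4] with ω h1 h2 h3 h4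
  exact ⟨h1, fun q => not_le.1 (h2 q), h3, h4⟩

lemma AccessRegular.isNearest_iff {ω : Ω} (h : AccessRegular p X ω) (q : Tier × ℕ) :
    IsNearest (accessPoint p X) accessLoss q ω ↔
      ∀ q', biasedPower p X q' ω ≤ biasedPower p X q ω := by
  simp only [biasedPower_eq, IsNearest]
  exact forall_congr' fun q' => (inv_le_inv₀ (h.loss_pos q') (h.loss_pos q)).symm

/-- All losses being positive, least loss means greatest biased power; a maximiser exists, so the
choice made in `taggedBS` is one. -/
lemma AccessRegular.isNearest_taggedBS {ω : Ω} (h : AccessRegular p X ω) :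
    IsNearest (accessPoint p X) accessLoss (taggedBS p X ω) ω := by
  obtain ⟨q, hq, -⟩ := h.nearest
  rw [h.isNearest_iff]
  exact Classical.epsilon_spec (p := fun q => ∀ q', biasedPower p X q' ω ≤ biasedPower p X q ω)
    ⟨q, (h.isNearest_iff q).1 hq⟩

open Classical in
lemma interference_eq (ω : Ω) : interference p X ω =
    ∑' q, if q = taggedBS p X ω then 0 else accessWeight (accessPoint p X q ω) := by
  rw [ENNReal.tsum_prod', tsum_fintype]
  have h : (Finset.univ : Finset Tier) = {.mbs, .sbs} := rfl
  rw [h, Finset.sum_pair (by simp)]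
  have h1 : ∀ n, (if ((.mbs, n) : Tier × ℕ) = taggedBS p X ω then 0 else
      accessWeight (accessPoint p X (.mbs, n) ω)) = 0 := fun n => by
    simp [accessWeight, accessPoint, interfPower]
  simp only [h1, tsum_zero, zero_add]
  unfold interference
  refine tsum_congr fun n => ?_
  by_cases hn : taggedBS p X ω = (.sbs, n)
  · simp [hn]
  · simp only [hn, Ne.symm hn, if_false]
    rfl

open Classical in
-- The SINR inequality solved for the fading. The loss is inverse to the biased power while the
-- signal is unbiased, which is why the bias multiplies τ.
lemma AccessRegular.sinrAccess_lt_iff {ω : Ω} (h : AccessRegular p X ω) {τ : ℝ} (hτ : 0 ≤ τ) :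
    τ < sinrAccess p X ω ↔
      ENNReal.ofReal (τ * p.bias (taggedBS p X ω).1 *
        accessLoss (accessPoint p X (taggedBS p X ω) ω)) *
        ((∑' q, if q = taggedBS p X ω then 0 else accessWeight (accessPoint p X q ω)) +
          ENNReal.ofReal p.noise) <
      ENNReal.ofReal (fadingVar X (.access (taggedBS p X ω).1) (taggedBS p X ω).2 ω) := by
  set q := taggedBS p X ω with hq
  have hN : 0 < p.noise := mul_pos p.noisePSD_pos p.bandwidth_pos
  have hI : interference p X ω ≠ ∞ := by
    rw [interference_eq]
    refine ne_top_of_le_ne_top h.weight (ENNReal.tsum_le_tsum fun k => ?_)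
    split_ifs <;> simp
  rw [hq, ← interference_eq, ← hq]
  set D := interference p X ω + ENNReal.ofReal p.noise with hD
  have hD0 : D ≠ 0 := by simp [hD, hN]
  have hDt : D ≠ ∞ := by simp [hD, hI]
  have hl := h.loss_pos q
  have hT := p.bias_pos q.1
  have hL : 0 < pathloss p X (.access q.1) q.2 ω := by
    have := mul_pos hl (biasConst_pos p q.1)
    rwa [accessLoss, accessPoint, div_mul_cancel₀ _ (biasConst_pos p q.1).ne'] at this
  have e : fadingVar X (.access q.1) q.2 ω = p.bias q.1 * accessLoss (accessPoint p X q ω) *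
      (p.power q.1 * p.gain q.1 * p.userGain * p.refLoss (.access q.1) *
      fadingVar X (.access q.1) q.2 ω * (pathloss p X (.access q.1) q.2 ω)⁻¹) := by
    have h1 := p.power_pos q.1
    have h3 := p.refLoss_pos (.access q.1)
    have h4 := p.gain_pos q.1
    have h5 := p.userGain_pos
    simp only [accessLoss, accessPoint, biasConst]
    field_simp
  have hTl : 0 < p.bias q.1 * accessLoss (accessPoint p X q ω) := mul_pos hT hl
  have e2 : ENNReal.ofReal (τ * p.bias q.1 * accessLoss (accessPoint p X q ω)) * D =
      ENNReal.ofReal (p.bias q.1 * accessLoss (accessPoint p X q ω)) * (ENNReal.ofReal τ * D) := by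
    rw [mul_assoc, ENNReal.ofReal_mul hτ]; ring
  rw [e, e2, ENNReal.ofReal_mul hTl.le, ENNReal.mul_lt_mul_iff_right (by simpa using hTl)
    ENNReal.ofReal_ne_top, ← ENNReal.lt_div_iff_mul_lt (Or.inl hD0) (Or.inl hDt),
    ENNReal.ofReal_lt_iff_lt_toReal hτ (ENNReal.div_ne_top ENNReal.ofReal_ne_top hD0)]
  rfl

/-- The tagged BS is of tier `i` and the access link is covered at threshold `τ`. -/
def accessCover (p : Params) (X : ∀ s : Source, Ω → s.Val) (i : Tier) (τ : ℝ) : Set Ω :=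
  coverSet (accessPoint p X) accessLoss accessWeight (τ * p.bias i) (ENNReal.ofReal p.noise)
    {y | y.1 = i} fun q => fadingVar X (.access q.1) q.2

lemma accessCover_ae_eq (hX : IsNetwork p X P) (i : Tier) {τ : ℝ} (hτ : 0 ≤ τ) :
    accessCover p X i τ =ᵐ[P] {ω | (taggedBS p X ω).1 = i ∧ τ < sinrAccess p X ω} := by
  filter_upwards [ae_accessRegular hX] with ω h
  refine propext ?_
  change ω ∈ accessCover p X i τ ↔ (taggedBS p X ω).1 = i ∧ τ < sinrAccess p X ω
  have hn := h.isNearest_taggedBS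
  rw [accessCover, mem_coverSet_iff hn fun k hk => h.nearest.unique hk hn, h.sinrAccess_lt_iff hτ]
  refine and_congr_right fun hi => ?_
  have hi : (taggedBS p X ω).1 = i := hi
  rw [hi]
  convert Iff.rfl

lemma sinrAccess_pos {ω : Ω} (h : AccessRegular p X ω) : 0 < sinrAccess p X ω := by
  rw [h.sinrAccess_lt_iff le_rfl]
  simpa using h.fading_pos _ _

/-- The SINR is almost surely positive, so association is coverage at threshold 0 and needs no
separate computation. -/
lemma accessCover_zero_ae_eq (hX : IsNetwork p X P) (i : Tier) :
    accessCover p X i 0 =ᵐ[P] assocEvent p X i := by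
  refine (accessCover_ae_eq hX i le_rfl).trans ?_
  filter_upwards [ae_accessRegular hX] with ω h
  exact propext (and_iff_left (sinrAccess_pos h))

lemma measurableSet_accessCover (i : Tier) (τ : ℝ) :
    MeasurableSet[sourceAlgebra X accessSources] (accessCover p X i τ) := by
  have hf : ∀ j n, Measurable[sourceAlgebra X accessSources] (fadingVar X (.access j) n) :=
    fun j n => measurable_source (s := .fading (.access j) n)
      (Or.inr (Or.inr (Or.inl ⟨j, n, rfl⟩)))
  refine measurableSet_coverSet measurable_accessLoss measurable_accessWeight
    (measurable_fst (MeasurableSet.of_discrete (s := {i}))) (fun q => ?_) fun q => hf _ _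
  exact measurable_accessPoint_of q (measurable_source (Or.inl ⟨_, rfl⟩))
    (measurable_source (Or.inr (Or.inl ⟨_, _, rfl⟩))) (fun _ => hf _ _)
    fun _ => (measurable_source (s := .sbsBeam q.2)
      (Or.inr (Or.inr (Or.inr (Or.inl ⟨_, rfl⟩))))).prodMk
      (measurable_source (s := .userBeam q.2) (Or.inr (Or.inr (Or.inr (Or.inr ⟨_, rfl⟩)))))

/-- The coverage integrand. -/
noncomputable def coverWeight (p : Params) (c s : ℝ) : ℝ≥0∞ :=
  expNeg (ENNReal.ofReal (c * s) * ENNReal.ofReal p.noise) *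
    expNeg (nearExponent (accessIntensity p) accessLoss accessWeight c s)

lemma measurable_coverWeight (c : ℝ) : Measurable (coverWeight p c) := by
  have := measurable_nearExponent (m := accessIntensity p) (c := c) measurable_accessLoss
    measurable_accessWeight
  unfold coverWeight
  fun_prop

lemma coverWeight_eq {c s : ℝ} (hc : 0 ≤ c) (hs : 0 < s) :
    coverWeight p c s = ENNReal.ofReal (Real.exp (-interfIntegral p
      (c * s * p.power .sbs * p.refLoss (.access .sbs)) (biasConst p .sbs * s) -
        c * s * p.noise - biasedIntensity p s)) := by
  have hN : 0 < p.noise := mul_pos p.noisePSD_pos p.bandwidth_pos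
  have hκ := biasConst_pos p .sbs
  have hP := p.power_pos .sbs
  have hβ := p.refLoss_pos (.access .sbs)
  rw [coverWeight, nearExponent_access hc hs, ← ENNReal.ofReal_mul (by positivity),
    expNeg_ofReal (by positivity), expNeg_ofReal (add_nonneg (biasedIntensity_nonneg hs.le)
    (interfIntegral_nonneg (by positivity) (by positivity))),
    ← ENNReal.ofReal_mul (Real.exp_pos _).le, ← Real.exp_add]
  congr 2
  ring

/-- All sources but the fading of one link. -/
abbrev otherSources (k : Link) (n : ℕ) : Set Source := {s | s ≠ .fading k n}

lemma measurable_pathloss_other (k k' : Link) (n n' : ℕ) :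
    Measurable[sourceAlgebra X (otherSources k n)] (pathloss p X k' n') :=
  measurable_pathloss k' n' (measurable_source (s := .points k') (fun h => nomatch h))
    (measurable_source (s := .blocking k' n') (fun h => nomatch h))

/-- The only fading in an access point is its own, so the points other than q do not see the fading
of link q. -/
lemma measurable_accessPoint_other {q r : Tier × ℕ} (hr : r ≠ q) :
    Measurable[sourceAlgebra X (otherSources (.access q.1) q.2)] (accessPoint p X r) := by
  refine measurable_accessPoint_of r (measurable_source (s := .points _) (fun h => nomatch h))
    (measurable_source (s := .blocking _ _) (fun h => nomatch h)) (fun hi => ?_) fun _ => ?_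
  · refine measurable_source (s := .fading (.access .sbs) r.2) fun h => ?_
    injection h with h h'
    injection h with h
    exact hr (Prod.ext (hi.trans h) h')
  · exact (measurable_source (s := .sbsBeam r.2) (fun h => nomatch h)).prodMk
      (measurable_source (s := .userBeam r.2) (fun h => nomatch h))

lemma indep_fading_other (hX : IsNetwork p X P) (k : Link) (n : ℕ) :
    Indep (MeasurableSpace.comap (fadingVar X k n) inferInstance)
      (sourceAlgebra X (otherSources k n)) P := by
  refine indep_of_indep_of_le_left (indep_sourceAlgebra hX (S := {.fading k n}) ?_)
    (measurable_iff_comap_le.1 (measurable_source (X := X) (s := .fading k n) rfl))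
  exact Set.disjoint_singleton_left.2 fun h => h rfl

lemma tsum_measure_access (hX : IsNetwork p X P) (i : Tier) {c : ℝ} (hc : 0 ≤ c) :
    ∑' q, P {ω | fadingThreshold (accessPoint p X) accessLoss accessWeight c
        (ENNReal.ofReal p.noise) {y | y.1 = i} q ω <
          ENNReal.ofReal (fadingVar X (.access q.1) q.2 ω)} =
      ∫⁻ y in {y | y.1 = i}, coverWeight p c (accessLoss y) ∂(accessIntensity p) := by
  have hB : MeasurableSet {y : Tier × ℝ × ℝ | y.1 = i} :=
    measurable_fst (MeasurableSet.of_discrete (s := {i}))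
  exact (isPPP_access hX).tsum_measure_fadingThreshold_lt (h := fun q => fadingVar X (.access q.1) q.2)
    measurable_accessLoss measurable_accessWeight accessWeight_ne_top hc accessIntensity_le_ne_top hB
    (ENNReal.ofReal p.noise) (fun q => measurable_fadingVar hX (.access q.1) q.2)
    (fun q => hX.fading_law _ _) (fun q => sourceAlgebra X (otherSources (.access q.1) q.2))
    (fun q => sourceAlgebra_le hX _) (fun q => indep_fading_other hX _ _)
    (fun q r hr => measurable_accessPoint_other hr)
    (fun q => (measurable_pathloss_other _ _ _ _).div_const _)
    -- The tier of a point is fixed by its index, so membership in the tier is not random.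
    (fun q => MeasurableSet.const (q.1 = i))

lemma measure_accessCover_lintegral (hX : IsNetwork p X P) (i : Tier) {τ : ℝ} (hτ : 0 ≤ τ) :
    P (accessCover p X i τ) = ∫⁻ l in Set.Ioi (0 : ℝ),
      ENNReal.ofReal (pathlossDensity p (.access i) l) *
        coverWeight p (τ * p.bias i) (l / biasConst p i) := by
  have hB : MeasurableSet {y : Tier × ℝ × ℝ | y.1 = i} :=
    measurable_fst (MeasurableSet.of_discrete (s := {i}))
  have huniq : ∀ᵐ ω ∂P, ∃! q, IsNearest (accessPoint p X) accessLoss q ω := by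
    filter_upwards [ae_accessRegular hX] with ω h using h.nearest
  rw [accessCover, measure_coverSet (h := fun q => fadingVar X (.access q.1) q.2)
    measurable_accessLoss measurable_accessWeight hB
    (measurable_accessPoint hX) (fun q => measurable_fadingVar hX (.access q.1) q.2) huniq,
    tsum_measure_access hX i (mul_nonneg hτ (p.bias_pos i).le), ← lintegral_indicator hB]
  have h1 := lintegral_access_loss (p := p)
    (ψ := fun j s => if j = i then coverWeight p (τ * p.bias i) s else 0)
    (fun j => by
      have := measurable_coverWeight (p := p) (τ * p.bias i)
      split_ifs <;> fun_prop)
  have h2 : ∀ y : Tier × ℝ × ℝ, {y : Tier × ℝ × ℝ | y.1 = i}.indicator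
      (fun y => coverWeight p (τ * p.bias i) (accessLoss y)) y =
      if y.1 = i then coverWeight p (τ * p.bias i) (accessLoss y) else 0 := fun y => by
    by_cases hy : y.1 = i <;> simp [hy]
  rw [lintegral_congr h2, h1]
  cases i <;> simp

/-- The coverage integral of tier `i`. -/
noncomputable def coverIntegral (p : Params) (i : Tier) (τ : ℝ) : ℝ :=
  ∫ l in Set.Ioi (0 : ℝ), Real.exp (-interfIntegral p
    (τ * p.bias i * (l / biasConst p i) * p.power .sbs * p.refLoss (.access .sbs))
      (biasConst p .sbs * (l / biasConst p i)) - τ * p.bias i * (l / biasConst p i) * p.noise -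
        biasedIntensity p (l / biasConst p i)) * pathlossDensity p (.access i) l

lemma toReal_coverIntegrand (i : Tier) {τ l : ℝ} (hτ : 0 ≤ τ) (hl : 0 < l) :
    (ENNReal.ofReal (pathlossDensity p (.access i) l) *
        coverWeight p (τ * p.bias i) (l / biasConst p i)).toReal =
    Real.exp (-interfIntegral p
    (τ * p.bias i * (l / biasConst p i) * p.power .sbs * p.refLoss (.access .sbs))
      (biasConst p .sbs * (l / biasConst p i)) - τ * p.bias i * (l / biasConst p i) * p.noise -
        biasedIntensity p (l / biasConst p i)) * pathlossDensity p (.access i) l := by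
  rw [coverWeight_eq (mul_nonneg hτ (p.bias_pos i).le) (div_pos hl (biasConst_pos p i)),
    ENNReal.toReal_mul, ENNReal.toReal_ofReal (pathlossDensity_nonneg p _ hl.le),
    ENNReal.toReal_ofReal (Real.exp_pos _).le, mul_comm]

lemma measureReal_accessCover (hX : IsNetwork p X P) (i : Tier) {τ : ℝ} (hτ : 0 ≤ τ) :
    P.real (accessCover p X i τ) = coverIntegral p i τ := by
  have hm : Measurable fun l => ENNReal.ofReal (pathlossDensity p (.access i) l) *
      coverWeight p (τ * p.bias i) (l / biasConst p i) := by
    have := measurable_coverWeight (p := p) (τ * p.bias i)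
    have := measurable_pathlossDensity p (.access i)
    fun_prop
  have h := measure_accessCover_lintegral hX i hτ
  rw [measureReal_def, h, ← integral_toReal hm.aemeasurable
    (ae_lt_top hm (h ▸ measure_ne_top P _)), coverIntegral]
  exact setIntegral_congr_fun measurableSet_Ioi fun l hl => toReal_coverIntegrand i hτ hl

/-- The integrand is strictly positive on the half-line. At τ = 0 this gives positive association
probabilities, so the conditioning is meaningful. -/
lemma coverIntegral_pos (hX : IsNetwork p X P) (i : Tier) {τ : ℝ} (hτ : 0 ≤ τ) :
    0 < coverIntegral p i τ := by
  have hm : Measurable fun l => ENNReal.ofReal (pathlossDensity p (.access i) l) *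
      coverWeight p (τ * p.bias i) (l / biasConst p i) := by
    have := measurable_coverWeight (p := p) (τ * p.bias i)
    have := measurable_pathlossDensity p (.access i)
    fun_prop
  have h := measure_accessCover_lintegral hX i hτ
  rw [← measureReal_accessCover hX i hτ, measureReal_def, h]
  refine ENNReal.toReal_pos ?_ (h ▸ measure_ne_top P _)
  rw [← pos_iff_ne_zero, lintegral_pos_iff_support hm, Measure.restrict_apply' measurableSet_Ioi]
  refine lt_of_lt_of_le ?_ (measure_mono (s := Set.Ioi (0 : ℝ)) fun l hl => ⟨?_, hl⟩)
  · simp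
  · have hl : 0 < l := hl
    rw [Function.mem_support, coverWeight_eq (mul_nonneg hτ (p.bias_pos i).le)
      (div_pos hl (biasConst_pos p i))]
    have := pathlossDensity_pos p (.access i) hl
    simp [this, Real.exp_pos]

/-- A tier-i link of pathloss l ties in biased power with a tier-j link of pathloss Ω_{j,i} l; the
UE gain cancels. -/
lemma biasConst_mul_div (i j : Tier) (l : ℝ) :
    biasConst p j * (l / biasConst p i) = p.biasRatio j i * l := by
  have h1 := (p.power_pos i).ne'
  have h2 := (p.bias_pos i).ne'
  have h3 := (p.refLoss_pos (.access i)).ne'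
  have h4 := (p.gain_pos i).ne'
  have h5 := p.userGain_pos.ne'
  unfold biasConst Params.biasRatio
  field_simp

lemma biasedIntensity_div (i : Tier) (l : ℝ) : biasedIntensity p (l / biasConst p i) =
    pathlossIntensity p (.access .mbs) (p.biasRatio .mbs i * l) +
      pathlossIntensity p (.access .sbs) (p.biasRatio .sbs i * l) := by
  rw [biasedIntensity, biasConst_mul_div, biasConst_mul_div]

lemma coverIntegral_zero (i : Tier) : coverIntegral p i 0 = assocFormula p i := by
  simp [coverIntegral, interfIntegral, biasedIntensity_div, assocFormula]

lemma coverIntegral_eq (h0 : assocFormula p i ≠ 0) (τ : ℝ) :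
    coverIntegral p i τ = assocFormula p i * accessCoverage p i τ := by
  rw [accessCoverage, ← mul_assoc, mul_one_div_cancel h0, one_mul, coverIntegral]
  have h1 := (p.power_pos i).ne'
  have h2 := (p.bias_pos i).ne'
  have h3 := (p.refLoss_pos (.access i)).ne'
  have h4 := (p.gain_pos i).ne'
  have h5 := p.userGain_pos.ne'
  refine integral_congr_ae (ae_of_all _ fun l => ?_)
  simp only [biasedIntensity_div, biasConst_mul_div, interfIntegral]
  have e1 : τ * p.bias i * (l / biasConst p i) * p.noise =
      τ * p.noise * l / (p.power i * p.refLoss (.access i) * p.gain i * p.userGain) := by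
    unfold biasConst
    field_simp
  have e2 : ∀ b z, τ * p.bias i * (l / biasConst p i) * p.power .sbs * p.refLoss (.access .sbs) *
      p.interfGain b / z = τ * p.power .sbs * p.refLoss (.access .sbs) * p.interfGain b * l /
            (p.power i * p.refLoss (.access i) * p.gain i * p.userGain * z) := fun b z => by
    rw [← div_div]
    congr 1
    unfold biasConst
    field_simp
  simp only [e1, e2]

lemma assocFormula_pos (hX : IsNetwork p X P) (i : Tier) : 0 < assocFormula p i := by
  rw [← coverIntegral_zero]
  exact coverIntegral_pos hX i le_rfl

lemma assocProb_eq (hX : IsNetwork p X P) (i : Tier) : assocProb p X P i = assocFormula p i := by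
  rw [assocProb, ← measureReal_congr (accessCover_zero_ae_eq hX i),
    measureReal_accessCover hX i le_rfl, coverIntegral_zero]

lemma measureReal_accessCover_eq (hX : IsNetwork p X P) (i : Tier) {τ : ℝ} (hτ : 0 ≤ τ) :
    P.real (accessCover p X i τ) = assocFormula p i * accessCoverage p i τ := by
  rw [measureReal_accessCover hX i hτ, coverIntegral_eq (assocFormula_pos hX i).ne']

/-- The tagged BS is an arbitrary choice off the regular configurations, so the event is only seen
to agree almost everywhere with a measurable one. -/
lemma nullMeasurableSet_assocEvent (hX : IsNetwork p X P) (i : Tier) :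
    NullMeasurableSet (assocEvent p X i) P :=
  ((sourceAlgebra_le hX _ _ (measurableSet_accessCover i 0)).nullMeasurableSet).congr
    (accessCover_zero_ae_eq hX i)

lemma assocFormula_add (hX : IsNetwork p X P) :
    assocFormula p .mbs + assocFormula p .sbs = 1 := by
  rw [← assocProb_eq hX, ← assocProb_eq hX, assocProb, assocProb]
  have h : assocEvent p X .sbs = (assocEvent p X .mbs)ᶜ := by
    ext ω
    simp only [assocEvent, Set.mem_ofPred_eq, Set.mem_compl_iff]
    cases (taggedBS p X ω).1 <;> simp
  rw [h, measureReal_compl₀ (nullMeasurableSet_assocEvent hX _)]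
  simp

lemma cond_assocEvent_real (hX : IsNetwork p X P) (i : Tier) (s : Set Ω) :
    (P[|assocEvent p X i]).real s =
      (assocFormula p i)⁻¹ * P.real {ω | (taggedBS p X ω).1 = i ∧ ω ∈ s} := by
  rw [ProbabilityTheory.cond, measureReal_ennreal_smul_apply, ENNReal.toReal_inv, ← measureReal_def,
    ← assocProb_eq hX, assocProb, measureReal_def (μ := P.restrict _),
    Measure.restrict_apply₀' (nullMeasurableSet_assocEvent hX i), ← measureReal_def, Set.inter_comm]
  rfl

end AccessCoverage


/-! ### The backhaul link -/

section Backhaul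

variable {Ω : Type*} [mΩ : MeasurableSpace Ω] {P : Measure Ω} [IsProbabilityMeasure P]
  {p : Params} {X : ∀ s : Source, Ω → s.Val}

/-- The intensity measure of positions and blocking variables of links. -/
noncomputable abbrev linkIntensity (p : Params) (k : Link) : Measure (Plane × ℝ) :=
  (ENNReal.ofReal (p.density k.tier) • (volume : Measure Plane)).prod
    (volume.restrict (Set.Icc (0 : ℝ) 1))

/-- A link given by its position and blocking variable. -/
def linkPoint (X : ∀ s : Source, Ω → s.Val) (k : Link) (n : ℕ) (ω : Ω) : Plane × ℝ :=
  (point X k n ω, blockVar X k n ω)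

lemma linkIntensity_lt (k : Link) {s : ℝ} (hs : 0 ≤ s) :
    linkIntensity p k {y | linkLoss p k y < s} = ENNReal.ofReal (pathlossIntensity p k s) := by
  have h1 : MeasurableSet {y | linkLoss p k y < s} :=
    measurableSet_lt (measurable_linkLoss p k) measurable_const
  have h2 := lintegral_linkLoss p k (φ := (Set.Iio s).indicator 1)
    (measurable_one.indicator measurableSet_Iio)
  have h3 := lintegral_pathlossDensity_indicator (p := p) k one_pos hs
  simp only [div_one, one_mul] at h3
  rw [h3] at h2
  rw [← lintegral_indicator_one h1, ← h2]
  rfl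

lemma linkIntensity_le_ne_top (k : Link) (s : ℝ) :
    linkIntensity p k {y | linkLoss p k y ≤ s} ≠ ∞ := by
  have h := linkIntensity_lt (p := p) k (s := |s| + 1) (by positivity)
  refine ne_top_of_le_ne_top (h.trans_ne ENNReal.ofReal_ne_top) (measure_mono fun y hy => ?_)
  have hy : linkLoss p k y ≤ s := hy
  have : linkLoss p k y < |s| + 1 := by linarith [le_abs_self s]
  exact this

lemma linkIntensity_nonpos (k : Link) : linkIntensity p k {y | linkLoss p k y ≤ 0} = 0 := by
  have h1 : MeasurableSet {y | linkLoss p k y ≤ 0} :=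
    measurableSet_le (measurable_linkLoss p k) measurable_const
  have h2 := lintegral_linkLoss p k (φ := (Set.Iic 0).indicator 1)
    (measurable_one.indicator measurableSet_Iic)
  rw [setLIntegral_congr_fun (g := fun _ => 0) measurableSet_Ioi (fun l (hl : 0 < l) => by
      have : ¬ l ∈ Set.Iic 0 := not_le.2 hl
      rw [Set.indicator_of_notMem this, mul_zero]), lintegral_zero] at h2
  rw [← lintegral_indicator_one h1]
  exact h2

/-- The least pathloss has density λ_k e^{-Λ_k}: a point at l and none nearer. -/
lemma lintegral_link_loss (k : Link) {φ : ℝ → ℝ≥0∞} (hφ : Measurable φ) :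
    ∫⁻ y, expNeg (linkIntensity p k {x | linkLoss p k x < linkLoss p k y}) *
        φ (linkLoss p k y) ∂(linkIntensity p k) =
      ∫⁻ l in Set.Ioi (0 : ℝ), ENNReal.ofReal (pathlossDensity p k l *
        Real.exp (-pathlossIntensity p k l)) * φ l := by
  have hm : Measurable fun l => expNeg (ENNReal.ofReal (pathlossIntensity p k l)) * φ l := by
    have := (continuous_pathlossIntensity p k).measurable
    fun_prop
  have h1 := lintegral_linkLoss p k hm
  have hnn : ∀ᵐ y ∂(linkIntensity p k), ¬ linkLoss p k y ≤ 0 := by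
    rw [ae_iff]; simpa only [not_not] using linkIntensity_nonpos (p := p) k
  refine (lintegral_congr_ae ?_).trans (h1.trans ?_)
  · filter_upwards [hnn] with y hy
    rw [linkIntensity_lt k (not_le.1 hy).le]
  · refine setLIntegral_congr_fun measurableSet_Ioi fun l (hl : 0 < l) => ?_
    rw [expNeg_ofReal (pathlossIntensity_nonneg p k hl.le), ← mul_assoc,
      ← ENNReal.ofReal_mul (pathlossDensity_nonneg p k hl.le)]

lemma lintegral_expNeg_linkIntensity (k : Link) :
    ∫⁻ y, expNeg (linkIntensity p k {x | linkLoss p k x < linkLoss p k y})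
      ∂(linkIntensity p k) = 1 := by
  have h := lintegral_link_loss (p := p) k (φ := fun _ => 1) measurable_const
  simp only [mul_one] at h
  rw [h, lintegral_deriv_mul_exp_neg (continuous_pathlossIntensity p k) (pathlossIntensity_zero p k)
    (fun l hl => hasDerivAt_pathlossIntensity p k hl)
    (fun l hl => pathlossDensity_nonneg p k hl.le) (tendsto_pathlossIntensity p k)]

/-- Without interference the exponent is the void exponent alone, whatever the threshold. -/
lemma nearExponent_zero_weight {E : Type*} [MeasurableSpace E] {m : Measure E} {ℓ : E → ℝ}
    (hℓ : Measurable ℓ) (c l : ℝ) :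
    nearExponent m ℓ (fun _ => 0) c l = m {y | ℓ y < l} := by
  rw [← nearExponent_zero hℓ l]
  simp [nearExponent, nearCost]

/-- The average power of the backhaul link over its inverse pathloss. -/
noncomputable def backhaulPower (p : Params) : ℝ :=
  p.power .mbs * p.refLoss .backhaul * p.gain .mbs * p.gain .sbs

lemma backhaulPower_pos (p : Params) : 0 < backhaulPower p := by
  have h1 := p.power_pos .mbs
  have h2 := p.refLoss_pos .backhaul
  have h3 := p.gain_pos .mbs
  have h4 := p.gain_pos .sbs
  unfold backhaulPower
  positivity

/-- The sources of the backhaul links. -/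
def backhaulSources : Set Source :=
  {s | s = .points .backhaul ∨ (∃ n, s = .blocking .backhaul n) ∨ (∃ n, s = .fading .backhaul n)}

/-- The backhaul link is covered at threshold `τ`. -/
def backhaulCover (p : Params) (X : ∀ s : Source, Ω → s.Val) (τ : ℝ) : Set Ω :=
  coverSet (linkPoint X .backhaul) (linkLoss p .backhaul) (fun _ => 0) (τ / backhaulPower p)
    (ENNReal.ofReal p.noise) Set.univ (fadingVar X .backhaul)

lemma measurable_linkPoint {Ω : Type*} {mΩ : MeasurableSpace Ω} {X : ∀ s : Source, Ω → s.Val}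
    (k : Link) (n : ℕ) (h1 : Measurable (X (.points k))) (h2 : Measurable (X (.blocking k n))) :
    Measurable (linkPoint X k n) :=
  (measurable_point k n h1).prodMk h2

lemma measurableSet_backhaulCover (τ : ℝ) :
    MeasurableSet[sourceAlgebra X backhaulSources] (backhaulCover p X τ) :=
  measurableSet_coverSet (measurable_linkLoss p .backhaul) measurable_const MeasurableSet.univ
    (fun n => measurable_linkPoint _ _ (measurable_source (s := .points .backhaul) (Or.inl rfl))
      (measurable_source (s := .blocking .backhaul n) (Or.inr (Or.inl ⟨n, rfl⟩))))
    fun n => measurable_source (s := .fading .backhaul n) (Or.inr (Or.inr ⟨n, rfl⟩))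

lemma ae_backhaul (hX : IsNetwork p X P) : ∀ᵐ ω ∂P,
    (∃! n, IsNearest (linkPoint X .backhaul) (linkLoss p .backhaul) n ω) ∧
      (∀ n, 0 < pathloss p X .backhaul n ω) ∧ ∀ n, 0 < fadingVar X .backhaul n ω := by
  have hY := isPPP_link hX .backhaul
  have h1 := hY.ae_existsUnique_isNearest (measurable_linkLoss p .backhaul)
    (linkIntensity_le_ne_top _) (lintegral_expNeg_linkIntensity _)
  have h2 := hY.ae_forall_notMem (measurableSet_le (measurable_linkLoss p .backhaul)
    measurable_const) (linkIntensity_nonpos _)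
  have h3 : ∀ᵐ ω ∂P, ∀ n, 0 < fadingVar X .backhaul n ω := ae_all_iff.2 fun n =>
      ae_nonneg_of_map_eq_expMeasure (measurable_fadingVar hX .backhaul n) (hX.fading_law _ n)
  filter_upwards [h1, h2, h3] with ω h1 h2 h3
  exact ⟨h1, fun n => not_le.1 (h2 n), h3⟩

lemma isNearest_anchorMBS {ω : Ω}
    (h1 : ∃ n, IsNearest (linkPoint X .backhaul) (linkLoss p .backhaul) n ω)
    (h2 : ∀ n, 0 < pathloss p X .backhaul n ω) :
    IsNearest (linkPoint X .backhaul) (linkLoss p .backhaul) (anchorMBS p X ω) ω := by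
  have hP : 0 < p.power .mbs * p.refLoss .backhaul * p.gain .mbs * p.gain .sbs :=
    backhaulPower_pos p
  have key : ∀ n, IsNearest (linkPoint X .backhaul) (linkLoss p .backhaul) n ω ↔
      ∀ n', p.power .mbs * p.refLoss .backhaul * p.gain .mbs * p.gain .sbs *
        (pathloss p X .backhaul n' ω)⁻¹ ≤
      p.power .mbs * p.refLoss .backhaul * p.gain .mbs * p.gain .sbs *
        (pathloss p X .backhaul n ω)⁻¹ := fun n => forall_congr' fun n' => by
    rw [mul_le_mul_iff_right₀ hP, inv_le_inv₀ (h2 n') (h2 n)]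
    rfl
  obtain ⟨n, hn⟩ := h1
  rw [key]
  exact Classical.epsilon_spec (p := fun n => ∀ n',
    p.power .mbs * p.refLoss .backhaul * p.gain .mbs * p.gain .sbs *
        (pathloss p X .backhaul n' ω)⁻¹ ≤
      p.power .mbs * p.refLoss .backhaul * p.gain .mbs * p.gain .sbs *
        (pathloss p X .backhaul n ω)⁻¹) ⟨n, (key n).1 hn⟩

lemma ae_snrBackhaul_pos (hX : IsNetwork p X P) : ∀ᵐ ω ∂P, 0 < snrBackhaul p X ω := by
  filter_upwards [ae_backhaul hX] with ω ⟨_, h2, h3⟩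
  have h4 := h2 (anchorMBS p X ω)
  have h5 := h3 (anchorMBS p X ω)
  have h1 := p.power_pos .mbs
  have h2 := p.refLoss_pos .backhaul
  have h3 := p.gain_pos .mbs
  have h6 := p.gain_pos .sbs
  have hN : 0 < p.noise := mul_pos p.noisePSD_pos p.bandwidth_pos
  unfold snrBackhaul
  positivity

lemma backhaulCover_ae_eq (hX : IsNetwork p X P) {τ : ℝ} (hτ : 0 ≤ τ) :
    backhaulCover p X τ =ᵐ[P] {ω | τ < snrBackhaul p X ω} := by
  filter_upwards [ae_backhaul hX] with ω ⟨h1, h2, h3⟩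
  refine propext ?_
  change ω ∈ backhaulCover p X τ ↔ τ < snrBackhaul p X ω
  have hn := isNearest_anchorMBS h1.exists h2
  rw [backhaulCover, mem_coverSet_iff hn fun k hk => h1.unique hk hn]
  set n := anchorMBS p X ω with hndef
  have hN : 0 < p.noise := mul_pos p.noisePSD_pos p.bandwidth_pos
  have hL : 0 < linkLoss p .backhaul (linkPoint X .backhaul n ω) := h2 n
  have hP := backhaulPower_pos p
  simp only [Set.mem_univ, true_and, ite_self, tsum_zero, zero_add]
  rw [← ENNReal.ofReal_mul (by positivity), ENNReal.ofReal_lt_ofReal_iff (h3 n)]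
  have e : snrBackhaul p X ω = backhaulPower p * fadingVar X .backhaul n ω /
      (linkLoss p .backhaul (linkPoint X .backhaul n ω) * p.noise) := by
    unfold snrBackhaul backhaulPower
    rw [← hndef, pathloss_eq, ← div_div, div_eq_mul_inv _ (linkLoss _ _ _)]
    simp only [linkPoint]
    ring
  -- Both inequalities are cleared to τ times pathloss times noise below mean power times fading.
  rw [e, lt_div_iff₀ (by positivity), div_mul_eq_mul_div, div_mul_eq_mul_div, div_lt_iff₀ hP]
  constructor <;> intro h <;> linarith

lemma tsum_measure_backhaul (hX : IsNetwork p X P) {c : ℝ} (hc : 0 ≤ c) :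
    ∑' n, P {ω | fadingThreshold (linkPoint X .backhaul) (linkLoss p .backhaul) (fun _ => 0) c
        (ENNReal.ofReal p.noise) Set.univ n ω < ENNReal.ofReal (fadingVar X .backhaul n ω)} =
      ∫⁻ y in Set.univ, expNeg (ENNReal.ofReal (c * linkLoss p .backhaul y) *
        ENNReal.ofReal p.noise) * expNeg (nearExponent (linkIntensity p .backhaul)
          (linkLoss p .backhaul) (fun _ => 0) c (linkLoss p .backhaul y))
            ∂(linkIntensity p .backhaul) := by
  have hlp : ∀ n k, Measurable[sourceAlgebra X (otherSources .backhaul n)]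
      (linkPoint X .backhaul k) := fun n k =>
    measurable_linkPoint _ _ (measurable_source (s := .points .backhaul) (fun h => nomatch h))
      (measurable_source (s := .blocking .backhaul k) (fun h => nomatch h))
  have hY : IsPPP (linkPoint X .backhaul) P (linkIntensity p .backhaul) := isPPP_link hX .backhaul
  exact hY.tsum_measure_fadingThreshold_lt (h := fadingVar X .backhaul)
    (measurable_linkLoss p .backhaul) measurable_const (by simp) hc (linkIntensity_le_ne_top _)
    MeasurableSet.univ (ENNReal.ofReal p.noise) (fun n => measurable_fadingVar hX .backhaul n)
    (fun n => hX.fading_law _ _) (fun n => sourceAlgebra X (otherSources .backhaul n))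
    (fun n => sourceAlgebra_le hX _) (fun n => indep_fading_other hX _ _)
    (fun n k _ => hlp n k) (fun n => (measurable_linkLoss p .backhaul).comp (hlp n n))
    (fun n => MeasurableSet.univ)

lemma measureReal_backhaulCover (hX : IsNetwork p X P) {τ : ℝ} (hτ : 0 ≤ τ) :
    P.real (backhaulCover p X τ) = backhaulCoverage p τ := by
  have hY : IsPPP (linkPoint X .backhaul) P (linkIntensity p .backhaul) := isPPP_link hX .backhaul
  have hPw := backhaulPower_pos p
  have hN : 0 < p.noise := mul_pos p.noisePSD_pos p.bandwidth_pos
  have hc : 0 ≤ τ / backhaulPower p := by positivity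
  have huniq := hY.ae_existsUnique_isNearest (measurable_linkLoss p .backhaul)
    (linkIntensity_le_ne_top _) (lintegral_expNeg_linkIntensity _)
  have hφ : Measurable fun l : ℝ => expNeg (ENNReal.ofReal (τ / backhaulPower p * l) *
      ENNReal.ofReal p.noise) := by fun_prop
  have h : P (backhaulCover p X τ) = ∫⁻ l in Set.Ioi (0 : ℝ),
      ENNReal.ofReal (pathlossDensity p .backhaul l *
        Real.exp (-pathlossIntensity p .backhaul l)) *
        expNeg (ENNReal.ofReal (τ / backhaulPower p * l) * ENNReal.ofReal p.noise) := by
    rw [backhaulCover, measure_coverSet (h := fadingVar X .backhaul)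
      (measurable_linkLoss p .backhaul) measurable_const MeasurableSet.univ hY.measurable
      (fun n => measurable_fadingVar hX .backhaul n) huniq, tsum_measure_backhaul hX hc,
      ← lintegral_link_loss _ hφ, Measure.restrict_univ]
    refine lintegral_congr fun y => ?_
    rw [nearExponent_zero_weight (measurable_linkLoss p .backhaul), mul_comm]
  have hm : Measurable fun l => ENNReal.ofReal (pathlossDensity p .backhaul l *
        Real.exp (-pathlossIntensity p .backhaul l)) *
        expNeg (ENNReal.ofReal (τ / backhaulPower p * l) * ENNReal.ofReal p.noise) := by
    have := measurable_pathlossDensity p .backhaul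
    have := (continuous_pathlossIntensity p .backhaul).measurable
    fun_prop
  rw [measureReal_def, h, ← integral_toReal hm.aemeasurable
    (ae_lt_top hm (h ▸ measure_ne_top P _)), backhaulCoverage]
  refine setIntegral_congr_fun measurableSet_Ioi fun l (hl : 0 < l) => ?_
  have hd := pathlossDensity_nonneg p .backhaul hl.le
  rw [← ENNReal.ofReal_mul (by positivity), expNeg_ofReal (by positivity), ENNReal.toReal_mul,
    ENNReal.toReal_ofReal (by positivity), ENNReal.toReal_ofReal (Real.exp_pos _).le, mul_assoc,
    ← Real.exp_add, mul_comm]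
  congr 2
  unfold backhaulPower
  ring

lemma measureReal_snrBackhaul (hX : IsNetwork p X P) {τ : ℝ} (hτ : 0 ≤ τ) :
    P.real {ω | τ < snrBackhaul p X ω} = backhaulCoverage p τ := by
  rw [← measureReal_congr (backhaulCover_ae_eq hX hτ), measureReal_backhaulCover hX hτ]

end Backhaul

/-! ### Joint laws of access, backhaul and load -/

section Joint

variable {Ω : Type*} [mΩ : MeasurableSpace Ω] {P : Measure Ω} [IsProbabilityMeasure P]
  {p : Params} {X : ∀ s : Source, Ω → s.Val}

lemma sourceAlgebra_mono {S T : Set Source} (h : S ⊆ T) :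
    sourceAlgebra X S ≤ sourceAlgebra X T :=
  biSup_mono h

lemma measureReal_inter_of_sources (hX : IsNetwork p X P) {S T : Set Source} (hST : Disjoint S T)
    {A B : Set Ω} (hA : MeasurableSet[sourceAlgebra X S] A)
    (hB : MeasurableSet[sourceAlgebra X T] B) : P.real (A ∩ B) = P.real A * P.real B := by
  have h := ((Indep_iff _ _ _).1 (indep_sourceAlgebra hX hST)) A B hA hB
  simp only [measureReal_def, h, ENNReal.toReal_mul]

lemma disjoint_access_backhaul : Disjoint accessSources backhaulSources := by
  rw [Set.disjoint_left]
  rintro s (⟨i, rfl⟩ | ⟨i, n, rfl⟩ | ⟨i, n, rfl⟩ | ⟨n, rfl⟩ | ⟨n, rfl⟩) <;>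
    rintro (h | ⟨k, h⟩ | ⟨k, h⟩) <;> cases h

lemma disjoint_union_load (i : Tier) :
    Disjoint (accessSources ∪ backhaulSources) {Source.load i} := by
  rw [Set.disjoint_left]
  rintro s ((⟨i, rfl⟩ | ⟨i, n, rfl⟩ | ⟨i, n, rfl⟩ | ⟨n, rfl⟩ | ⟨n, rfl⟩) | (rfl | ⟨n, rfl⟩ | ⟨n, rfl⟩)) h <;>
    cases h

lemma measureReal_access_inter_backhaul (hX : IsNetwork p X P) (i : Tier) {τ₁ τ₂ : ℝ}
    (h₁ : 0 ≤ τ₁) (h₂ : 0 ≤ τ₂) : P.real (accessCover p X i τ₁ ∩ backhaulCover p X τ₂) =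
      assocFormula p i * (accessCoverage p i τ₁ * backhaulCoverage p τ₂) := by
  rw [measureReal_inter_of_sources hX disjoint_access_backhaul (measurableSet_accessCover i τ₁)
    (measurableSet_backhaulCover τ₂), measureReal_accessCover_eq hX i h₁,
    measureReal_backhaulCover hX h₂, mul_assoc]

lemma loadKt_nonneg (n : ℕ) {lam lamU : ℝ} (h : 0 < lam) (hU : 0 < lamU) :
    0 ≤ loadKt n lam lamU := by
  unfold loadKt
  split_ifs
  · exact le_rfl
  · have h1 : 0 < Real.Gamma ((n : ℝ) + 3.5) := Real.Gamma_pos_of_pos (by positivity)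
    have h2 : 0 < Real.Gamma 3.5 := Real.Gamma_pos_of_pos (by norm_num)
    positivity

lemma measureReal_load (hX : IsNetwork p X P) (i : Tier) (n : ℕ) :
    P.real {ω | loadVar X i ω = n} =
      loadKt n (p.density i / assocFormula p i) p.userDensity := by
  rw [measureReal_def, hX.load_law, assocProb_eq hX, ENNReal.toReal_ofReal]
  exact loadKt_nonneg n (div_pos (p.density_pos i) (assocFormula_pos hX i)) p.userDensity_pos

lemma measurableSet_load (i : Tier) (n : ℕ) :
    MeasurableSet[sourceAlgebra X {.load i}] {ω | loadVar X i ω = n} := by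
  have h : Measurable[sourceAlgebra X {.load i}] (loadVar X i) :=
    measurable_source (s := .load i) rfl
  exact h (measurableSet_singleton n)

lemma measureReal_access_load (hX : IsNetwork p X P) (i : Tier) (n : ℕ) {τ : ℝ} (hτ : 0 ≤ τ) :
    P.real {ω | loadVar X i ω = n ∧ (taggedBS p X ω).1 = i ∧ τ < sinrAccess p X ω} =
      assocFormula p i * (accessCoverage p i τ *
        loadKt n (p.density i / assocFormula p i) p.userDensity) := by
  have h : {ω | loadVar X i ω = n ∧ (taggedBS p X ω).1 = i ∧ τ < sinrAccess p X ω} =ᵐ[P]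
      (accessCover p X i τ ∩ {ω | loadVar X i ω = n} : Set Ω) := by
    rw [Set.inter_comm]
    exact (Filter.EventuallyEq.refl _ _).inter (accessCover_ae_eq hX i hτ).symm
  rw [measureReal_congr h, measureReal_inter_of_sources hX ((disjoint_union_load i).mono_left
    Set.subset_union_left) (measurableSet_accessCover i τ) (measurableSet_load i n),
    measureReal_accessCover_eq hX i hτ, measureReal_load hX, mul_assoc]

/-- Up to null sets the three conditions are events of pairwise disjoint families of sources, so
their probabilities multiply. -/
lemma measureReal_access_backhaul_load (hX : IsNetwork p X P) (i : Tier) (n : ℕ) {τ₁ τ₂ : ℝ}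
    (h₁ : 0 ≤ τ₁) (h₂ : 0 ≤ τ₂) :
    P.real {ω | loadVar X i ω = n ∧ (taggedBS p X ω).1 = i ∧ τ₁ < sinrAccess p X ω ∧
        τ₂ < snrBackhaul p X ω} =
      assocFormula p i * (accessCoverage p i τ₁ * backhaulCoverage p τ₂ *
        loadKt n (p.density i / assocFormula p i) p.userDensity) := by
  have h : {ω | loadVar X i ω = n ∧ (taggedBS p X ω).1 = i ∧ τ₁ < sinrAccess p X ω ∧
        τ₂ < snrBackhaul p X ω} =ᵐ[P]
      ((accessCover p X i τ₁ ∩ backhaulCover p X τ₂) ∩ {ω | loadVar X i ω = n} : Set Ω) := by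
    refine EventuallyEq.trans ?_ (((accessCover_ae_eq hX i h₁).symm.inter
      (backhaulCover_ae_eq hX h₂).symm).inter (EventuallyEq.refl _ {ω | loadVar X i ω = n}))
    refine ae_of_all _ fun ω => propext ?_
    change (_ ∧ _ ∧ _ ∧ _) ↔ ((_ ∧ _) ∧ _) ∧ _
    tauto
  rw [measureReal_congr h, measureReal_inter_of_sources hX (disjoint_union_load i)
    (MeasurableSet.inter (sourceAlgebra_mono Set.subset_union_left _ (measurableSet_accessCover i τ₁))
      (sourceAlgebra_mono Set.subset_union_right _ (measurableSet_backhaulCover τ₂)))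
    (measurableSet_load i n),
    measureReal_access_inter_backhaul hX i h₁ h₂, measureReal_load hX, mul_assoc]

lemma cond_sinrAccess (hX : IsNetwork p X P) (i : Tier) {τ : ℝ} (hτ : 0 ≤ τ) :
    (P[|assocEvent p X i]).real {ω | τ < sinrAccess p X ω} = accessCoverage p i τ := by
  rw [cond_assocEvent_real hX]
  simp only [Set.mem_ofPred_eq]
  rw [← measureReal_congr (accessCover_ae_eq hX i hτ), measureReal_accessCover_eq hX i hτ,
    inv_mul_cancel_left₀ (assocFormula_pos hX i).ne']

lemma cond_sinrAccess_snrBackhaul (hX : IsNetwork p X P) (i : Tier) {τ₁ τ₂ : ℝ}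
    (h₁ : 0 ≤ τ₁) (h₂ : 0 ≤ τ₂) : (P[|assocEvent p X i]).real
      {ω | τ₁ < sinrAccess p X ω ∧ τ₂ < snrBackhaul p X ω} =
        accessCoverage p i τ₁ * backhaulCoverage p τ₂ := by
  have h : {ω | (taggedBS p X ω).1 = i ∧ τ₁ < sinrAccess p X ω ∧ τ₂ < snrBackhaul p X ω} =ᵐ[P]
      (accessCover p X i τ₁ ∩ backhaulCover p X τ₂ : Set Ω) := by
    refine EventuallyEq.trans ?_ ((accessCover_ae_eq hX i h₁).symm.inter
      (backhaulCover_ae_eq hX h₂).symm)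
    refine ae_of_all _ fun ω => propext ?_
    change (_ ∧ _ ∧ _) ↔ (_ ∧ _) ∧ _
    tauto
  rw [cond_assocEvent_real hX]
  simp only [Set.mem_ofPred_eq]
  rw [measureReal_congr h, measureReal_access_inter_backhaul hX i h₁ h₂,
    inv_mul_cancel_left₀ (assocFormula_pos hX i).ne']

end Joint


/-! ### Mean of the load distribution -/

section NegativeBinomial

lemma hasSum_of_tsum_ofReal {ι : Type*} {a : ι → ℝ} {b : ℝ} (ha : ∀ i, 0 ≤ a i) (hb : 0 ≤ b)
    (h : ∑' i, ENNReal.ofReal (a i) = ENNReal.ofReal b) : HasSum a b := by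
  have h1 := ENNReal.hasSum_toReal (f := fun i => ENNReal.ofReal (a i)) (by simp [h])
  rw [← ENNReal.tsum_toReal_eq (by simp), h, ENNReal.toReal_ofReal hb] at h1
  simpa only [ENNReal.toReal_ofReal (ha _)] using h1

/-- The negative binomial series. -/
lemma hasSum_Gamma_mul_pow {s q : ℝ} (hs : 0 < s) (hq : 0 ≤ q) (hq1 : q < 1) :
    HasSum (fun n : ℕ => Real.Gamma (n + s) * (q ^ n / n.factorial))
      (Real.Gamma s * (1 - q) ^ (-s)) := by
  have h1q : 0 < 1 - q := sub_pos.2 hq1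
  have hG : ∀ r : ℝ, 0 < r → 0 < Real.Gamma r := fun r hr => Real.Gamma_pos_of_pos hr
  -- Each Gamma value is written as Euler's integral; under the integral the series is that of
  -- e^{qt}, and what remains is again a Gamma integral with rate 1 - q.
  have hterm : ∀ n : ℕ, ENNReal.ofReal (Real.Gamma (n + s) * (q ^ n / n.factorial)) =
      ∫⁻ t in Set.Ioi (0 : ℝ),
        ENNReal.ofReal (Real.exp (-t) * t ^ ((n : ℝ) + s - 1) * (q ^ n / n.factorial)) := fun n => by
    have hns : 0 < (n : ℝ) + s := by positivity
    rw [Real.Gamma_eq_integral hns, ← integral_mul_const, ofReal_integral_eq_lintegral_ofReal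
      ((Real.GammaIntegral_convergent hns).mul_const _)]
    filter_upwards [ae_restrict_mem measurableSet_Ioi] with t (ht : 0 < t)
    positivity
  have hsum : ∀ t : ℝ, 0 < t → ∑' n : ℕ,
      ENNReal.ofReal (Real.exp (-t) * t ^ ((n : ℝ) + s - 1) * (q ^ n / n.factorial)) =
      ENNReal.ofReal (t ^ (s - 1) * Real.exp (-((1 - q) * t))) := fun t ht => by
    have h1 := (NormedSpace.expSeries_div_hasSum_exp (q * t)).mul_left
      (Real.exp (-t) * t ^ (s - 1))
    rw [← Real.exp_eq_exp_ℝ] at h1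
    have h2 : HasSum (fun n : ℕ => Real.exp (-t) * t ^ ((n : ℝ) + s - 1) * (q ^ n / n.factorial))
        (t ^ (s - 1) * Real.exp (-((1 - q) * t))) := by
      convert! h1 using 1
      · funext n
        rw [show (n : ℝ) + s - 1 = s - 1 + n by ring, Real.rpow_add ht, Real.rpow_natCast, mul_pow]
        ring
      · rw [mul_right_comm, ← Real.exp_add, mul_comm]
        congr 2
        ring
    rw [← ENNReal.ofReal_tsum_of_nonneg (fun n => by positivity) h2.summable, h2.tsum_eq]
  refine hasSum_of_tsum_ofReal (fun n => ?_) ?_ ?_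
  · have := hG (n + s) (by positivity)
    positivity
  · have := hG s hs
    positivity
  · simp_rw [hterm]
    rw [← lintegral_tsum fun n => by fun_prop, setLIntegral_congr_fun measurableSet_Ioi
      fun t ht => hsum t ht]
    have h3 := Real.integral_rpow_mul_exp_neg_mul_Ioi hs h1q
    rw [one_div, Real.inv_rpow h1q.le, ← Real.rpow_neg h1q.le] at h3
    rw [mul_comm (Real.Gamma s), ← h3, ofReal_integral_eq_lintegral_ofReal]
    · refine Integrable.of_integral_ne_zero ?_
      rw [h3]
      have := hG s hs
      positivity
    · filter_upwards [ae_restrict_mem measurableSet_Ioi] with t (ht : 0 < t)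
      positivity

/-- The factor n cancels against n!, leaving after a shift by one the negative binomial series of
shape 4.5 at q = x/(3.5 + x), where x = `lamU / lam`. -/
lemma meanLoad_eq {lam lamU : ℝ} (h : 0 < lam) (hU : 0 < lamU) : meanLoad lam lamU = lamU / lam := by
  set x := lamU / lam with hx
  have hx0 : 0 < x := div_pos hU h
  clear_value x
  have hd : 0 < 3.5 + x := by positivity
  have hG : 0 < Real.Gamma 3.5 := Real.Gamma_pos_of_pos (by norm_num)
  have hG1 : Real.Gamma 4.5 = 3.5 * Real.Gamma 3.5 := by
    rw [← Real.Gamma_add_one (by norm_num)]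
    norm_num
  have h1 := (hasSum_Gamma_mul_pow (s := 4.5) (q := x / (3.5 + x)) (by norm_num) (by positivity)
    (by rw [div_lt_one hd]; linarith)).mul_left
      ((3.5 : ℝ) ^ (3.5 : ℝ) / Real.Gamma 3.5 * x * (3.5 + x) ^ (-4.5 : ℝ))
  have h2 : HasSum (fun m : ℕ => ((m + 1 : ℕ) : ℝ) * loadK (m + 1) lam lamU) x := by
    convert! h1 using 1
    · funext m
      have e1 : (3.5 + x) ^ (-((m + 1 : ℕ) : ℝ) - 3.5) = (3.5 + x) ^ (-4.5 : ℝ) / (3.5 + x) ^ m := by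
        rw [show (-((m + 1 : ℕ) : ℝ) - 3.5) = -4.5 - (m : ℝ) by push_cast; ring,
          Real.rpow_sub hd, Real.rpow_natCast]
      have e2 : (((m + 1 : ℕ) : ℝ) + 3.5) = (m : ℝ) + 4.5 := by push_cast; ring
      have e3 : (((m + 1).factorial : ℕ) : ℝ) = ((m + 1 : ℕ) : ℝ) * (m.factorial : ℝ) := by
        rw [Nat.factorial_succ]; push_cast; ring
      have e4 : (((m + 1 : ℕ) : ℝ)) ≠ 0 := by positivity
      rw [loadK, ← hx, e1, e2, e3, div_pow, pow_succ]
      have e5 : (m.factorial : ℝ) ≠ 0 := by positivity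
      field_simp
    · have e1 : 1 - x / (3.5 + x) = 3.5 / (3.5 + x) := by field_simp; ring
      rw [e1, Real.div_rpow (by norm_num) hd.le, hG1]
      have e2 : (3.5 : ℝ) ^ (-4.5 : ℝ) * (3.5 : ℝ) ^ (3.5 : ℝ) * 3.5 = 1 := by
        rw [← Real.rpow_add (by norm_num), ← Real.rpow_add_one (by norm_num)]
        norm_num
      have e3 : (3.5 + x) ^ (-4.5 : ℝ) ≠ 0 := (Real.rpow_pos_of_pos hd _).ne'
      field_simp
      linear_combination -e2
  -- The omitted term n = 0 carries the factor 0.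
  have h3 := (hasSum_nat_add_iff (f := fun n : ℕ => (n : ℝ) * loadK n lam lamU) 1).1 h2
  simp only [Finset.range_one, Finset.sum_singleton, Nat.cast_zero, zero_mul, add_zero] at h3
  exact h3.tsum_eq

end NegativeBinomial

/-! ### Decomposition of an event by the value of an integer variable -/

section Fibers

/-- Countable additivity of the restriction of P to A over the measurable fibres of N; A itself may
be nonmeasurable, as rate events are not known to be measurable. -/
lemma hasSum_measureReal_fiber {Ω : Type*} {mΩ : MeasurableSpace Ω} {P : Measure Ω}
    [IsFiniteMeasure P] {N : Ω → ℕ} (hN : Measurable N) (h0 : ∀ᵐ ω ∂P, N ω ≠ 0) (A : Set Ω) :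
    HasSum (fun n : ℕ+ => P.real ({ω | N ω = n} ∩ A)) (P.real A) := by
  have hm : ∀ n : ℕ+, MeasurableSet {ω | N ω = n} := fun n => hN (measurableSet_singleton (n : ℕ))
  have h1 : (P.restrict A) (⋃ n : ℕ+, {ω | N ω = n}) = ∑' n : ℕ+, P ({ω | N ω = n} ∩ A) := by
    rw [measure_iUnion (fun n k hnk => Set.disjoint_left.2 fun ω hn hk =>
      hnk (PNat.coe_injective (hn.symm.trans hk))) hm]
    exact tsum_congr fun n => Measure.restrict_apply (hm n)
  have h2 : (P.restrict A) (⋃ n : ℕ+, {ω | N ω = n}) = P A := by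
    rw [measure_congr (t := Set.univ), Measure.restrict_apply_univ]
    filter_upwards [ae_restrict_of_ae h0] with ω hω
    refine propext ⟨fun _ => trivial, fun _ => ?_⟩
    exact Set.mem_iUnion.2 ⟨⟨N ω, Nat.pos_of_ne_zero hω⟩, rfl⟩
  rw [h2] at h1
  have h3 := ENNReal.hasSum_toReal (f := fun n : ℕ+ => P ({ω | N ω = n} ∩ A))
    (h1 ▸ measure_ne_top P A)
  rw [← ENNReal.tsum_toReal_eq (fun n => measure_ne_top P _), ← h1] at h3
  exact h3

end Fibers

/-! ### Rate coverage under the two allocations -/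

section Rates

variable {Ω : Type*} [mΩ : MeasurableSpace Ω] {P : Measure Ω} [IsProbabilityMeasure P]
  {p : Params} {X : ∀ s : Source, Ω → s.Val}

lemma lt_mul_logb_iff {c x ρ : ℝ} (hc : 0 < c) (hx : 0 < x) :
    ρ < c * Real.logb 2 (1 + x) ↔ (2 : ℝ) ^ (ρ / c) - 1 < x := by
  rw [← div_lt_iff₀' hc, Real.lt_logb_iff_rpow_lt one_lt_two (by linarith), sub_lt_iff_lt_add']

lemma two_rpow_sub_one_nonneg {t : ℝ} (ht : 0 ≤ t) : 0 ≤ (2 : ℝ) ^ t - 1 :=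
  sub_nonneg.2 (Real.one_le_rpow one_le_two ht)

lemma meanUsers_eq (hX : IsNetwork p X P) (i : Tier) :
    meanUsers p X P i = p.userDensity * assocFormula p i / p.density i := by
  have h1 := p.density_pos i
  have h2 := assocFormula_pos hX i
  rw [meanUsers, assocProb_eq hX, meanLoad_eq (div_pos h1 h2) p.userDensity_pos, div_div_eq_mul_div]

lemma meanBackhauledUsers_eq (hX : IsNetwork p X P) :
    meanBackhauledUsers p X P = assocFormula p .sbs * p.userDensity / p.density .mbs := by
  have h1 := (p.density_pos .sbs).ne'
  rw [meanBackhauledUsers, meanUsers_eq hX, meanLoad_eq (p.density_pos _) (p.density_pos _)]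
  field_simp

lemma ae_loadVar_ne_zero (hX : IsNetwork p X P) (i : Tier) : ∀ᵐ ω ∂P, loadVar X i ω ≠ 0 := by
  rw [ae_iff]
  simp only [not_not]
  rw [hX.load_law i 0]
  simp [loadKt]

/-- The sum is the conditional probability of R given the tier; convergence is inherited from the
fibre decomposition after division by the positive association probability. -/
lemma exists_hasSum_measureReal (hX : IsNetwork p X P) (i : Tier) {R : Set Ω} {t : ℕ+ → ℝ}
    (h : ∀ n : ℕ+, P.real ({ω | loadVar X i ω = n} ∩ (R ∩ assocEvent p X i)) =
      assocFormula p i * t n) :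
    ∃ S, HasSum t S ∧ P.real (R ∩ assocEvent p X i) = assocFormula p i * S := by
  have h0 := (assocFormula_pos hX i).ne'
  have h1 := hasSum_measureReal_fiber (P := P) (hX.measurable (.load i)) (ae_loadVar_ne_zero hX i)
    (R ∩ assocEvent p X i)
  refine ⟨P.real (R ∩ assocEvent p X i) / assocFormula p i, ?_, (mul_div_cancel₀ _ h0).symm⟩
  rw [← hasSum_mul_left_iff h0, mul_div_cancel₀ _ h0]
  exact h1.congr_fun fun n => (h n).symm

/-- Decomposition of an event by the tier and the load of the tagged BS. -/
lemma exists_hasSum_rate (hX : IsNetwork p X P) {R : Set Ω} {tm ts : ℕ+ → ℝ}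
    (hm : ∀ n : ℕ+, P.real ({ω | loadVar X .mbs ω = n} ∩ (R ∩ assocEvent p X .mbs)) =
      assocFormula p .mbs * tm n)
    (hs : ∀ n : ℕ+, P.real ({ω | loadVar X .sbs ω = n} ∩ (R ∩ assocEvent p X .sbs)) =
      assocFormula p .sbs * ts n) :
    ∃ Sm Ss, HasSum tm Sm ∧ HasSum ts Ss ∧
      P.real R = assocFormula p .mbs * Sm + assocFormula p .sbs * Ss := by
  obtain ⟨Sm, h1, h2⟩ := exists_hasSum_measureReal hX .mbs hm
  obtain ⟨Ss, h3, h4⟩ := exists_hasSum_measureReal hX .sbs hs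
  refine ⟨Sm, Ss, h1, h3, ?_⟩
  have h5 : R ∩ assocEvent p X .sbs = R \ assocEvent p X .mbs := by
    ext ω
    simp only [assocEvent, Set.mem_sdiff, Set.mem_inter_iff, Set.mem_ofPred_eq]
    cases (taggedBS p X ω).1 <;> simp
  rw [← h2, ← h4, h5]
  exact (measureReal_inter_add_sdiff₀ (nullMeasurableSet_assocEvent hX .mbs)).symm

lemma ae_sinrAccess_pos (hX : IsNetwork p X P) : ∀ᵐ ω ∂P, 0 < sinrAccess p X ω := by
  filter_upwards [ae_accessRegular hX] with ω h using sinrAccess_pos h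

lemma measureReal_rate_mbs (hX : IsNetwork p X P) {R : Set Ω} {n : ℕ+} {ρ c t : ℝ} (hρ : 0 ≤ ρ)
    (hc : 0 < c) (ht : ρ / c = t)
    (hR : ∀ ω, loadVar X .mbs ω = n → (taggedBS p X ω).1 = .mbs →
      (ω ∈ R ↔ ρ < c * Real.logb 2 (1 + sinrAccess p X ω))) :
    P.real ({ω | loadVar X .mbs ω = n} ∩ (R ∩ assocEvent p X .mbs)) =
      assocFormula p .mbs * (accessCoverage p .mbs ((2 : ℝ) ^ t - 1) *
        loadKt n (p.density .mbs / assocFormula p .mbs) p.userDensity) := by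
  subst ht
  rw [← measureReal_access_load hX .mbs n (two_rpow_sub_one_nonneg (div_nonneg hρ hc.le))]
  refine measureReal_congr ?_
  filter_upwards [ae_sinrAccess_pos hX] with ω hω
  refine propext ?_
  change (loadVar X .mbs ω = n ∧ ω ∈ R ∧ (taggedBS p X ω).1 = .mbs) ↔
    loadVar X .mbs ω = n ∧ (taggedBS p X ω).1 = .mbs ∧ _ < sinrAccess p X ω
  refine and_congr_right fun h1 => ?_
  rw [and_comm]
  refine and_congr_right fun h2 => ?_
  rw [hR ω h1 h2, lt_mul_logb_iff hc hω]

/-- A minimum exceeds ρ when both terms do. Once the load is fixed each term is a constant times a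
logarithm, so the event is one joint threshold on SINR and SNR. -/
lemma measureReal_rate_sbs (hX : IsNetwork p X P) {R : Set Ω} {n : ℕ+} {ρ c d t u : ℝ}
    (hρ : 0 ≤ ρ) (hc : 0 < c) (hd : 0 < d) (ht : ρ / c = t) (hu : ρ / d = u)
    (hR : ∀ ω, loadVar X .sbs ω = n → (taggedBS p X ω).1 = .sbs →
      (ω ∈ R ↔ ρ < min (c * Real.logb 2 (1 + sinrAccess p X ω))
        (d * Real.logb 2 (1 + snrBackhaul p X ω)))) :
    P.real ({ω | loadVar X .sbs ω = n} ∩ (R ∩ assocEvent p X .sbs)) =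
      assocFormula p .sbs * (accessCoverage p .sbs ((2 : ℝ) ^ t - 1) *
        backhaulCoverage p ((2 : ℝ) ^ u - 1) *
          loadKt n (p.density .sbs / assocFormula p .sbs) p.userDensity) := by
  subst ht hu
  rw [← measureReal_access_backhaul_load hX .sbs n
    (two_rpow_sub_one_nonneg (div_nonneg hρ hc.le)) (two_rpow_sub_one_nonneg (div_nonneg hρ hd.le))]
  refine measureReal_congr ?_
  filter_upwards [ae_sinrAccess_pos hX, ae_snrBackhaul_pos hX] with ω hω hω'
  refine propext ?_
  change (loadVar X .sbs ω = n ∧ ω ∈ R ∧ (taggedBS p X ω).1 = .sbs) ↔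
    loadVar X .sbs ω = n ∧ (taggedBS p X ω).1 = .sbs ∧ _ < sinrAccess p X ω ∧ _ < snrBackhaul p X ω
  refine and_congr_right fun h1 => ?_
  rw [and_comm]
  refine and_congr_right fun h2 => ?_
  rw [hR ω h1 h2, lt_min_iff, lt_mul_logb_iff hc hω, lt_mul_logb_iff hd hω']

lemma one_sub_backhaulFraction {n M S : ℝ} (h : M + (n + S) ≠ 0) :
    1 - backhaulFraction n M S = (M + S) / (M + (n + S)) := by
  unfold backhaulFraction
  field_simp
  ring

/-- The association probabilities add up to 1, so all UEs of a backhaul cell are counted and the SBS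
density drops out. -/
lemma meanUsers_add (hX : IsNetwork p X P) :
    meanUsers p X P .mbs + meanBackhauledUsers p X P = p.userDensity / p.density .mbs := by
  rw [meanUsers_eq hX, meanBackhauledUsers_eq hX, ← add_div, mul_comm (assocFormula p .sbs),
    ← mul_add, assocFormula_add hX, mul_one]

lemma exists_hasSum_rateIRA (hX : IsNetwork p X P) {ρ : ℝ} (hρ : 0 ≤ ρ) : ∃ Sm Ss : ℝ,
    HasSum (fun n : ℕ+ =>
      accessCoverage p .mbs ((2 : ℝ) ^ (ρ / p.bandwidth *
        (n + assocFormula p .sbs * p.userDensity / p.density .mbs)) - 1) *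
        loadKt n (p.density .mbs / assocFormula p .mbs) p.userDensity) Sm ∧
    HasSum (fun n : ℕ+ =>
      accessCoverage p .sbs ((2 : ℝ) ^ (ρ * n / p.bandwidth *
        (1 + p.density .mbs * n / p.userDensity)) - 1) *
        backhaulCoverage p ((2 : ℝ) ^ (ρ * (n + p.userDensity / p.density .mbs) /
          p.bandwidth) - 1) *
        loadKt n (p.density .sbs / assocFormula p .sbs) p.userDensity) Ss ∧
    P.real {ω | ρ < rateIRA p X P ω} = assocFormula p .mbs * Sm + assocFormula p .sbs * Ss := by
  have hW := p.bandwidth_pos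
  have hlm := p.density_pos .mbs
  have hlu := p.userDensity_pos
  have hAs := assocFormula_pos hX .sbs
  refine exists_hasSum_rate hX (fun n => ?_) fun n => ?_
  · have hn : (0 : ℝ) < n := by exact_mod_cast n.pos
    have hS : 0 < meanBackhauledUsers p X P := by
      rw [meanBackhauledUsers_eq hX]
      positivity
    refine measureReal_rate_mbs hX hρ (c := p.bandwidth / (n + meanBackhauledUsers p X P))
      (by positivity) ?_ fun ω h1 h2 => ?_
    · rw [meanBackhauledUsers_eq hX, div_div_eq_mul_div, div_mul_eq_mul_div]
    · rw [Set.mem_ofPred_eq, rateIRA, h2]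
      simp only [h1]
  · have hn : (0 : ℝ) < n := by exact_mod_cast n.pos
    have hMS := meanUsers_add hX
    have hden : meanUsers p X P .mbs + (n + meanBackhauledUsers p X P) =
        n + p.userDensity / p.density .mbs := by rw [← hMS]; ring
    have hden0 : 0 < (n : ℝ) + p.userDensity / p.density .mbs := by positivity
    -- With M + S = λ_u/λ_m the backhaul share is n/(n + λ_u/λ_m) and the access share is the
    -- complement; dividing ρ by W/n times each share gives the two exponents.
    set w := backhaulFraction n (meanUsers p X P .mbs) (meanBackhauledUsers p X P) with hw
    have hw1 : w = n / (n + p.userDensity / p.density .mbs) := by rw [hw, backhaulFraction, hden]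
    have hw2 : 1 - w = p.userDensity / p.density .mbs / (n + p.userDensity / p.density .mbs) := by
      rw [hw, one_sub_backhaulFraction (hden ▸ hden0.ne'), hden, hMS]
    refine measureReal_rate_sbs hX hρ (c := p.bandwidth / n * (1 - w)) (d := p.bandwidth / n * w)
      (by rw [hw2]; positivity) (by rw [hw1]; positivity) ?_ ?_ fun ω h1 h2 => ?_
    · rw [hw2]
      field_simp
      ring
    · rw [hw1]
      field_simp
    · rw [Set.mem_ofPred_eq, rateIRA, h2]
      simp only [h1]
      rw [← hw, mul_min_of_nonneg _ _ (by positivity), ← mul_assoc, ← mul_assoc, min_comm]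

lemma exists_hasSum_rateORA (hX : IsNetwork p X P) {ρ η : ℝ} (hρ : 0 ≤ ρ) (hη : 0 < η)
    (hη1 : η < 1) : ∃ Sm Ss : ℝ,
    HasSum (fun n : ℕ+ =>
      accessCoverage p .mbs ((2 : ℝ) ^ (ρ * n / (η * p.bandwidth)) - 1) *
        loadKt n (p.density .mbs / assocFormula p .mbs) p.userDensity) Sm ∧
    HasSum (fun n : ℕ+ =>
      accessCoverage p .sbs ((2 : ℝ) ^ (ρ * n / (p.bandwidth * η)) - 1) *
        backhaulCoverage p ((2 : ℝ) ^ (ρ * (n + assocFormula p .sbs * p.userDensity /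
          p.density .mbs) / (p.bandwidth * (1 - η))) - 1) *
        loadKt n (p.density .sbs / assocFormula p .sbs) p.userDensity) Ss ∧
    P.real {ω | ρ < rateORA p X P η ω} = assocFormula p .mbs * Sm + assocFormula p .sbs * Ss := by
  have hW := p.bandwidth_pos
  have hlm := p.density_pos .mbs
  have hlu := p.userDensity_pos
  have hAs := assocFormula_pos hX .sbs
  have h1η : 0 < 1 - η := sub_pos.2 hη1
  have hS : 0 < meanBackhauledUsers p X P := by
    rw [meanBackhauledUsers_eq hX]
    positivity
  refine exists_hasSum_rate hX (fun n => ?_) fun n => ?_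
  · have hn : (0 : ℝ) < n := by exact_mod_cast n.pos
    refine measureReal_rate_mbs hX hρ (c := η * p.bandwidth / n)
      (by positivity) (div_div_eq_mul_div _ _ _) fun ω h1 h2 => ?_
    rw [Set.mem_ofPred_eq, rateORA, h2]
    simp only [h1]
  · have hn : (0 : ℝ) < n := by exact_mod_cast n.pos
    refine measureReal_rate_sbs hX hρ (c := η * p.bandwidth / n)
      (d := (1 - η) * p.bandwidth / (n + meanBackhauledUsers p X P))
      (by positivity) (by positivity) ?_ ?_ fun ω h1 h2 => ?_
    · rw [div_div_eq_mul_div, mul_comm η]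
    · rw [meanBackhauledUsers_eq hX, div_div_eq_mul_div, mul_comm (1 - η)]
    · rw [Set.mem_ofPred_eq, rateORA, h2]
      simp only [h1]

end Rates

end IAB

theorem mainTheorem1 {Ω : Type*} [MeasurableSpace Ω] (P : Measure Ω) [IsProbabilityMeasure P]
    (p : IAB.Params) (X : ∀ s : IAB.Source, Ω → s.Val) (hX : IAB.IsNetwork p X P) :
    let Am := IAB.assocFormula p .mbs
    let As := IAB.assocFormula p .sbs
    let lm := p.density .mbs
    let ls := p.density .sbs
    let lu := p.userDensity
    let W := p.bandwidth
    -- association probabilities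
    (∀ i, 0 < IAB.assocFormula p i ∧ IAB.assocProb p X P i = IAB.assocFormula p i) ∧
    -- MBS coverage
    (∀ τ, 0 ≤ τ → (P[|IAB.assocEvent p X .mbs]).real {ω | τ < IAB.sinrAccess p X ω} =
      IAB.accessCoverage p .mbs τ) ∧
    -- joint SBS and backhaul coverage
    (∀ τ₁ τ₂, 0 ≤ τ₁ → 0 ≤ τ₂ →
      (P[|IAB.assocEvent p X .sbs]).real {ω | τ₁ < IAB.sinrAccess p X ω} =
        IAB.accessCoverage p .sbs τ₁ ∧
      P.real {ω | τ₂ < IAB.snrBackhaul p X ω} = IAB.backhaulCoverage p τ₂ ∧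
      (P[|IAB.assocEvent p X .sbs]).real
          {ω | τ₁ < IAB.sinrAccess p X ω ∧ τ₂ < IAB.snrBackhaul p X ω} =
        IAB.accessCoverage p .sbs τ₁ * IAB.backhaulCoverage p τ₂) ∧
    -- rate coverage, integrated resource allocation
    (∀ ρ, 0 ≤ ρ → ∃ Sm Ss : ℝ,
      HasSum (fun n : ℕ+ =>
        IAB.accessCoverage p .mbs ((2 : ℝ) ^ (ρ / W * (n + As * lu / lm)) - 1) *
          IAB.loadKt n (lm / Am) lu) Sm ∧
      HasSum (fun n : ℕ+ =>
        IAB.accessCoverage p .sbs ((2 : ℝ) ^ (ρ * n / W * (1 + lm * n / lu)) - 1) *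
          IAB.backhaulCoverage p ((2 : ℝ) ^ (ρ * (n + lu / lm) / W) - 1) *
          IAB.loadKt n (ls / As) lu) Ss ∧
      P.real {ω | ρ < IAB.rateIRA p X P ω} = Am * Sm + As * Ss) ∧
    -- rate coverage, orthogonal resource allocation
    (∀ ρ η, 0 ≤ ρ → 0 < η → η < 1 → ∃ Sm Ss : ℝ,
      HasSum (fun n : ℕ+ =>
        IAB.accessCoverage p .mbs ((2 : ℝ) ^ (ρ * n / (η * W)) - 1) *
          IAB.loadKt n (lm / Am) lu) Sm ∧
      HasSum (fun n : ℕ+ =>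
        IAB.accessCoverage p .sbs ((2 : ℝ) ^ (ρ * n / (W * η)) - 1) *
          IAB.backhaulCoverage p ((2 : ℝ) ^ (ρ * (n + As * lu / lm) / (W * (1 - η))) - 1) *
          IAB.loadKt n (ls / As) lu) Ss ∧
      P.real {ω | ρ < IAB.rateORA p X P η ω} = Am * Sm + As * Ss) := by
  intro Am As lm ls lu W
  exact ⟨fun i => ⟨IAB.assocFormula_pos hX i, IAB.assocProb_eq hX i⟩,
    fun τ hτ => IAB.cond_sinrAccess hX .mbs hτ,
    fun τ₁ τ₂ h₁ h₂ => ⟨IAB.cond_sinrAccess hX .sbs h₁, IAB.measureReal_snrBackhaul hX h₂,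
      IAB.cond_sinrAccess_snrBackhaul hX .sbs h₁ h₂⟩,
    fun ρ hρ => IAB.exists_hasSum_rateIRA hX hρ,
    fun ρ η hρ hη hη1 => IAB.exists_hasSum_rateORA hX hρ hη hη1⟩
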